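/- Let $T>0$. For $\sigma\in L^1(\mathbb R^3)$ write $(-\Delta)^{-1}\sigma=\frac1{4\pi|x|}*\sigma$, so that $-\nabla(-\Delta)^{-1}\sigma=\frac{x}{4\pi|x|^3}*\sigma$; for $j\in L^1(\mathbb R^3;\mathbb R^3)$ write $(-\Delta)^{-1}\mathrm{div}\,j=\sum_k\partial_k\bigl(\frac1{4\pi|x|}\bigr)*j_k$. Let $b:(0,T)\times\mathbb R^6\to\mathbb R^6$ be a vector field and $t\in[0,T)$. A map $Z:[t,T]\times\mathbb R^6\to\mathbb R^6$, with $Z(s,\cdot)$ measurable for every $s$, is a regular Lagrangian flow of $b$ starting at time $t$ with compressibility constant $L$ if (1) for a.e. $z$, $s\mapsto Z(s,z)$ is an absolutely continuous integral solution of $\dot\beta(s)=b(s,\beta(s))$ on $[t,T]$ with $\beta(t)=z$, and (2) $\mathcal L^6(Z(s,\cdot)^{-1}(A))\le L\,\mathcal L^6(A)$ for all $s\in[t,T]$ and all Borel sets $A\subset\mathbb R^6$. For $\lambda>0$ its sublevel is $G_\lambda=\{z\in\mathbb R^6:\ |Z(s,z)|\le\lambda\text{ for a.e. }s\in[t,T]\}$.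 Let $B_r$ be the ball of $\mathbb R^6$ with centre $0$ and radius $r$. **Proposition.** Let $\rho\in L^\infty((0,T);L^1(\mathbb R^3))$ with $\rho\ge0$, let $\rho_b\in L^1\cap L^p(\mathbb R^3)$ for some $p>3/2$, and let $$E(t,x)=-\nabla_x(-\Delta_x)^{-1}\bigl(\rho(t,x)-\rho_b(x)\bigr)$$ (the repulsive case $\omega=+1$ in dimension $N=3$). Assume that $E\in L^\infty((0,T);L^2(\mathbb R^3))$ and that $$\partial_tE=\nabla_x(-\Delta_x)^{-1}\mathrm{div}_x J\quad\text{in the sense of distributions on }(0,T)\times\mathbb R^3$$ for some $J\in L^\infty((0,T);L^1(\mathbb R^3;\mathbb R^3))$. Then the vector field $b(t,x,v)=(v,E(t,x))$ satisfies condition (R1a): for each $L\ge 0$ there is a function $g(r,\lambda)$, with $g(r,\lambda)\to0$ as $\lambda\to\infty$ at fixed $r$, such that for all $t\in[0,T)$, all regular Lagrangian flows $Z$ of $b$ starting at time $t$ with compressibility constant $L$, and all $r,\lambda>0$, $$\mathcal L^6(B_r\setminus G_\lambda)\le g(r,\lambda).$$ Moreover $g$ depends only on $L$, $T$ and upper bounds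 for $\|E\|_{L^\infty_t(L^2_x)}$, $\|J\|_{L^\infty_t(L^1_x)}$ and $\|(-\Delta)^{-1}\rho_b\|_{L^\infty}$: one $g$ serves all $\rho,\rho_b,E,J$ as above that satisfy the same bounds. -/

import Mathlib

open MeasureTheory Set Filter Topology
open scoped ENNReal NNReal

noncomputable section

/-- The physical space `ℝ³` with its Euclidean norm. -/
abbrev Space3 : Type := EuclideanSpace ℝ (Fin 3)

/-- The phase space `ℝ³ₓ × ℝ³ᵥ`, with Lebesgue measure `volume` (the product measure).
Its Euclidean norm is `phaseNorm`; the sup norm of the product type is not used. -/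
abbrev Phase : Type := Space3 × Space3

/-- The Euclidean norm `|z| = (|x|² + |v|²)^{1/2}` of `z = (x, v) ∈ ℝ⁶`. -/
def phaseNorm (z : Phase) : ℝ := ‖WithLp.toLp 2 z‖

/-- The Euclidean ball `B_r` of `ℝ⁶` with centre `0` and radius `r`. -/
def phaseBall (r : ℝ) : Set Phase := {z | phaseNorm z < r}

/-- Lebesgue measure on `(0,T) × ℝ³`. -/
def slabMeasure (T : ℝ) : Measure (ℝ × Space3) :=
  (volume.restrict (Ioo 0 T)).prod volume

section Bochner

variable {F : Type*} [NormedAddCommGroup F]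

/-- The norm of `L^∞((0,T); L^q(ℝ³))`, with values in `[0,∞]`. -/
def normLinftyLq (T : ℝ) (q : ℝ≥0∞) (u : ℝ → Space3 → F) : ℝ≥0∞ :=
  essSup (fun t => eLpNorm (u t) q volume) (volume.restrict (Ioo 0 T))

/-- `u ∈ L^∞((0,T); L^q(ℝ³))`. -/
def MemLinftyLq (T : ℝ) (q : ℝ≥0∞) (u : ℝ → Space3 → F) : Prop :=
  AEStronglyMeasurable (fun p : ℝ × Space3 => u p.1 p.2) (slabMeasure T) ∧
    normLinftyLq T q u < ∞

end Bochner

/-- The kernel `x / (|S²| |x|³) = x / (4π |x|³)` of `-∇(-Δ)⁻¹` in `ℝ³`. -/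
def coulombKernel (x : Space3) : Space3 := (4 * Real.pi * ‖x‖ ^ 3)⁻¹ • x

/-- `(-Δ)⁻¹ σ`, the convolution of `σ` with `1 / (4π |x|)`. -/
def newtonPotential (σ : Space3 → ℝ) (x : Space3) : ℝ :=
  ∫ y, (4 * Real.pi * ‖x - y‖)⁻¹ * σ y

/-- `-∇(-Δ)⁻¹ σ`, the convolution of `σ` with `x / (4π |x|³)`. -/
def coulombField (σ : Space3 → ℝ) (x : Space3) : Space3 :=
  ∫ y, σ y • coulombKernel (x - y)

/-- `(-Δ)⁻¹ div j = ∑ₖ ∂ₖ(1 / (4π |x|)) * jₖ`; here `∇(1 / (4π |x|)) = -x / (4π |x|³)`. -/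
def invLaplacianDiv (j : Space3 → Space3) (x : Space3) : ℝ :=
  ∫ y, -inner ℝ (coulombKernel (x - y)) (j y)

/-- `∂ₜ E = ∇(-Δ)⁻¹ div J` in the sense of distributions on `(0,T) × ℝ³`, componentwise. -/
def IsWeakTimeDerivEq (T : ℝ) (E J : ℝ → Space3 → Space3) : Prop :=
  ∀ φ : ℝ × Space3 → ℝ, ContDiff ℝ (⊤ : ℕ∞) φ → HasCompactSupport φ →
    tsupport φ ⊆ Ioo 0 T ×ˢ univ → ∀ i : Fin 3,
      ∫ p, E p.1 p.2 i * fderiv ℝ φ p (1, 0) ∂(slabMeasure T) =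
        ∫ p, invLaplacianDiv (J p.1) p.2 * fderiv ℝ φ p (0, EuclideanSpace.single i 1)
          ∂(slabMeasure T)

/-- The vector field `b(t,x,v) = (v, E(t,x))` on phase space. -/
def vlasovField (E : ℝ → Space3 → Space3) (t : ℝ) (z : Phase) : Phase := (z.2, E t z.1)

/-- `Z` is a regular Lagrangian flow on `[t,T]` starting at time `t` for the vector field `b`, with
compressibility constant `L`. -/
structure IsRegularLagrangianFlow (b : ℝ → Phase → Phase) (t T : ℝ) (L : ℝ≥0)
    (Z : ℝ → Phase → Phase) : Prop where
  aemeasurable : ∀ s ∈ Icc t T, AEMeasurable (Z s) volume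
  /-- For almost every `z`, `s ↦ Z(s,z)` is an absolutely continuous integral solution of
  `β' = b(s,β)` on `[t,T]` with `β(t) = z`. -/
  integral_solution : ∀ᵐ z : Phase,
    IntegrableOn (fun τ => b τ (Z τ z)) (Icc t T) volume ∧
      ∀ s ∈ Icc t T, Z s z = z + ∫ τ in t..s, b τ (Z τ z)
  compression : ∀ s ∈ Icc t T, ∀ A : Set Phase, MeasurableSet A →
    volume (Z s ⁻¹' A) ≤ L * volume A

/-- The sublevel `G_ℓ` of the flow: the `z` with `|Z(s,z)| ≤ ℓ` for almost all `s ∈ [t,T]`. -/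
def flowSublevel (t T : ℝ) (Z : ℝ → Phase → Phase) (ℓ : ℝ) : Set Phase :=
  {z | ∀ᵐ s ∂(volume.restrict (Icc t T)), phaseNorm (Z s z) ≤ ℓ}

/-- Condition (R1a) for `b` on `[0,T]` and the compressibility constant `L`, with the function `g`:
the superlevels `B_r \ G_ℓ` of all regular Lagrangian flows of `b` with constant `L` have measure
at most `g r ℓ`, and `g r ℓ → 0` as `ℓ → ∞` at fixed `r`. -/
def ConditionR1a (b : ℝ → Phase → Phase) (T : ℝ) (L : ℝ≥0) (g : ℝ → ℝ → ℝ≥0) : Prop :=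
  (∀ r > 0, Tendsto (g r) atTop (𝓝 0)) ∧
    ∀ t ∈ Ico 0 T, ∀ Z : ℝ → Phase → Phase, IsRegularLagrangianFlow b t T L Z →
      ∀ r > 0, ∀ ℓ > 0, volume (phaseBall r \ flowSublevel t T Z ℓ) ≤ (g r ℓ : ℝ≥0∞)

end

/-!
Since `E = -∇U` for the potential `U = (-Δ)⁻¹ (ρ - ρ_b)`, and `∂ₜ E = ∇ F` for
`F = (-Δ)⁻¹ div J`, the gradient of `∂ₜ U + F` vanishes; as the potentials of integrable densities
tend to zero in mean at infinity, `∂ₜ U = -F`. Hence along a trajectory `(X, V)` of the flow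

`|V(s)|² / 2 + U(s, X(s)) = |V(s₁)|² / 2 + U(s₁, X(s₁)) - ∫ F(τ, X(τ)) dτ`.

The functions `U`, `F` and `E` are only locally integrable, so this is proved for mollified
potentials. The passage to the limit along almost every trajectory uses the compressibility of the
flow (`IsRegularLagrangianFlow.ae_energy_identity`).

The density `ρ` is nonnegative, hence `U` is bounded below by `-‖(-Δ)⁻¹ ρ_b‖_∞`, and the energy
dominates `h = 1 + |V|² / 2` up to a constant. Composing with `log (1 + log h)`, whose derivative
is `w = 1 / (h (1 + log h))`, bounds the growth of the velocity by the integral of `|F| w(V)`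
(`ofReal_logGrowth_le`). Integrated over the initial points in `B_r`, this is finite. Indeed
`|F| ≤ |K| * |J|` for the Coulomb kernel `K`, which is of size `|x|⁻²`. If it is split at a
distance `δ(v)` with `w ≤ 6 δ²`, then the distant part times `w` is bounded by `6 ‖J‖₁`. The near
part times `w` has an integral over phase space of at most a multiple of `‖J‖₁ ∫ δ(v)³ dv`. The
latter integral converges because of the logarithm in `w` (`absPot_mul_velWeight_le`,
`exists_lintegral_nearPot_le`).

It remains to control the energy at times `s₁` near the initial time. The initial velocity is
bounded in `B_r`, and the superlevels of `U(s₁)` are controlled by the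
Gagliardo-Nirenberg-Sobolev inequality in terms of `‖E‖₂` alone
(`exists_measure_potential_gt_le`). A trajectory from `B_r` which leaves the ball of radius `ℓ` has a
large velocity at some time, so that either the weighted integral of the source or the potential
`U(s₁)` is large. Chebyshev's inequality and the compressibility of the flow then bound the measure
of these trajectories (`volume_phaseBall_diff_flowSublevel_le`).
-/

noncomputable section

/-! ### Convolution with kernels of Coulomb type -/

/-- A kernel on `ℝ³` which is integrable near the origin and bounded by `1 / |x|` away from it.
The Newton kernel and the components of the Coulomb kernel are the examples of interest. -/
structure IsPotentialKernel (k : Space3 → ℝ) : Prop where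
  measurable : Measurable k
  lintegral_ball : ∫⁻ x in Metric.ball 0 1, ‖k x‖ₑ < ∞
  decay : ∀ x, 1 ≤ ‖x‖ → |k x| ≤ ‖x‖⁻¹

/-- The convolution `x ↦ ∫ s(y) k(x - y) dy`. -/
def kconv (k s : Space3 → ℝ) (x : Space3) : ℝ := ∫ y, s y * k (x - y)

/-- A bound for the integral of a translate of `k` over a ball of radius `R`. -/
def kernelBound (k : Space3 → ℝ) (R : ℝ) : ℝ≥0∞ :=
  (∫⁻ x in Metric.ball (0 : Space3) 1, ‖k x‖ₑ) + volume (Metric.ball (0 : Space3) R)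

namespace IsPotentialKernel

variable {k : Space3 → ℝ} (hk : IsPotentialKernel k)
include hk

lemma kernelBound_lt_top (R : ℝ) : kernelBound k R < ∞ :=
  ENNReal.add_lt_top.2 ⟨hk.lintegral_ball, measure_ball_lt_top⟩

lemma lintegral_translate_ball_le (c y : Space3) (R : ℝ) :
    ∫⁻ x in Metric.ball c R, ‖k (x - y)‖ₑ ≤ kernelBound k R := by
  have hm : Measurable fun x => ‖k (x - y)‖ₑ :=
    (hk.measurable.comp (measurable_id.sub_const y)).enorm
  have h1 : ∀ x, ‖k (x - y)‖ₑ ≤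
      (Metric.ball (0 : Space3) 1).indicator (fun x => ‖k x‖ₑ) (x - y) + 1 := by
    intro x
    by_cases hx : x - y ∈ Metric.ball (0 : Space3) 1
    · simp [indicator_of_mem hx]
    · rw [indicator_of_notMem hx, zero_add]
      have h : 1 ≤ ‖x - y‖ := by simpa using hx
      have h2 : |k (x - y)| ≤ 1 := (hk.decay _ h).trans (inv_le_one_of_one_le₀ h)
      rw [← ofReal_norm, Real.norm_eq_abs]
      simpa using ENNReal.ofReal_le_ofReal h2
  calc ∫⁻ x in Metric.ball c R, ‖k (x - y)‖ₑ
      ≤ ∫⁻ x in Metric.ball c R,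
          ((Metric.ball (0 : Space3) 1).indicator (fun x => ‖k x‖ₑ) (x - y) + 1) :=
        lintegral_mono h1
    _ = (∫⁻ x in Metric.ball c R,
          (Metric.ball (0 : Space3) 1).indicator (fun x => ‖k x‖ₑ) (x - y))
          + volume (Metric.ball c R) := by
        rw [lintegral_add_right _ measurable_const]; simp
    _ ≤ (∫⁻ x, (Metric.ball (0 : Space3) 1).indicator (fun x => ‖k x‖ₑ) (x - y))
          + volume (Metric.ball c R) := by
        gcongr; exact Measure.restrict_le_self
    _ = kernelBound k R := by
        rw [lintegral_sub_right_eq_self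
          (fun x => (Metric.ball (0 : Space3) 1).indicator (fun x => ‖k x‖ₑ) x),
          lintegral_indicator Metric.isOpen_ball.measurableSet, kernelBound,
          Measure.addHaar_ball_center]

/-- The decay of the kernel makes its integral over a ball of fixed radius vanish as the centre
moves to infinity. -/
lemma tendsto_lintegral_translate_ball (y : Space3) (R : ℝ) {c : ℕ → Space3}
    (hc : Tendsto (fun n => ‖c n‖) atTop atTop) :
    Tendsto (fun n => ∫⁻ x in Metric.ball (c n) R, ‖k (x - y)‖ₑ) atTop (𝓝 0) := by
  have hlim : Tendsto (fun n => ENNReal.ofReal ((‖c n‖ - (‖y‖ + R))⁻¹)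
      * volume (Metric.ball (0 : Space3) R)) atTop (𝓝 0) := by
    have h1 : Tendsto (fun n => (‖c n‖ - (‖y‖ + R))⁻¹) atTop (𝓝 0) :=
      tendsto_inv_atTop_zero.comp (tendsto_atTop_add_const_right _ _ hc)
    have h2 := ENNReal.tendsto_ofReal h1
    rw [ENNReal.ofReal_zero] at h2
    have h3 := ENNReal.Tendsto.mul_const h2
      (Or.inr (measure_ball_lt_top (μ := volume) (x := (0 : Space3)) (r := R)).ne)
    simpa using h3
  refine tendsto_of_tendsto_of_tendsto_of_le_of_le' tendsto_const_nhds hlim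
    (Eventually.of_forall fun _ => bot_le) ?_
  filter_upwards [hc.eventually_ge_atTop (‖y‖ + R + 1)] with n hn
  calc ∫⁻ x in Metric.ball (c n) R, ‖k (x - y)‖ₑ
      ≤ ∫⁻ x in Metric.ball (c n) R, ENNReal.ofReal ((‖c n‖ - (‖y‖ + R))⁻¹) := by
        refine setLIntegral_mono measurable_const fun x hx => ?_
        have hx' : ‖x - c n‖ < R := by simpa [dist_eq_norm] using hx
        have h1 : ‖c n‖ - (‖y‖ + R) ≤ ‖x - y‖ := by
          have h2 : c n = (x - y) + y - (x - c n) := by abel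
          have h3 : ‖c n‖ ≤ ‖x - y‖ + ‖y‖ + ‖x - c n‖ := by
            calc ‖c n‖ = ‖(x - y) + y - (x - c n)‖ := congrArg _ h2
              _ ≤ ‖(x - y) + y‖ + ‖x - c n‖ := norm_sub_le _ _
              _ ≤ _ := by gcongr; exact norm_add_le _ _
          linarith
        rw [← ofReal_norm, Real.norm_eq_abs]
        refine ENNReal.ofReal_le_ofReal ((hk.decay _ (by linarith)).trans ?_)
        exact inv_anti₀ (by linarith) h1
    _ = _ := by rw [setLIntegral_const, Measure.addHaar_ball_center]

lemma measurable_mul_translate {s : Space3 → ℝ} (hs : Measurable s) :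
    Measurable fun p : Space3 × Space3 => ‖s p.2‖ₑ * ‖k (p.1 - p.2)‖ₑ :=
  ((hs.comp measurable_snd).enorm).mul
    ((hk.measurable.comp (measurable_fst.sub measurable_snd)).enorm)

lemma lintegral_conv_swap {s : Space3 → ℝ} (hs : Measurable s) (c : Space3) (R : ℝ) :
    ∫⁻ x in Metric.ball c R, ∫⁻ y, ‖s y‖ₑ * ‖k (x - y)‖ₑ =
      ∫⁻ y, ‖s y‖ₑ * ∫⁻ x in Metric.ball c R, ‖k (x - y)‖ₑ := by
  rw [lintegral_lintegral_swap (hk.measurable_mul_translate hs).aemeasurable]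
  refine lintegral_congr fun y => ?_
  rw [lintegral_const_mul]
  exact (hk.measurable.comp (measurable_id.sub_const y)).enorm

lemma lintegral_conv_ball_le {s : Space3 → ℝ} (hs : Measurable s) (c : Space3) (R : ℝ) :
    ∫⁻ x in Metric.ball c R, ∫⁻ y, ‖s y‖ₑ * ‖k (x - y)‖ₑ ≤
      kernelBound k R * ∫⁻ y, ‖s y‖ₑ := by
  rw [hk.lintegral_conv_swap hs, mul_comm, ← lintegral_mul_const _ hs.enorm]
  gcongr with y
  exact hk.lintegral_translate_ball_le c y R

/-- The potential of an integrable density tends to zero at infinity in local mean. -/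
lemma tendsto_lintegral_conv_ball {s : Space3 → ℝ} (hs : Measurable s)
    (hsi : ∫⁻ y, ‖s y‖ₑ < ∞) (R : ℝ) {c : ℕ → Space3}
    (hc : Tendsto (fun n => ‖c n‖) atTop atTop) :
    Tendsto (fun n => ∫⁻ x in Metric.ball (c n) R, ∫⁻ y, ‖s y‖ₑ * ‖k (x - y)‖ₑ)
      atTop (𝓝 0) := by
  simp_rw [hk.lintegral_conv_swap hs]
  have hm : ∀ n, Measurable fun y => ∫⁻ x in Metric.ball (c n) R, ‖k (x - y)‖ₑ := fun n =>
    Measurable.lintegral_prod_left'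
      (f := fun p : Space3 × Space3 => ‖k (p.1 - p.2)‖ₑ)
      ((hk.measurable.comp (measurable_fst.sub measurable_snd)).enorm)
  have := tendsto_lintegral_of_dominated_convergence (μ := (volume : Measure Space3))
    (F := fun n y => ‖s y‖ₑ * ∫⁻ x in Metric.ball (c n) R, ‖k (x - y)‖ₑ) (f := fun _ => 0)
    (fun y => ‖s y‖ₑ * kernelBound k R) (fun n => hs.enorm.mul (hm n))
    (fun n => Eventually.of_forall fun y => by
      exact mul_le_mul_right (hk.lintegral_translate_ball_le _ _ _) _)
    (by
      rw [lintegral_mul_const _ hs.enorm]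
      exact (ENNReal.mul_lt_top hsi (hk.kernelBound_lt_top R)).ne)
    (Eventually.of_forall fun y => by
      have := ENNReal.Tendsto.const_mul (a := ‖s y‖ₑ)
        (hk.tendsto_lintegral_translate_ball y R hc) (Or.inr enorm_ne_top)
      simpa using this)
  simpa using this

omit hk in
lemma enorm_kconv_le (s : Space3 → ℝ) (x : Space3) :
    ‖kconv k s x‖ₑ ≤ ∫⁻ y, ‖s y‖ₑ * ‖k (x - y)‖ₑ := by
  refine (enorm_integral_le_lintegral_enorm _).trans (le_of_eq ?_)
  simp_rw [enorm_mul]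

lemma ae_lintegral_conv_lt_top {s : Space3 → ℝ} (hs : Measurable s)
    (hsi : ∫⁻ y, ‖s y‖ₑ < ∞) : ∀ᵐ x, ∫⁻ y, ‖s y‖ₑ * ‖k (x - y)‖ₑ < ∞ := by
  have hm : Measurable fun x => ∫⁻ y, ‖s y‖ₑ * ‖k (x - y)‖ₑ :=
    (hk.measurable_mul_translate hs).lintegral_prod_right'
  have h : ∀ n : ℕ, ∀ᵐ x, x ∈ Metric.ball (0 : Space3) n → ∫⁻ y, ‖s y‖ₑ * ‖k (x - y)‖ₑ < ∞ := by
    intro n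
    rw [← ae_restrict_iff' Metric.isOpen_ball.measurableSet]
    refine ae_lt_top hm (ne_of_lt ?_)
    exact (hk.lintegral_conv_ball_le hs 0 n).trans_lt
      (ENNReal.mul_lt_top (hk.kernelBound_lt_top _) hsi)
  filter_upwards [ae_all_iff.2 h] with x hx
  obtain ⟨n, hn⟩ := exists_nat_gt ‖x‖
  exact hx n (by simpa using hn)

lemma integrable_mul_translate {s : Space3 → ℝ} (hs : Measurable s) {x : Space3}
    (hx : ∫⁻ y, ‖s y‖ₑ * ‖k (x - y)‖ₑ < ∞) : Integrable fun y => s y * k (x - y) := by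
  refine ⟨(hs.mul (hk.measurable.comp (measurable_const.sub measurable_id))).aestronglyMeasurable,
    ?_⟩
  simpa only [HasFiniteIntegral, enorm_mul] using hx

lemma measurable_kconv {s : Space3 → ℝ} (hs : Measurable s) : Measurable (kconv k s) := by
  have : StronglyMeasurable fun p : Space3 × Space3 => s p.2 * k (p.1 - p.2) :=
    ((hs.comp measurable_snd).mul
      (hk.measurable.comp (measurable_fst.sub measurable_snd))).stronglyMeasurable
  exact this.integral_prod_right.measurable

lemma integrableOn_kconv_ball {s : Space3 → ℝ} (hs : Measurable s)
    (hsi : ∫⁻ y, ‖s y‖ₑ < ∞) (c : Space3) (R : ℝ) :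
    IntegrableOn (kconv k s) (Metric.ball c R) := by
  refine ⟨(hk.measurable_kconv hs).aestronglyMeasurable, ?_⟩
  calc ∫⁻ x in Metric.ball c R, ‖kconv k s x‖ₑ
      ≤ ∫⁻ x in Metric.ball c R, ∫⁻ y, ‖s y‖ₑ * ‖k (x - y)‖ₑ :=
        lintegral_mono fun x => enorm_kconv_le s x
    _ ≤ _ := hk.lintegral_conv_ball_le hs c R
    _ < ∞ := ENNReal.mul_lt_top (hk.kernelBound_lt_top R) hsi

lemma locallyIntegrable_kconv {s : Space3 → ℝ} (hs : Measurable s)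
    (hsi : ∫⁻ y, ‖s y‖ₑ < ∞) : LocallyIntegrable (kconv k s) := fun x =>
  ⟨Metric.ball x 1, Metric.ball_mem_nhds x one_pos, hk.integrableOn_kconv_ball hs hsi x 1⟩

/-- Fubini's theorem for the pairing of a potential with a test function. -/
lemma integral_kconv_mul {s : Space3 → ℝ} (hs : Measurable s)
    (hsi : ∫⁻ y, ‖s y‖ₑ < ∞) {ψ : Space3 → ℝ} (hψ : Continuous ψ) (hψc : HasCompactSupport ψ) :
    ∫ x, kconv k s x * ψ x = ∫ y, s y * ∫ x, k (x - y) * ψ x := by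
  obtain ⟨M, hM⟩ := hψ.bounded_above_of_compact_support hψc
  obtain ⟨R, hR⟩ := hψc.isCompact.isBounded.subset_ball (0 : Space3)
  have hR' : ∀ x, x ∉ Metric.ball (0 : Space3) R → ψ x = 0 := fun x hx =>
    image_eq_zero_of_notMem_tsupport fun h => hx (hR h)
  have hint : Integrable (Function.uncurry fun x y : Space3 => s y * k (x - y) * ψ x)
      (volume.prod volume) := by
    have hmeas : Measurable (Function.uncurry fun x y : Space3 => s y * k (x - y) * ψ x) :=
      (((hs.comp measurable_snd).mul (hk.measurable.comp (measurable_fst.sub measurable_snd))).mul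
        (hψ.measurable.comp measurable_fst))
    refine ⟨hmeas.aestronglyMeasurable, ?_⟩
    rw [HasFiniteIntegral, lintegral_prod _ hmeas.enorm.aemeasurable]
    calc ∫⁻ x, ∫⁻ y, ‖Function.uncurry (fun x y : Space3 => s y * k (x - y) * ψ x) (x, y)‖ₑ
        ≤ ∫⁻ x, (Metric.ball (0 : Space3) R).indicator
            (fun x => ENNReal.ofReal M * ∫⁻ y, ‖s y‖ₑ * ‖k (x - y)‖ₑ) x := by
          refine lintegral_mono fun x => ?_
          by_cases hx : x ∈ Metric.ball (0 : Space3) R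
          · rw [indicator_of_mem hx]
            dsimp only
            have hmx : Measurable fun y => ‖s y‖ₑ * ‖k (x - y)‖ₑ :=
              (hk.measurable_mul_translate hs).comp measurable_prodMk_left
            rw [← lintegral_const_mul _ hmx]
            refine lintegral_mono fun y => ?_
            simp only [Function.uncurry, enorm_mul]
            rw [mul_comm]
            gcongr
            rw [← ofReal_norm]
            exact ENNReal.ofReal_le_ofReal (hM x)
          · simp [-enorm_mul, Function.uncurry, hR' x hx]
      _ = ENNReal.ofReal M * ∫⁻ x in Metric.ball (0 : Space3) R, ∫⁻ y, ‖s y‖ₑ * ‖k (x - y)‖ₑ := by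
          rw [lintegral_indicator Metric.isOpen_ball.measurableSet, lintegral_const_mul]
          exact (hk.measurable_mul_translate hs).lintegral_prod_right'
      _ < ∞ := ENNReal.mul_lt_top ENNReal.ofReal_lt_top
          ((hk.lintegral_conv_ball_le hs 0 R).trans_lt
            (ENNReal.mul_lt_top (hk.kernelBound_lt_top R) hsi))
  calc ∫ x, kconv k s x * ψ x = ∫ x, ∫ y, s y * k (x - y) * ψ x := by
        refine integral_congr_ae (Eventually.of_forall fun x => ?_)
        simp only [kconv, integral_mul_const]
    _ = ∫ y, ∫ x, s y * k (x - y) * ψ x := integral_integral_swap hint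
    _ = _ := by
        refine integral_congr_ae (Eventually.of_forall fun y => ?_)
        simp only [mul_assoc, integral_const_mul]

lemma integrable_translate_mul {ψ : Space3 → ℝ} (hψ : Continuous ψ) (hψc : HasCompactSupport ψ)
    (y : Space3) : Integrable fun x => k (x - y) * ψ x := by
  obtain ⟨M, hM⟩ := hψ.bounded_above_of_compact_support hψc
  obtain ⟨R, hR⟩ := hψc.isCompact.isBounded.subset_ball (0 : Space3)
  have hkm : Measurable fun x => k (x - y) := hk.measurable.comp (measurable_id.sub_const y)
  have h1 : IntegrableOn (fun x => k (x - y)) (Metric.ball (0 : Space3) R) :=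
    ⟨hkm.aestronglyMeasurable,
      (hk.lintegral_translate_ball_le 0 y R).trans_lt (hk.kernelBound_lt_top R)⟩
  have h2 : IntegrableOn (fun x => k (x - y) * ψ x) (Metric.ball (0 : Space3) R) :=
    h1.mul_bdd hψ.aestronglyMeasurable (Eventually.of_forall hM)
  refine (integrableOn_iff_integrable_of_support_subset fun x hx => ?_).1 h2
  exact hR (subset_tsupport _ (right_ne_zero_of_mul hx))

end IsPotentialKernel

/-! ### The Newton and Coulomb kernels -/

/-- The Newton kernel `1 / (4π |x|)`. -/
def newtonKernel (x : Space3) : ℝ := (4 * Real.pi * ‖x‖)⁻¹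

lemma norm_coulombKernel (x : Space3) : ‖coulombKernel x‖ = (4 * Real.pi * ‖x‖ ^ 2)⁻¹ := by
  rcases eq_or_ne x 0 with rfl | hx
  · simp [coulombKernel]
  have hx' : 0 < ‖x‖ := norm_pos_iff.2 hx
  have := Real.pi_pos
  rw [coulombKernel, norm_smul, Real.norm_of_nonneg (by positivity)]
  field_simp

lemma measurable_newtonKernel : Measurable newtonKernel := by
  unfold newtonKernel; fun_prop

lemma measurable_coulombKernel : Measurable coulombKernel := by
  unfold coulombKernel; fun_prop

/-- The Coulomb kernel has mass proportional to `δ` in the ball of radius `δ`. -/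
lemma lintegral_coulombKernel_ball : ∃ c : ℝ≥0, ∀ δ : ℝ, 0 ≤ δ →
    ∫⁻ x in Metric.ball (0 : Space3) δ, ‖coulombKernel x‖ₑ ≤ c * ENNReal.ofReal δ := by
  have hpi := Real.pi_pos
  refine ⟨(∫⁻ x in Metric.ball (0 : Space3) 1, ‖coulombKernel x‖ₑ).toNNReal, fun δ hδ => ?_⟩
  have hfin : ∫⁻ x in Metric.ball (0 : Space3) 1, ‖coulombKernel x‖ₑ ≠ ∞ := by
    have hi : IntegrableOn (fun x : Space3 => (4 * Real.pi * ‖x‖ ^ 2)⁻¹)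
        (Metric.ball (0 : Space3) 1) := by
      rw [integrableOn_fun_norm_addHaar volume (f := fun r => (4 * Real.pi * r ^ 2)⁻¹)]
      have : IntegrableOn (fun _ : ℝ => (4 * Real.pi)⁻¹) (Ioo 0 1) := by
        exact integrableOn_const (by simp)
      refine this.congr_fun (fun y hy => ?_) measurableSet_Ioo
      have hy0 : 0 < y := hy.1
      simp only [finrank_euclideanSpace, Fintype.card_fin, smul_eq_mul]
      field_simp
    have h2 := hi.2
    rw [HasFiniteIntegral] at h2
    refine (lt_of_le_of_lt (lintegral_mono fun x => ?_) h2).ne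
    rw [← ofReal_norm, norm_coulombKernel, ← ofReal_norm]
    exact ENNReal.ofReal_le_ofReal (le_abs_self _)
  rw [ENNReal.coe_toNNReal hfin]
  rcases hδ.eq_or_lt with rfl | hδ
  · simp
  -- The general radius follows from the unit radius by scaling.
  have hmap := Measure.map_addHaar_smul (volume : Measure Space3) (inv_pos.2 hδ).ne'
  have hme : MeasurableEmbedding fun x : Space3 => δ⁻¹ • x :=
    (Homeomorph.smulOfNeZero δ⁻¹ (inv_pos.2 hδ).ne').measurableEmbedding
  have hker : ∀ x : Space3, ‖coulombKernel x‖ₑ =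
      ENNReal.ofReal (δ⁻¹ ^ 2) * ‖coulombKernel (δ⁻¹ • x)‖ₑ := by
    intro x
    rw [← ofReal_norm, ← ofReal_norm, ← ENNReal.ofReal_mul (by positivity), norm_coulombKernel,
      norm_coulombKernel, norm_smul, Real.norm_of_nonneg (inv_nonneg.2 hδ.le)]
    congr 1
    rcases eq_or_ne x 0 with rfl | hx
    · simp
    have hx' : 0 < ‖x‖ := norm_pos_iff.2 hx
    field_simp
  have hpre : (fun x : Space3 => δ⁻¹ • x) ⁻¹' Metric.ball 0 1 = Metric.ball 0 δ := by
    ext x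
    simp only [mem_preimage, mem_ball_zero_iff, norm_smul, Real.norm_of_nonneg (inv_nonneg.2 hδ.le)]
    rw [inv_mul_lt_one₀ hδ]
  have hcv : ∫⁻ x in Metric.ball (0 : Space3) δ, ‖coulombKernel (δ⁻¹ • x)‖ₑ =
      ENNReal.ofReal (δ ^ 3) * ∫⁻ x in Metric.ball (0 : Space3) 1, ‖coulombKernel x‖ₑ := by
    rw [← hpre, ← hme.lintegral_map (fun x => ‖coulombKernel x‖ₑ) , ← hme.restrict_map, hmap]
    rw [Measure.restrict_smul, lintegral_smul_measure, smul_eq_mul]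
    congr 2
    simp only [finrank_euclideanSpace, Fintype.card_fin, inv_pow, inv_inv]
    exact abs_of_pos (by positivity)
  calc ∫⁻ x in Metric.ball (0 : Space3) δ, ‖coulombKernel x‖ₑ
      = ENNReal.ofReal (δ⁻¹ ^ 2) * (ENNReal.ofReal (δ ^ 3) *
          ∫⁻ x in Metric.ball (0 : Space3) 1, ‖coulombKernel x‖ₑ) := by
        have hm : Measurable fun x : Space3 => ‖coulombKernel (δ⁻¹ • x)‖ₑ :=
          (measurable_coulombKernel.comp (measurable_const_smul _)).enorm
        rw [← hcv, ← lintegral_const_mul _ hm]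
        exact lintegral_congr fun x => hker x
    _ = (∫⁻ x in Metric.ball (0 : Space3) 1, ‖coulombKernel x‖ₑ) * ENNReal.ofReal δ := by
        rw [← mul_assoc, ← ENNReal.ofReal_mul (by positivity), mul_comm]
        congr 2
        field_simp
    _ ≤ _ := le_rfl

/-- The Newton kernel is dominated by the Coulomb kernel in the unit ball. -/
lemma newtonKernel_le_norm_coulombKernel {x : Space3} (hx : ‖x‖ ≤ 1) :
    newtonKernel x ≤ ‖coulombKernel x‖ := by
  rw [norm_coulombKernel, newtonKernel]
  rcases eq_or_ne x 0 with rfl | hx0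
  · simp
  have hx' : 0 < ‖x‖ := norm_pos_iff.2 hx0
  have := Real.pi_pos
  refine inv_anti₀ (by positivity) ?_
  gcongr
  nlinarith

lemma newtonKernel_nonneg (x : Space3) : 0 ≤ newtonKernel x := by
  unfold newtonKernel; have := Real.pi_pos; positivity

lemma isPotentialKernel_of_norm_le {k : Space3 → ℝ} (hm : Measurable k)
    (h1 : ∀ x, ‖x‖ ≤ 1 → |k x| ≤ ‖coulombKernel x‖) (h2 : ∀ x, 1 ≤ ‖x‖ → |k x| ≤ ‖x‖⁻¹) :
    IsPotentialKernel k where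
  measurable := hm
  decay := h2
  lintegral_ball := by
    obtain ⟨c, hc⟩ := lintegral_coulombKernel_ball
    refine lt_of_le_of_lt ?_ ((hc 1 zero_le_one).trans_lt (by simp))
    refine setLIntegral_mono measurable_coulombKernel.enorm fun x hx => ?_
    rw [← ofReal_norm, ← ofReal_norm]
    exact ENNReal.ofReal_le_ofReal (h1 x (by simpa using (mem_ball_zero_iff.1 hx).le))

lemma isPotentialKernel_newtonKernel : IsPotentialKernel newtonKernel := by
  refine isPotentialKernel_of_norm_le measurable_newtonKernel (fun x hx => ?_) (fun x hx => ?_)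
  · rw [abs_of_nonneg (newtonKernel_nonneg x)]
    exact newtonKernel_le_norm_coulombKernel hx
  · rw [abs_of_nonneg (newtonKernel_nonneg x), newtonKernel]
    refine inv_anti₀ (by linarith) ?_
    nlinarith [Real.pi_gt_three]

lemma norm_coulombKernel_le_inv {x : Space3} (hx : 1 ≤ ‖x‖) : ‖coulombKernel x‖ ≤ ‖x‖⁻¹ := by
  rw [norm_coulombKernel]
  refine inv_anti₀ (by linarith) ?_
  have h := Real.pi_gt_three
  have h2 : ‖x‖ ≤ ‖x‖ ^ 2 := by nlinarith
  nlinarith [sq_nonneg ‖x‖]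

lemma isPotentialKernel_coulombKernel (i : Fin 3) :
    IsPotentialKernel fun x => coulombKernel x i := by
  have h : ∀ x, |coulombKernel x i| ≤ ‖coulombKernel x‖ := fun x =>
    (PiLp.norm_apply_le (coulombKernel x) i)
  refine isPotentialKernel_of_norm_le ?_ (fun x _ => h x)
    (fun x hx => (h x).trans (norm_coulombKernel_le_inv hx))
  exact (EuclideanSpace.proj (𝕜 := ℝ) i).continuous.measurable.comp measurable_coulombKernel

lemma isPotentialKernel_norm_coulombKernel :
    IsPotentialKernel fun x => ‖coulombKernel x‖ :=
  isPotentialKernel_of_norm_le measurable_coulombKernel.norm (fun x _ => by simp)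
    (fun x hx => by simpa using norm_coulombKernel_le_inv hx)

lemma newtonPotential_eq_kconv (s : Space3 → ℝ) : newtonPotential s = kconv newtonKernel s := by
  ext x
  simp only [newtonPotential, kconv, newtonKernel, mul_comm]

/-! ### The gradient of the Newton potential -/

/-- The smooth kernel `1 / (4π (|x|² + ε²)^{1/2})`. -/
def regKernel (ε : ℝ) (x : Space3) : ℝ := (4 * Real.pi * √(‖x‖ ^ 2 + ε ^ 2))⁻¹

lemma hasFDerivAt_regKernel {ε : ℝ} (hε : 0 < ε) (x : Space3) :
    HasFDerivAt (regKernel ε)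
      (-(4 * Real.pi * √(‖x‖ ^ 2 + ε ^ 2) ^ 3)⁻¹ • innerSL ℝ x) x := by
  have hpi := Real.pi_pos
  have hpos : 0 < ‖x‖ ^ 2 + ε ^ 2 := by positivity
  have h1 : HasFDerivAt (fun x : Space3 => ‖x‖ ^ 2 + ε ^ 2) (2 • innerSL ℝ x) x :=
    (hasStrictFDerivAt_norm_sq x).hasFDerivAt.add_const _
  have h2 := ((Real.hasDerivAt_sqrt hpos.ne').const_mul (4 * Real.pi)).inv
    (mul_pos (by positivity) (Real.sqrt_pos.2 hpos)).ne'
  have h3 := h2.comp_hasFDerivAt x h1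
  refine HasFDerivAt.congr_fderiv (f := regKernel ε) h3 ?_
  have hs : √(‖x‖ ^ 2 + ε ^ 2) ≠ 0 := (Real.sqrt_pos.2 hpos).ne'
  ext v
  simp only [smul_apply, smul_eq_mul, nsmul_eq_mul, Nat.cast_ofNat]
  field_simp

lemma regKernel_nonneg (ε : ℝ) (x : Space3) : 0 ≤ regKernel ε x := by
  unfold regKernel; have := Real.pi_pos; positivity

lemma norm_le_sqrt_add_sq (ε : ℝ) (x : Space3) : ‖x‖ ≤ √(‖x‖ ^ 2 + ε ^ 2) :=
  Real.le_sqrt_of_sq_le (by nlinarith [sq_nonneg ε])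

lemma regKernel_le (ε : ℝ) {x : Space3} (hx : x ≠ 0) : regKernel ε x ≤ newtonKernel x := by
  have hx' : 0 < ‖x‖ := norm_pos_iff.2 hx
  have := Real.pi_pos
  refine inv_anti₀ (by positivity) ?_
  gcongr
  exact norm_le_sqrt_add_sq ε x

/-- `∇N = -K` in the sense of distributions. -/
lemma integral_newtonKernel_mul_fderiv {ψ : Space3 → ℝ} (hψ : ContDiff ℝ 1 ψ)
    (hψc : HasCompactSupport ψ) (i : Fin 3) (y : Space3) :
    ∫ x, newtonKernel (x - y) * fderiv ℝ ψ x (EuclideanSpace.single i 1) =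
      ∫ x, coulombKernel (x - y) i * ψ x := by
  have hpi := Real.pi_pos
  set e : Space3 := EuclideanSpace.single i 1
  set ε : ℕ → ℝ := fun n => 1 / ((n : ℝ) + 1)
  have hε : ∀ n, 0 < ε n := fun n => by positivity
  have hε0 : Tendsto ε atTop (𝓝 0) := tendsto_one_div_add_atTop_nhds_zero_nat
  have hsqrt : ∀ x : Space3, Tendsto (fun n => √(‖x‖ ^ 2 + ε n ^ 2)) atTop (𝓝 ‖x‖) := fun x => by
    have : Tendsto (fun n => √(‖x‖ ^ 2 + ε n ^ 2)) atTop (𝓝 √(‖x‖ ^ 2 + 0 ^ 2)) :=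
      (Real.continuous_sqrt.tendsto _).comp (tendsto_const_nhds.add (hε0.pow 2))
    simpa using this
  have hDc : Continuous fun x => fderiv ℝ ψ x e :=
    (hψ.continuous_fderiv one_ne_zero).clm_apply continuous_const
  have hDs : HasCompactSupport fun x => fderiv ℝ ψ x e := hψc.fderiv_apply ℝ e
  have hne : ∀ᵐ x : Space3, x - y ≠ 0 := by
    filter_upwards [compl_mem_ae_iff.2 (measure_singleton (μ := volume) y)] with x hx
    exact sub_ne_zero.2 hx
  let c : ℕ → Space3 → ℝ := fun n x => (4 * Real.pi * √(‖x‖ ^ 2 + ε n ^ 2) ^ 3)⁻¹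
  have hcne : ∀ n (x : Space3), 4 * Real.pi * √(‖x‖ ^ 2 + ε n ^ 2) ^ 3 ≠ 0 := fun n x => by
    have : 0 < √(‖x‖ ^ 2 + ε n ^ 2) := Real.sqrt_pos.2 (by have := hε n; positivity)
    positivity
  have hsc : ∀ n, Continuous fun x : Space3 => √(‖x‖ ^ 2 + ε n ^ 2) := fun n => by fun_prop
  have hcc : ∀ n, Continuous (c n) := fun n =>
    (continuous_const.mul ((hsc n).pow 3)).inv₀ (hcne n)
  have hNc : ∀ n, Continuous (regKernel (ε n)) := fun n =>
    continuous_iff_continuousAt.2 fun x => (hasFDerivAt_regKernel (hε n) x).continuousAt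
  -- Integration by parts for the regularised kernel.
  have hparts : ∀ n, ∫ x, regKernel (ε n) (x - y) * fderiv ℝ ψ x e =
      ∫ x, c n (x - y) * (x - y) i * ψ x := by
    intro n
    have hd : ∀ x, HasFDerivAt (fun x => regKernel (ε n) (x - y))
        (-(c n (x - y)) • innerSL ℝ (x - y)) x := fun x =>
      (hasFDerivAt_comp_sub y).2 (hasFDerivAt_regKernel (hε n) (x - y))
    have hfd : ∀ x, fderiv ℝ (fun x => regKernel (ε n) (x - y)) x e =
        -(c n (x - y) * (x - y) i) := fun x => by
      rw [(hd x).fderiv]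
      simp only [smul_apply, innerSL_apply_apply, smul_eq_mul, e,
        EuclideanSpace.inner_single_right]
      simp
    have hcoord : Continuous fun x : Space3 => (x - y) i :=
      (EuclideanSpace.proj (𝕜 := ℝ) i).continuous.comp (continuous_id.sub continuous_const)
    have hC : Continuous fun x => c n (x - y) := (hcc n).comp (continuous_id.sub continuous_const)
    have hNC : Continuous fun x => regKernel (ε n) (x - y) :=
      (hNc n).comp (continuous_id.sub continuous_const)
    rw [integral_mul_fderiv_eq_neg_fderiv_mul_of_integrable]
    · simp_rw [hfd, neg_mul, integral_neg, neg_neg]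
    · simp_rw [hfd]
      exact ((hC.mul hcoord).neg.mul hψ.continuous).integrable_of_hasCompactSupport hψc.mul_left
    · exact (hNC.mul hDc).integrable_of_hasCompactSupport hDs.mul_left
    · exact (hNC.mul hψ.continuous).integrable_of_hasCompactSupport hψc.mul_left
    · exact fun x _ => (hd x).differentiableAt
    · exact fun x _ => hψ.differentiable one_ne_zero x
  have hL : Tendsto (fun n => ∫ x, regKernel (ε n) (x - y) * fderiv ℝ ψ x e) atTop
      (𝓝 (∫ x, newtonKernel (x - y) * fderiv ℝ ψ x e)) := by
    refine tendsto_integral_of_dominated_convergence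
      (fun x => ‖newtonKernel (x - y) * fderiv ℝ ψ x e‖) (fun n => ?_)
      (isPotentialKernel_newtonKernel.integrable_translate_mul hDc hDs y).norm (fun n => ?_) ?_
    · exact (((hNc n).comp (continuous_id.sub continuous_const)).mul hDc).aestronglyMeasurable
    · filter_upwards [hne] with x hx
      rw [norm_mul, norm_mul, Real.norm_of_nonneg (regKernel_nonneg _ _),
        Real.norm_of_nonneg (newtonKernel_nonneg _)]
      gcongr
      exact regKernel_le _ hx
    · filter_upwards [hne] with x hx
      refine Tendsto.mul_const _ ?_
      exact ((hsqrt (x - y)).const_mul _).inv₀ (by have := norm_pos_iff.2 hx; positivity)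
  have hR : Tendsto (fun n => ∫ x, c n (x - y) * (x - y) i * ψ x) atTop
      (𝓝 (∫ x, coulombKernel (x - y) i * ψ x)) := by
    refine tendsto_integral_of_dominated_convergence
      (fun x => ‖coulombKernel (x - y) i * ψ x‖) (fun n => ?_)
      ((isPotentialKernel_coulombKernel i).integrable_translate_mul hψ.continuous hψc y).norm
      (fun n => ?_) ?_
    · have hcoord : Continuous fun x : Space3 => (x - y) i :=
        (EuclideanSpace.proj (𝕜 := ℝ) i).continuous.comp (continuous_id.sub continuous_const)
      exact ((((hcc n).comp (continuous_id.sub continuous_const)).mul hcoord).mul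
        hψ.continuous).aestronglyMeasurable
    · filter_upwards [hne] with x hx
      have hx' := norm_pos_iff.2 hx
      rw [norm_mul, norm_mul, norm_mul]
      simp only [coulombKernel, PiLp.smul_apply, smul_eq_mul, norm_mul]
      gcongr
      rw [Real.norm_of_nonneg (by positivity), Real.norm_of_nonneg (by positivity)]
      refine inv_anti₀ (by positivity) ?_
      gcongr
      exact norm_le_sqrt_add_sq _ _
    · filter_upwards [hne] with x hx
      have hx' := norm_pos_iff.2 hx
      refine Tendsto.mul_const _ ?_
      simp only [coulombKernel, PiLp.smul_apply, smul_eq_mul]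
      refine Tendsto.mul_const _ ?_
      exact (((hsqrt (x - y)).pow 3).const_mul _).inv₀ (by positivity)
  simp_rw [hparts] at hL
  exact tendsto_nhds_unique hL hR

/-- `∇(N * s) = -(K * s)` in the sense of distributions. -/
lemma integral_kconv_newtonKernel_mul_fderiv {s : Space3 → ℝ} (hs : Measurable s)
    (hsi : ∫⁻ y, ‖s y‖ₑ < ∞) {ψ : Space3 → ℝ} (hψ : ContDiff ℝ 1 ψ)
    (hψc : HasCompactSupport ψ) (i : Fin 3) :
    ∫ x, kconv newtonKernel s x * fderiv ℝ ψ x (EuclideanSpace.single i 1) =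
      ∫ x, kconv (fun x => coulombKernel x i) s x * ψ x := by
  rw [isPotentialKernel_newtonKernel.integral_kconv_mul hs hsi
      ((hψ.continuous_fderiv one_ne_zero).clm_apply continuous_const) (hψc.fderiv_apply ℝ _),
    (isPotentialKernel_coulombKernel i).integral_kconv_mul hs hsi hψ.continuous hψc]
  simp_rw [integral_newtonKernel_mul_fderiv hψ hψc]

/-! ### Potentials on space-time -/

/-- A density on `(0,T) × ℝ³`, extended by zero, which is bounded by `M` in `L^∞_t L^1_x`;
all conditions hold at every time. -/
structure IsSlabDensity (T : ℝ) (M : ℝ≥0) (s : ℝ → Space3 → ℝ) : Prop where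
  measurable : Measurable fun p : ℝ × Space3 => s p.1 p.2
  lintegral_le : ∀ t, ∫⁻ y, ‖s t y‖ₑ ≤ M
  eq_zero : ∀ t, t ∉ Ioo 0 T → s t = 0

/-- The potential of `|s|` with kernel `|k|`, at every time. -/
def absPot (k : Space3 → ℝ) (s : ℝ → Space3 → ℝ) (p : ℝ × Space3) : ℝ≥0∞ :=
  ∫⁻ y, ‖s p.1 y‖ₑ * ‖k (p.2 - y)‖ₑ

/-- Integrability over cylinders `ℝ × B(c,R)` together with the convergence to zero of the
integral as the centre `c` moves to infinity. -/
structure VanishesInMean (u : ℝ × Space3 → ℝ) : Prop where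
  measurable : Measurable u
  lintegral_lt_top : ∀ c R, ∫⁻ p in univ ×ˢ Metric.ball c R, ‖u p‖ₑ < ∞
  tendsto : ∀ R, ∀ c : ℕ → Space3, Tendsto (fun n => ‖c n‖) atTop atTop →
    Tendsto (fun n => ∫⁻ p in univ ×ˢ Metric.ball (c n) R, ‖u p‖ₑ) atTop (𝓝 0)

namespace IsSlabDensity

variable {T : ℝ} {M : ℝ≥0} {s : ℝ → Space3 → ℝ} {k : Space3 → ℝ}

lemma measurable_time (hs : IsSlabDensity T M s) (t : ℝ) : Measurable (s t) :=
  hs.measurable.comp measurable_prodMk_left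

lemma lintegral_lt_top (hs : IsSlabDensity T M s) (t : ℝ) : ∫⁻ y, ‖s t y‖ₑ < ∞ :=
  (hs.lintegral_le t).trans_lt ENNReal.coe_lt_top

lemma measurable_absPot_integrand (hs : IsSlabDensity T M s) (hk : IsPotentialKernel k) :
    Measurable fun q : (ℝ × Space3) × Space3 => ‖s q.1.1 q.2‖ₑ * ‖k (q.1.2 - q.2)‖ₑ := by
  have h1 : Measurable fun q : (ℝ × Space3) × Space3 => s q.1.1 q.2 :=
    hs.measurable.comp ((measurable_fst.comp measurable_fst).prodMk measurable_snd)
  have h2 : Measurable fun q : (ℝ × Space3) × Space3 => k (q.1.2 - q.2) :=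
    hk.measurable.comp ((measurable_snd.comp measurable_fst).sub measurable_snd)
  exact h1.enorm.mul h2.enorm

lemma measurable_absPot (hs : IsSlabDensity T M s) (hk : IsPotentialKernel k) :
    Measurable (absPot k s) :=
  (hs.measurable_absPot_integrand hk).lintegral_prod_right'

lemma absPot_eq_zero (hs : IsSlabDensity T M s) {p : ℝ × Space3} (hp : p.1 ∉ Ioo 0 T) :
    absPot k s p = 0 := by
  simp [absPot, hs.eq_zero _ hp]

lemma setLIntegral_prod_ball {f : ℝ × Space3 → ℝ≥0∞} (hf : Measurable f) (c : Space3) (R : ℝ) :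
    ∫⁻ p in univ ×ˢ Metric.ball c R, f p = ∫⁻ t, ∫⁻ x in Metric.ball c R, f (t, x) := by
  rw [Measure.volume_eq_prod, ← Measure.prod_restrict, Measure.restrict_univ,
    lintegral_prod _ hf.aemeasurable]

lemma lintegral_absPot_ball_le_indicator (hs : IsSlabDensity T M s) (hk : IsPotentialKernel k)
    (c : Space3) (R : ℝ) (t : ℝ) :
    ∫⁻ x in Metric.ball c R, absPot k s (t, x) ≤
      (Ioo 0 T).indicator (fun _ => kernelBound k R * M) t := by
  by_cases ht : t ∈ Ioo 0 T
  · rw [indicator_of_mem ht]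
    exact (hk.lintegral_conv_ball_le (hs.measurable_time t) c R).trans
      (mul_le_mul_right (hs.lintegral_le t) _)
  · simp [hs.absPot_eq_zero (p := (t, _)) ht]

lemma lintegral_absPot_lt_top (hs : IsSlabDensity T M s) (hk : IsPotentialKernel k)
    (c : Space3) (R : ℝ) : ∫⁻ p in univ ×ˢ Metric.ball c R, absPot k s p < ∞ := by
  rw [setLIntegral_prod_ball (hs.measurable_absPot hk)]
  refine (lintegral_mono fun t => hs.lintegral_absPot_ball_le_indicator hk c R t).trans_lt ?_
  rw [lintegral_indicator measurableSet_Ioo, setLIntegral_const]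
  exact ENNReal.mul_lt_top (ENNReal.mul_lt_top (hk.kernelBound_lt_top R) ENNReal.coe_lt_top)
    (by simp)

lemma tendsto_lintegral_absPot (hs : IsSlabDensity T M s) (hk : IsPotentialKernel k) (R : ℝ)
    {c : ℕ → Space3} (hc : Tendsto (fun n => ‖c n‖) atTop atTop) :
    Tendsto (fun n => ∫⁻ p in univ ×ˢ Metric.ball (c n) R, absPot k s p) atTop (𝓝 0) := by
  simp_rw [setLIntegral_prod_ball (hs.measurable_absPot hk)]
  have hm := hs.measurable_absPot hk
  have := tendsto_lintegral_of_dominated_convergence (μ := (volume : Measure ℝ))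
    (F := fun n t => ∫⁻ x in Metric.ball (c n) R, absPot k s (t, x)) (f := fun _ => 0)
    ((Ioo 0 T).indicator (fun _ => kernelBound k R * M)) (fun n => hm.lintegral_prod_right')
    (fun n => Eventually.of_forall fun t => hs.lintegral_absPot_ball_le_indicator hk _ R t)
    (by
      rw [lintegral_indicator measurableSet_Ioo, setLIntegral_const]
      exact (ENNReal.mul_lt_top (ENNReal.mul_lt_top (hk.kernelBound_lt_top R) ENNReal.coe_lt_top)
        (by simp)).ne)
    (Eventually.of_forall fun t =>
      hk.tendsto_lintegral_conv_ball (hs.measurable_time t) (hs.lintegral_lt_top t) R hc)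
  simpa using this

lemma vanishesInMean (hs : IsSlabDensity T M s) (hk : IsPotentialKernel k) {u : ℝ × Space3 → ℝ}
    (hu : Measurable u) (hle : ∀ p, ‖u p‖ₑ ≤ absPot k s p) : VanishesInMean u where
  measurable := hu
  lintegral_lt_top c R := (lintegral_mono hle).trans_lt (hs.lintegral_absPot_lt_top hk c R)
  tendsto R _ hc := tendsto_of_tendsto_of_tendsto_of_le_of_le tendsto_const_nhds
    (hs.tendsto_lintegral_absPot hk R hc) (fun _ => bot_le) (fun _ => lintegral_mono hle)

lemma measurable_kconv (hs : IsSlabDensity T M s) (hk : IsPotentialKernel k) :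
    Measurable fun p : ℝ × Space3 => kconv k (s p.1) p.2 := by
  have : StronglyMeasurable fun q : (ℝ × Space3) × Space3 => s q.1.1 q.2 * k (q.1.2 - q.2) :=
    ((hs.measurable.comp ((measurable_fst.comp measurable_fst).prodMk measurable_snd)).mul
      (hk.measurable.comp
        ((measurable_snd.comp measurable_fst).sub measurable_snd))).stronglyMeasurable
  exact this.integral_prod_right.measurable

lemma vanishesInMean_kconv (hs : IsSlabDensity T M s) (hk : IsPotentialKernel k) :
    VanishesInMean fun p : ℝ × Space3 => kconv k (s p.1) p.2 :=
  hs.vanishesInMean hk (hs.measurable_kconv hk) fun _ => IsPotentialKernel.enorm_kconv_le _ _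

end IsSlabDensity

namespace VanishesInMean

variable {u : ℝ × Space3 → ℝ}

lemma integrableOn (hu : VanishesInMean u) (c : Space3) (R : ℝ) :
    IntegrableOn u (univ ×ˢ Metric.ball c R) :=
  ⟨hu.measurable.aestronglyMeasurable, hu.lintegral_lt_top c R⟩

lemma locallyIntegrable (hu : VanishesInMean u) : LocallyIntegrable u := fun p =>
  ⟨univ ×ˢ Metric.ball p.2 1, (isOpen_univ.prod Metric.isOpen_ball).mem_nhds
    ⟨mem_univ _, Metric.mem_ball_self one_pos⟩, hu.integrableOn p.2 1⟩

lemma integrable_mul (hu : VanishesInMean u) {φ : ℝ × Space3 → ℝ} (hφ : Continuous φ)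
    (hφc : HasCompactSupport φ) : Integrable fun p => u p * φ p := by
  have := hu.locallyIntegrable.integrable_smul_right_of_hasCompactSupport hφ hφc
  simpa [mul_comm] using this

/-- The pairing with translates in space of a test function tends to zero. -/
lemma tendsto_integral_translate (hu : VanishesInMean u) {φ : ℝ × Space3 → ℝ} (hφ : Continuous φ)
    (hφc : HasCompactSupport φ) {c : ℕ → Space3} (hc : Tendsto (fun n => ‖c n‖) atTop atTop) :
    Tendsto (fun n => ∫ p, u p * φ (p - (0, c n))) atTop (𝓝 0) := by
  obtain ⟨M, hM⟩ := hφ.bounded_above_of_compact_support hφc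
  obtain ⟨R, hR⟩ := hφc.isCompact.isBounded.subset_ball (0 : ℝ × Space3)
  rw [tendsto_zero_iff_norm_tendsto_zero]
  have hlim : Tendsto (fun n => (ENNReal.ofReal M *
      ∫⁻ p in univ ×ˢ Metric.ball (c n) R, ‖u p‖ₑ).toReal) atTop (𝓝 0) := by
    have h := ENNReal.Tendsto.const_mul (a := ENNReal.ofReal M) (hu.tendsto R c hc)
      (Or.inr ENNReal.ofReal_ne_top)
    rw [mul_zero] at h
    exact (ENNReal.tendsto_toReal ENNReal.zero_ne_top).comp h
  refine squeeze_zero (fun _ => norm_nonneg _) (fun n => ?_) hlim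
  have hne : ENNReal.ofReal M * ∫⁻ p in univ ×ˢ Metric.ball (c n) R, ‖u p‖ₑ ≠ ∞ :=
    (ENNReal.mul_lt_top ENNReal.ofReal_lt_top (hu.lintegral_lt_top _ _)).ne
  rw [← toReal_enorm]
  refine ENNReal.toReal_mono hne ((enorm_integral_le_lintegral_enorm _).trans ?_)
  have hms : MeasurableSet (univ ×ˢ Metric.ball (c n) R : Set (ℝ × Space3)) :=
    MeasurableSet.univ.prod Metric.isOpen_ball.measurableSet
  rw [← lintegral_const_mul _ hu.measurable.enorm, ← lintegral_indicator hms]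
  refine lintegral_mono fun p => ?_
  by_cases hp : p ∈ (univ ×ˢ Metric.ball (c n) R : Set (ℝ × Space3))
  · rw [indicator_of_mem hp, enorm_mul, mul_comm]
    gcongr
    rw [← ofReal_norm]
    exact ENNReal.ofReal_le_ofReal (hM _)
  · have h0 : φ (p - (0, c n)) = 0 := by
      refine image_eq_zero_of_notMem_tsupport fun h => hp ⟨mem_univ _, ?_⟩
      have h1 := hR h
      rw [mem_ball_zero_iff] at h1
      rw [mem_ball_iff_norm]
      exact (norm_snd_le (p - (0, c n))).trans_lt h1
    rw [h0, indicator_of_notMem hp]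
    simp

end VanishesInMean

instance isAddHaarMeasure_volume_spaceTime :
    (volume : Measure (ℝ × Space3)).IsAddHaarMeasure := by
  rw [Measure.volume_eq_prod]; infer_instance

/-- Differentiation of the pairing of a locally integrable function with the translates of a test
function. -/
lemma hasFDerivAt_integral_translate {G : Type*} [NormedAddCommGroup G] [NormedSpace ℝ G]
    [MeasurableSpace G] [BorelSpace G] [FiniteDimensional ℝ G] {μ : Measure G}
    [μ.IsAddHaarMeasure] {u : G → ℝ} (hu : LocallyIntegrable u μ) {ψ : G → ℝ}
    (hψ : ContDiff ℝ 1 ψ) (hψc : HasCompactSupport ψ) (a : G) :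
    ∃ D : G →L[ℝ] ℝ, HasFDerivAt (fun a => ∫ p, u p * ψ (p - a) ∂μ) D a ∧
      ∀ v, D v = -∫ p, u p * fderiv ℝ ψ (p - a) v ∂μ := by
  set g : G → ℝ := fun p => ψ (-p)
  have hg : ContDiff ℝ 1 g := hψ.comp contDiff_neg
  have hgc : HasCompactSupport g := hψc.comp_homeomorph (Homeomorph.neg G)
  have h := hgc.hasFDerivAt_convolution_right (ContinuousLinearMap.mul ℝ ℝ) hu hg a
  have hfun : (convolution u g (ContinuousLinearMap.mul ℝ ℝ) μ) =
      fun a => ∫ p, u p * ψ (p - a) ∂μ := by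
    ext a
    simp [convolution_def, g]
  rw [hfun] at h
  refine ⟨_, h, fun v => ?_⟩
  rw [convolution_precompR_apply _ hu (hgc.fderiv ℝ) (hg.continuous_fderiv one_ne_zero),
    convolution_def, ← integral_neg]
  congr 1
  ext p
  have hd : fderiv ℝ g (a - p) = -fderiv ℝ ψ (p - a) := by
    have h1 : HasFDerivAt g ((fderiv ℝ ψ (-(a - p))).comp (-ContinuousLinearMap.id ℝ G)) (a - p) :=
      (hψ.differentiable one_ne_zero _).hasFDerivAt.comp _ (hasFDerivAt_id _).neg
    rw [h1.fderiv, neg_sub]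
    ext v
    simp
  simp [hd]

/-! ### The field equations for the potential -/

/-- `∂_i U = -E_i` in the sense of distributions, where `U` is the space-time Newton potential of
`s` and `E_i` its `i`-th Coulomb potential. -/
lemma IsSlabDensity.integral_potential_mul_fderiv {T : ℝ} {M : ℝ≥0} {s : ℝ → Space3 → ℝ}
    (hs : IsSlabDensity T M s) {φ : ℝ × Space3 → ℝ} (hφ : ContDiff ℝ 1 φ)
    (hφc : HasCompactSupport φ) (i : Fin 3) :
    ∫ p : ℝ × Space3, kconv newtonKernel (s p.1) p.2 *
        fderiv ℝ φ p (0, EuclideanSpace.single i 1) =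
      ∫ p : ℝ × Space3, kconv (fun x => coulombKernel x i) (s p.1) p.2 * φ p := by
  have h1 := (hs.vanishesInMean_kconv isPotentialKernel_newtonKernel).integrable_mul
    (φ := fun p => fderiv ℝ φ p (0, EuclideanSpace.single i 1))
    ((hφ.continuous_fderiv one_ne_zero).clm_apply continuous_const) (hφc.fderiv_apply ℝ _)
  have h2 := (hs.vanishesInMean_kconv (isPotentialKernel_coulombKernel i)).integrable_mul
    hφ.continuous hφc
  rw [Measure.volume_eq_prod] at h1 h2 ⊢
  rw [integral_prod _ h1, integral_prod _ h2]
  congr 1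
  ext t
  have hψ : ContDiff ℝ 1 fun x => φ (t, x) := hφ.comp (contDiff_const.prodMk contDiff_id)
  have hψc : HasCompactSupport fun x => φ (t, x) :=
    HasCompactSupport.of_support_subset_isCompact (hφc.isCompact.image continuous_snd)
      fun x hx => ⟨(t, x), subset_tsupport _ hx, rfl⟩
  rw [← integral_kconv_newtonKernel_mul_fderiv (hs.measurable_time t) (hs.lintegral_lt_top t)
    hψ hψc]
  congr 1
  ext x
  have hd : HasFDerivAt (fun x => φ (t, x))
      ((fderiv ℝ φ (t, x)).comp (ContinuousLinearMap.inr ℝ ℝ Space3)) x :=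
    (hφ.differentiable one_ne_zero (t, x)).hasFDerivAt.comp x (hasFDerivAt_prodMk_right t x)
  rw [hd.fderiv]
  simp

lemma tendsto_norm_natCast_smul_single :
    Tendsto (fun n : ℕ => ‖(n : ℝ) • (EuclideanSpace.single 0 1 : Space3)‖) atTop atTop := by
  simp only [norm_smul, PiLp.norm_single]
  simpa using tendsto_natCast_atTop_atTop (R := ℝ)

/-- If `∇U = -E` and `∂_t E = ∇F` in the sense of distributions, then `∂_t U = -F`. The difference
is constant in space, and the constant vanishes because `U` and `F` tend to zero in mean. -/
lemma integral_mul_fderiv_time_eq {T : ℝ} {U F : ℝ × Space3 → ℝ} {E : Fin 3 → ℝ × Space3 → ℝ}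
    (hU : VanishesInMean U) (hF : VanishesInMean F)
    (hUE : ∀ φ : ℝ × Space3 → ℝ, ContDiff ℝ 1 φ → HasCompactSupport φ → ∀ i,
      ∫ p, U p * fderiv ℝ φ p (0, EuclideanSpace.single i 1) = ∫ p, E i p * φ p)
    (hEF : ∀ φ : ℝ × Space3 → ℝ, ContDiff ℝ (⊤ : ℕ∞) φ → HasCompactSupport φ →
      tsupport φ ⊆ Ioo 0 T ×ˢ univ → ∀ i,
      ∫ p, E i p * fderiv ℝ φ p (1, 0) =
        ∫ p, F p * fderiv ℝ φ p (0, EuclideanSpace.single i 1))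
    {φ : ℝ × Space3 → ℝ} (hφ : ContDiff ℝ (⊤ : ℕ∞) φ) (hφc : HasCompactSupport φ)
    (hφs : tsupport φ ⊆ Ioo 0 T ×ˢ univ) :
    ∫ p, U p * fderiv ℝ φ p (1, 0) = ∫ p, F p * φ p := by
  set φt : ℝ × Space3 → ℝ := fun p => fderiv ℝ φ p (1, 0) with hφt_def
  have hφt : ContDiff ℝ (⊤ : ℕ∞) φt := by
    have h1 : ContDiff ℝ (⊤ : ℕ∞) (fderiv ℝ φ) := hφ.fderiv_right le_rfl
    exact h1.clm_apply contDiff_const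
  have hφtc : HasCompactSupport φt := hφc.fderiv_apply ℝ _
  have hφ1 : ContDiff ℝ 1 φ := hφ.of_le (by exact_mod_cast le_top)
  have hφt1 : ContDiff ℝ 1 φt := hφt.of_le (by exact_mod_cast le_top)
  -- `w a` pairs the equation with the translate of `φ` by `a` in space.
  set w : Space3 → ℝ := fun a => (∫ p, U p * φt (p - (0, a))) - ∫ p, F p * φ (p - (0, a))
  have hw : ∀ a, HasFDerivAt w (0 : Space3 →L[ℝ] ℝ) a := by
    intro a
    obtain ⟨D1, hD1, hD1v⟩ :=
      hasFDerivAt_integral_translate hU.locallyIntegrable hφt1 hφtc (0, a)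
    obtain ⟨D2, hD2, hD2v⟩ :=
      hasFDerivAt_integral_translate hF.locallyIntegrable hφ1 hφc (0, a)
    have hD : HasFDerivAt w ((D1 - D2).comp (ContinuousLinearMap.inr ℝ ℝ Space3)) a :=
      (hD1.sub hD2).comp a (hasFDerivAt_prodMk_right 0 a)
    have hzero : (D1 - D2).comp (ContinuousLinearMap.inr ℝ ℝ Space3) = 0 := by
      have hbasis : ∀ i : Fin 3, D1 (0, EuclideanSpace.single i 1) =
          D2 (0, EuclideanSpace.single i 1) := by
        intro i
        rw [hD1v, hD2v]
        congr 1
        set q : ℝ × Space3 := (0, a)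
        set φa : ℝ × Space3 → ℝ := fun p => φ (p - q)
        have hφa : ContDiff ℝ (⊤ : ℕ∞) φa := hφ.comp (contDiff_id.sub contDiff_const)
        have hφac : HasCompactSupport φa := hφc.comp_homeomorph (Homeomorph.subRight q)
        have hφas : tsupport φa ⊆ Ioo 0 T ×ˢ univ := by
          intro p hp
          have h1 : p - q ∈ tsupport φ := by
            have := tsupport_comp_subset_preimage φ (f := fun p : ℝ × Space3 => p - q)
              (by fun_prop) hp
            exact this
          have h2 := (hφs h1).1
          refine ⟨?_, mem_univ _⟩
          simpa [q] using h2
        have hfd : ∀ p, fderiv ℝ φa p = fderiv ℝ φ (p - q) := fun p => fderiv_comp_sub q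
        have hfd2 : ∀ p, fderiv ℝ (fun p => φt (p - q)) p = fderiv ℝ φt (p - q) :=
          fun p => fderiv_comp_sub q
        have hUE' := hUE (fun p => φt (p - q)) (hφt1.comp (contDiff_id.sub contDiff_const))
          (hφtc.comp_homeomorph (Homeomorph.subRight q)) i
        have hEF' := hEF φa hφa hφac hφas i
        simp only [hfd, hfd2] at hUE' hEF'
        rw [hUE', ← hEF']
      ext v
      have hv : v = ∑ i, v i • (EuclideanSpace.single i 1 : Space3) := by
        ext j; simp [Finset.sum_apply, Pi.single_apply]
      have h3 : ∀ i : Fin 3, ((D1 - D2).comp (ContinuousLinearMap.inr ℝ ℝ Space3))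
          (EuclideanSpace.single i 1) = 0 := fun i => by simp [hbasis i]
      rw [hv, map_sum]
      simp only [map_smul, h3, smul_zero, Finset.sum_const_zero, zero_apply]
    rwa [hzero] at hD
  have hconst : ∀ a, w a = w 0 := fun a =>
    is_const_of_fderiv_eq_zero (𝕜 := ℝ) (fun x => (hw x).differentiableAt) (fun x => (hw x).fderiv)
      a 0
  have hlim : Tendsto (fun n : ℕ => w ((n : ℝ) • (EuclideanSpace.single 0 1 : Space3)))
      atTop (𝓝 0) := by
    have h1 := (hU.tendsto_integral_translate hφt.continuous hφtc
      tendsto_norm_natCast_smul_single).sub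
      (hF.tendsto_integral_translate hφ.continuous hφc tendsto_norm_natCast_smul_single)
    simpa using h1
  simp only [hconst] at hlim
  have h0 : w 0 = 0 := tendsto_nhds_unique tendsto_const_nhds hlim
  have h1 : ∀ p : ℝ × Space3, p - (0, 0) = p := fun p => sub_zero p
  simp only [w, h1] at h0
  linarith

/-! ### Mollification -/

section Mollify

variable {G : Type*} [NormedAddCommGroup G] [NormedSpace ℝ G] [MeasurableSpace G] [BorelSpace G]
  [FiniteDimensional ℝ G] (μ : Measure G) [μ.IsAddHaarMeasure]

/-- A smooth bump function with support of radius `1 / (n + 1)`. -/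
def stdBump (G : Type*) [NormedAddCommGroup G] (n : ℕ) : ContDiffBump (0 : G) where
  rIn := 1 / (2 * (n + 1))
  rOut := 1 / (n + 1)
  rIn_pos := by positivity
  rIn_lt_rOut := by
    rw [div_lt_div_iff₀ (by positivity) (by positivity)]
    have : (0 : ℝ) ≤ n := n.cast_nonneg
    linarith

/-- The normalised bump function with support of radius `1 / (n + 1)`. -/
def mollifier (n : ℕ) : G → ℝ := (stdBump G n).normed μ

/-- The mollification of `u`. -/
def mollify (n : ℕ) (u : G → ℝ) (a : G) : ℝ := ∫ p, u p * mollifier μ n (p - a) ∂μ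

omit [BorelSpace G] [μ.IsAddHaarMeasure] in
lemma mollifier_nonneg (n : ℕ) (a : G) : 0 ≤ mollifier μ n a := (stdBump G n).nonneg_normed a

omit [BorelSpace G] [μ.IsAddHaarMeasure] in
lemma contDiff_mollifier (n : ℕ) : ContDiff ℝ (⊤ : ℕ∞) (mollifier μ n) :=
  (stdBump G n).contDiff_normed

lemma hasCompactSupport_mollifier (n : ℕ) : HasCompactSupport (mollifier μ n) :=
  (stdBump G n).hasCompactSupport_normed

lemma integral_mollifier (n : ℕ) : ∫ a, mollifier μ n a ∂μ = 1 := (stdBump G n).integral_normed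

lemma tsupport_mollifier (n : ℕ) :
    tsupport (mollifier μ n) = Metric.closedBall 0 (1 / ((n : ℝ) + 1)) :=
  (stdBump G n).tsupport_normed_eq

lemma mollifier_eq_zero {n : ℕ} {a : G} (ha : 1 / ((n : ℝ) + 1) ≤ ‖a‖) : mollifier μ n a = 0 := by
  by_contra h
  have : a ∈ Function.support ((stdBump G n).normed μ) := h
  rw [(stdBump G n).support_normed_eq, mem_ball_zero_iff] at this
  exact absurd this (not_lt.2 ha)

lemma mollify_eq_convolution (n : ℕ) (u : G → ℝ) :
    mollify μ n u = convolution ((stdBump G n).normed μ) u (ContinuousLinearMap.lsmul ℝ ℝ) μ := by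
  ext a
  rw [convolution_eq_swap]
  refine integral_congr_ae (Eventually.of_forall fun p => ?_)
  simp only [ContinuousLinearMap.lsmul_apply, smul_eq_mul, mollifier]
  rw [mul_comm, ← (stdBump G n).normed_neg, neg_sub]

omit [NormedSpace ℝ G] [MeasurableSpace G] [BorelSpace G] [FiniteDimensional ℝ G] in
lemma tendsto_rOut_stdBump : Tendsto (fun n => (stdBump G n).rOut) atTop (𝓝 0) :=
  tendsto_one_div_add_atTop_nhds_zero_nat

variable {μ}

lemma ae_tendsto_mollify {u : G → ℝ} (hu : LocallyIntegrable u μ) :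
    ∀ᵐ a ∂μ, Tendsto (fun n => mollify μ n u a) atTop (𝓝 (u a)) := by
  simp_rw [mollify_eq_convolution]
  refine ContDiffBump.ae_convolution_tendsto_right_of_locallyIntegrable (K := 2)
    tendsto_rOut_stdBump (Eventually.of_forall fun n => le_of_eq ?_) hu
  simp only [stdBump]
  field_simp

lemma tendsto_mollify_of_continuous {u : G → ℝ} (hu : Continuous u) (a : G) :
    Tendsto (fun n => mollify μ n u a) atTop (𝓝 (u a)) := by
  simp_rw [mollify_eq_convolution]
  exact ContDiffBump.convolution_tendsto_right_of_continuous tendsto_rOut_stdBump hu a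

lemma hasFDerivAt_mollify (n : ℕ) {u : G → ℝ} (hu : LocallyIntegrable u μ) (a : G) :
    ∃ D : G →L[ℝ] ℝ, HasFDerivAt (mollify μ n u) D a ∧
      ∀ v, D v = -∫ p, u p * fderiv ℝ (fun p => mollifier μ n (p - a)) p v ∂μ := by
  obtain ⟨D, hD, hDv⟩ := hasFDerivAt_integral_translate hu
    ((contDiff_mollifier μ n).of_le (by exact_mod_cast le_top)) (hasCompactSupport_mollifier μ n) a
  refine ⟨D, hD, fun v => ?_⟩
  rw [hDv]
  simp only [fderiv_comp_sub (𝕜 := ℝ) (f := mollifier μ n) a]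

lemma continuous_mollify (n : ℕ) {u : G → ℝ} (hu : LocallyIntegrable u μ) :
    Continuous (mollify μ n u) :=
  continuous_iff_continuousAt.2 fun a =>
    (hasFDerivAt_mollify n hu a).choose_spec.1.continuousAt

lemma lintegral_mollifier (n : ℕ) : ∫⁻ a, ‖mollifier μ n a‖ₑ ∂μ = 1 := by
  have h : Integrable (mollifier μ n) μ := (stdBump G n).integrable_normed
  rw [← ofReal_integral_norm_eq_lintegral_enorm h]
  simp_rw [Real.norm_of_nonneg (mollifier_nonneg μ n _)]
  rw [integral_mollifier, ENNReal.ofReal_one]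

lemma lintegral_enorm_mollify_le (n : ℕ) {u : G → ℝ} (hu : AEStronglyMeasurable u μ) :
    ∫⁻ a, ‖mollify μ n u a‖ₑ ∂μ ≤ ∫⁻ p, ‖u p‖ₑ ∂μ := by
  have hmc : Measurable (mollifier μ n) := (contDiff_mollifier μ n).continuous.measurable
  calc ∫⁻ a, ‖mollify μ n u a‖ₑ ∂μ
      ≤ ∫⁻ a, ∫⁻ p, ‖u p‖ₑ * ‖mollifier μ n (p - a)‖ₑ ∂μ ∂μ := by
        refine lintegral_mono fun a => (enorm_integral_le_lintegral_enorm _).trans (le_of_eq ?_)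
        simp_rw [enorm_mul]
    _ = ∫⁻ p, ∫⁻ a, ‖u p‖ₑ * ‖mollifier μ n (p - a)‖ₑ ∂μ ∂μ := by
        rw [lintegral_lintegral_swap]
        have h1 : AEMeasurable (fun q : G × G => ‖u q.2‖ₑ) (μ.prod μ) :=
          hu.enorm.comp_quasiMeasurePreserving Measure.quasiMeasurePreserving_snd
        have h2 : Measurable fun q : G × G => ‖mollifier μ n (q.2 - q.1)‖ₑ :=
          (hmc.comp (measurable_snd.sub measurable_fst)).enorm
        exact h1.mul h2.aemeasurable
    _ = ∫⁻ p, ‖u p‖ₑ ∂μ := by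
        refine lintegral_congr fun p => ?_
        have hm : Measurable fun a => ‖mollifier μ n (p - a)‖ₑ :=
          (hmc.comp (measurable_const.sub measurable_id)).enorm
        rw [lintegral_const_mul _ hm,
          lintegral_sub_left_eq_self (fun a => ‖mollifier μ n a‖ₑ) p, lintegral_mollifier, mul_one]

lemma integrable_mul_mollifier (n : ℕ) {u : G → ℝ} (hu : LocallyIntegrable u μ) (a : G) :
    Integrable (fun p => u p * mollifier μ n (p - a)) μ := by
  have h := hu.integrable_smul_right_of_hasCompactSupport (g := fun p => mollifier μ n (p - a))
    ((contDiff_mollifier μ n).continuous.comp (continuous_id.sub continuous_const))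
    ((hasCompactSupport_mollifier μ n).comp_homeomorph (Homeomorph.subRight a))
  simpa [mul_comm] using h

lemma mollify_sub (n : ℕ) {u v : G → ℝ} (hu : LocallyIntegrable u μ)
    (hv : LocallyIntegrable v μ) (a : G) :
    mollify μ n (u - v) a = mollify μ n u a - mollify μ n v a := by
  simp only [mollify, Pi.sub_apply, sub_mul]
  exact integral_sub (integrable_mul_mollifier n hu a) (integrable_mul_mollifier n hv a)

lemma norm_mollify_le (n : ℕ) {u : G → ℝ} {M : ℝ} (hM : ∀ p, ‖u p‖ ≤ M) (a : G) :
    ‖mollify μ n u a‖ ≤ M := by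
  have hi : Integrable (fun p => mollifier μ n (p - a)) μ :=
    ((stdBump G n).integrable_normed (μ := μ)).comp_sub_right a
  calc ‖mollify μ n u a‖ ≤ ∫ p, M * mollifier μ n (p - a) ∂μ := by
        refine norm_integral_le_of_norm_le (hi.const_mul M) (Eventually.of_forall fun p => ?_)
        rw [norm_mul, Real.norm_of_nonneg (mollifier_nonneg μ n _)]
        exact mul_le_mul_of_nonneg_right (hM p) (mollifier_nonneg μ n _)
    _ = M := by
        rw [integral_const_mul, integral_sub_right_eq_self (mollifier μ n) a, integral_mollifier,
          mul_one]

lemma mollify_eq_zero {n : ℕ} {u : G → ℝ} {a : G}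
    (h : ∀ p ∈ Metric.ball a 1, u p = 0) : mollify μ n u a = 0 := by
  refine integral_eq_zero_of_ae (Eventually.of_forall fun p => ?_)
  by_cases hp : p ∈ Metric.ball a 1
  · simp [h p hp]
  · have : mollifier μ n (p - a) = 0 := by
      refine mollifier_eq_zero μ ?_
      rw [mem_ball_iff_norm, not_lt] at hp
      refine le_trans ?_ hp
      rw [div_le_one (by positivity)]
      simp
    simp [this]

/-- Mollifications converge in `L¹`: this is clear for continuous functions with compact support,
and mollification is a contraction of `L¹`. -/
lemma tendsto_lintegral_mollify_sub {u : G → ℝ} (hu : Integrable u μ) :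
    Tendsto (fun n => ∫⁻ a, ‖mollify μ n u a - u a‖ₑ ∂μ) atTop (𝓝 0) := by
  have : ProperSpace G := FiniteDimensional.proper_real G
  rw [ENNReal.tendsto_nhds_zero]
  intro ε hε
  obtain ⟨δ, hδ, hδε⟩ : ∃ δ : ℝ≥0∞, 0 < δ ∧ δ + δ + δ ≤ ε := by
    refine ⟨ε / 3, ENNReal.div_pos hε.ne' (by norm_num), ?_⟩
    rw [ENNReal.add_thirds]
  obtain ⟨v, hvc, hvδ, hv, hvi⟩ := hu.exists_hasCompactSupport_lintegral_sub_le hδ.ne'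
  obtain ⟨M, hM⟩ := hv.bounded_above_of_compact_support hvc
  set K : Set G := Metric.cthickening 1 (tsupport v)
  have hK : IsCompact K := hvc.isCompact.cthickening
  have hv0 : Tendsto (fun n => ∫⁻ a, ‖mollify μ n v a - v a‖ₑ ∂μ) atTop (𝓝 0) := by
    have := tendsto_lintegral_of_dominated_convergence (μ := μ)
      (F := fun n a => ‖mollify μ n v a - v a‖ₑ) (f := fun _ => 0)
      (K.indicator fun _ => ENNReal.ofReal (M + M))
      (fun n => ((continuous_mollify n hvi.locallyIntegrable).sub hv).measurable.enorm)
      (fun n => Eventually.of_forall fun a => by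
        by_cases ha : a ∈ K
        · simp only [indicator_of_mem ha]
          rw [← ofReal_norm]
          exact ENNReal.ofReal_le_ofReal
            ((norm_sub_le _ _).trans (add_le_add (norm_mollify_le n hM a) (hM a)))
        · have h0 : ∀ p ∈ Metric.ball a 1, v p = 0 := fun p hp => by
            by_contra hne
            exact ha (Metric.mem_cthickening_of_dist_le a p 1 _ (subset_tsupport v hne)
              (by rw [dist_comm]; exact hp.le))
          simp [mollify_eq_zero h0, h0 a (Metric.mem_ball_self one_pos)])
      (by
        rw [lintegral_indicator hK.measurableSet, setLIntegral_const]
        exact (ENNReal.mul_lt_top ENNReal.ofReal_lt_top hK.measure_lt_top).ne)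
      (Eventually.of_forall fun a => by
        have h1 := (tendsto_mollify_of_continuous (μ := μ) hv a).sub_const (v a)
        rw [sub_self] at h1
        simpa using h1.enorm)
    simpa using this
  filter_upwards [ENNReal.tendsto_nhds_zero.1 hv0 δ hδ] with n hn
  refine le_trans ?_ hδε
  have hsub : LocallyIntegrable (u - v) μ := (hu.sub hvi).locallyIntegrable
  have hm1 : Measurable fun a => ‖mollify μ n (u - v) a‖ₑ :=
    (continuous_mollify n hsub).measurable.enorm
  have hm2 : Measurable fun a => ‖mollify μ n v a - v a‖ₑ :=
    ((continuous_mollify n hvi.locallyIntegrable).sub hv).measurable.enorm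
  calc ∫⁻ a, ‖mollify μ n u a - u a‖ₑ ∂μ
      ≤ ∫⁻ a, (‖mollify μ n (u - v) a‖ₑ + ‖mollify μ n v a - v a‖ₑ + ‖u a - v a‖ₑ) ∂μ := by
        refine lintegral_mono fun a => ?_
        have : mollify μ n u a - u a =
            mollify μ n (u - v) a + (mollify μ n v a - v a) - (u a - v a) := by
          rw [mollify_sub n hu.locallyIntegrable hvi.locallyIntegrable]; ring
        rw [this]
        refine (enorm_sub_le).trans ?_
        gcongr
        exact enorm_add_le _ _
    _ = (∫⁻ a, ‖mollify μ n (u - v) a‖ₑ ∂μ) + (∫⁻ a, ‖mollify μ n v a - v a‖ₑ ∂μ)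
          + ∫⁻ a, ‖u a - v a‖ₑ ∂μ := by
        have hm3 : Measurable fun a => ‖mollify μ n (u - v) a‖ₑ + ‖mollify μ n v a - v a‖ₑ :=
          hm1.add hm2
        rw [lintegral_add_left hm3, lintegral_add_left hm1]
    _ ≤ δ + δ + δ := by
        gcongr
        exact (lintegral_enorm_mollify_le n (hu.sub hvi).aestronglyMeasurable).trans hvδ

end Mollify

lemma VanishesInMean.tendsto_lintegral_mollify_sub {u : ℝ × Space3 → ℝ} (hu : VanishesInMean u)
    (R : ℝ) : Tendsto (fun n => ∫⁻ p in univ ×ˢ Metric.ball (0 : Space3) R,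
      ‖mollify volume n u p - u p‖ₑ) atTop (𝓝 0) := by
  set A : Set (ℝ × Space3) := univ ×ˢ Metric.ball (0 : Space3) (R + 1)
  have hA : MeasurableSet A := MeasurableSet.univ.prod Metric.isOpen_ball.measurableSet
  have hi : Integrable (A.indicator u) := (hu.integrableOn 0 (R + 1)).integrable_indicator hA
  have h := _root_.tendsto_lintegral_mollify_sub hi
  refine tendsto_of_tendsto_of_tendsto_of_le_of_le tendsto_const_nhds h (fun _ => bot_le)
    fun n => ?_
  have hB : MeasurableSet (univ ×ˢ Metric.ball (0 : Space3) R : Set (ℝ × Space3)) :=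
    MeasurableSet.univ.prod Metric.isOpen_ball.measurableSet
  refine le_trans (le_of_eq ?_) (setLIntegral_le_lintegral
    (univ ×ˢ Metric.ball (0 : Space3) R : Set (ℝ × Space3)) _)
  refine setLIntegral_congr_fun hB fun p hp => ?_
  have hball : ∀ q ∈ Metric.ball p 1, q ∈ A := fun q hq => by
    refine ⟨mem_univ _, ?_⟩
    have h1 : ‖p.2‖ < R := by simpa using hp.2
    have h2 : ‖(q - p).2‖ < 1 := (norm_snd_le _).trans_lt (mem_ball_iff_norm.1 hq)
    rw [mem_ball_zero_iff]
    calc ‖q.2‖ = ‖p.2 + (q - p).2‖ := by simp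
      _ ≤ ‖p.2‖ + ‖(q - p).2‖ := norm_add_le _ _
      _ < R + 1 := add_lt_add h1 h2
  have h1 : mollify volume n (A.indicator u) p = mollify volume n u p := by
    have h0 : mollify volume n (A.indicator u - u) p = 0 :=
      mollify_eq_zero fun q hq => by simp [indicator_of_mem (hball q hq)]
    rw [mollify_sub n hi.locallyIntegrable hu.locallyIntegrable] at h0
    linarith
  rw [h1, indicator_of_mem (hball p (Metric.mem_ball_self one_pos))]

/-! ### Absolutely continuous functions -/

lemma AbsolutelyContinuousOnInterval.lipschitzOnWith_comp {f g : ℝ → ℝ} {a b : ℝ} {K : ℝ≥0}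
    {S : Set ℝ} (hf : AbsolutelyContinuousOnInterval f a b) (hg : LipschitzOnWith K g S)
    (hS : MapsTo f (uIcc a b) S) : AbsolutelyContinuousOnInterval (fun x => g (f x)) a b := by
  rw [absolutelyContinuousOnInterval_iff] at hf ⊢
  intro ε hε
  obtain ⟨δ, hδ, h⟩ := hf (ε / (K + 1)) (by positivity)
  refine ⟨δ, hδ, fun I hI hlen => ?_⟩
  calc ∑ i ∈ Finset.range I.1, dist (g (f (I.2 i).1)) (g (f (I.2 i).2))
      ≤ ∑ i ∈ Finset.range I.1, K * dist (f (I.2 i).1) (f (I.2 i).2) :=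
        Finset.sum_le_sum fun i hi =>
          hg.dist_le_mul _ (hS (hI.1 i hi).1) _ (hS (hI.1 i hi).2)
    _ = K * ∑ i ∈ Finset.range I.1, dist (f (I.2 i).1) (f (I.2 i).2) :=
        (Finset.mul_sum _ _ _).symm
    _ ≤ K * (ε / (K + 1)) := by gcongr; exact (h I hI hlen).le
    _ < (K + 1) * (ε / (K + 1)) := by gcongr; linarith
    _ = ε := by field_simp

/-- The chain rule for a primitive, in integrated form. -/
lemma integral_deriv_comp_primitive {f g g' : ℝ → ℝ} {a b c : ℝ} {K : ℝ≥0} {S : Set ℝ}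
    (hf : IntervalIntegrable f volume a b) (hg : LipschitzOnWith K g S)
    (hg' : ∀ x ∈ S, HasDerivAt g (g' x) x)
    (hS : MapsTo (fun s => c + ∫ τ in a..s, f τ) (uIcc a b) S) :
    ∫ s in a..b, g' (c + ∫ τ in a..s, f τ) * f s = g (c + ∫ τ in a..b, f τ) - g c := by
  have hac : AbsolutelyContinuousOnInterval (fun s => c + ∫ τ in a..s, f τ) a b := by
    have h1 := hf.absolutelyContinuousOnInterval_intervalIntegral (c := a) left_mem_uIcc
    have h2 : AbsolutelyContinuousOnInterval (fun _ : ℝ => c) a b :=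
      (LipschitzWith.const c).lipschitzOnWith.absolutelyContinuousOnInterval
    exact h2.add h1
  have h := (hac.lipschitzOnWith_comp hg hS).integral_deriv_eq_sub
  simp only [intervalIntegral.integral_same, add_zero] at h
  rw [← h]
  refine intervalIntegral.integral_congr_ae ?_
  filter_upwards [hf.ae_hasDerivAt_integral] with s hs hsab
  have hs' := uIoc_subset_uIcc hsab
  have h3 := (hs hs' a left_mem_uIcc).const_add c
  exact ((hg' _ (hS hs')).comp s h3).deriv.symm

/-- The chain rule for the square of a primitive; the square is not globally Lipschitz, and a
product rule avoids a bound for the primitive. -/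
lemma sq_primitive_sub_sq {f : ℝ → ℝ} {a b c : ℝ} (hf : IntervalIntegrable f volume a b) :
    ∫ s in a..b, (c + ∫ τ in a..s, f τ) * f s =
      ((c + ∫ τ in a..b, f τ) ^ 2 - c ^ 2) / 2 := by
  have hac : AbsolutelyContinuousOnInterval (fun s => c + ∫ τ in a..s, f τ) a b := by
    have h1 := hf.absolutelyContinuousOnInterval_intervalIntegral (c := a) left_mem_uIcc
    have h2 : AbsolutelyContinuousOnInterval (fun _ : ℝ => c) a b :=
      (LipschitzWith.const c).lipschitzOnWith.absolutelyContinuousOnInterval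
    exact h2.add h1
  have h := hac.integral_deriv_mul_eq_sub hac
  simp only [intervalIntegral.integral_same, add_zero] at h
  have h4 : ∫ s in a..b, 2 * ((c + ∫ τ in a..s, f τ) * f s) =
      (c + ∫ τ in a..b, f τ) * (c + ∫ τ in a..b, f τ) - c * c := by
    rw [← h]
    refine intervalIntegral.integral_congr_ae ?_
    filter_upwards [hf.ae_hasDerivAt_integral] with s hs hsab
    have h3 := (hs (uIoc_subset_uIcc hsab) a left_mem_uIcc).const_add c
    rw [h3.deriv]
    ring
  rw [intervalIntegral.integral_const_mul] at h4
  linarith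

/-! ### The energy along a trajectory -/

/-- A potential `U` on `(0,T) × ℝ³` with `∇U = -E` and `∂_t U = -F` in the sense of
distributions. -/
structure IsPotentialOf (T : ℝ) (U F : ℝ × Space3 → ℝ) (E : Fin 3 → ℝ × Space3 → ℝ) : Prop where
  potential : VanishesInMean U
  source : VanishesInMean F
  field : ∀ i, VanishesInMean (E i)
  grad : ∀ φ : ℝ × Space3 → ℝ, ContDiff ℝ 1 φ → HasCompactSupport φ → ∀ i,
    ∫ p, U p * fderiv ℝ φ p (0, EuclideanSpace.single i 1) = ∫ p, E i p * φ p
  time : ∀ φ : ℝ × Space3 → ℝ, ContDiff ℝ (⊤ : ℕ∞) φ → HasCompactSupport φ →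
    tsupport φ ⊆ Ioo 0 T ×ˢ univ → ∫ p, U p * fderiv ℝ φ p (1, 0) = ∫ p, F p * φ p

namespace IsPotentialOf

variable {T : ℝ} {U F : ℝ × Space3 → ℝ} {E : Fin 3 → ℝ × Space3 → ℝ}

/-- At times at a distance of more than `1 / (n + 1)` from `0` and `T`, the mollified potential is
differentiable and satisfies the equations with mollified right-hand sides. -/
lemma hasFDerivAt_mollify (h : IsPotentialOf T U F E) {n : ℕ} {p : ℝ × Space3}
    (h0 : 1 / ((n : ℝ) + 1) < p.1) (hT : 1 / ((n : ℝ) + 1) < T - p.1) :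
    ∃ D : ℝ × Space3 →L[ℝ] ℝ, HasFDerivAt (mollify volume n U) D p ∧
      ∀ v : Space3, D (1, v) =
        -mollify volume n F p - ∑ i, v i * mollify volume n (E i) p := by
  obtain ⟨D, hD, hDv⟩ := _root_.hasFDerivAt_mollify n h.potential.locallyIntegrable p
  refine ⟨D, hD, fun v => ?_⟩
  set φ : ℝ × Space3 → ℝ := fun q => mollifier volume n (q - p)
  have hφ : ContDiff ℝ (⊤ : ℕ∞) φ :=
    (contDiff_mollifier volume n).comp (contDiff_id.sub contDiff_const)
  have hφc : HasCompactSupport φ :=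
    (hasCompactSupport_mollifier volume n).comp_homeomorph (Homeomorph.subRight p)
  have hφs : tsupport φ ⊆ Ioo 0 T ×ˢ univ := by
    intro q hq
    have h1 : q - p ∈ tsupport (mollifier (G := ℝ × Space3) volume n) :=
      tsupport_comp_subset_preimage (mollifier (G := ℝ × Space3) volume n)
        (f := fun q : ℝ × Space3 => q - p) (by fun_prop) hq
    rw [tsupport_mollifier, mem_closedBall_zero_iff] at h1
    have h2 : |q.1 - p.1| ≤ 1 / ((n : ℝ) + 1) := (norm_fst_le (q - p)).trans h1
    rw [abs_le] at h2
    exact ⟨⟨by linarith, by linarith⟩, mem_univ _⟩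
  have ht : D (1, 0) = -mollify volume n F p := by
    rw [hDv, h.time φ hφ hφc hφs]; rfl
  have hx : ∀ i, D (0, EuclideanSpace.single i 1) = -mollify volume n (E i) p := fun i => by
    rw [hDv, h.grad φ (hφ.of_le (by exact_mod_cast le_top)) hφc i]; rfl
  have hv : ((1 : ℝ), v) = (1, 0) + ∑ i, v i • ((0 : ℝ), (EuclideanSpace.single i 1 : Space3)) := by
    refine Prod.ext ?_ ?_
    · simp [Prod.fst_sum]
    · ext j
      simp [Prod.snd_sum, Pi.single_apply]
  rw [hv, map_add, map_sum, ht]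
  simp only [map_smul, hx, smul_eq_mul, mul_neg, Finset.sum_neg_distrib]
  ring

/-- The variation of the mollified potential along a curve of class `C¹`. -/
lemma mollify_sub_mollify (h : IsPotentialOf T U F E) {n : ℕ} {s₁ s₂ : ℝ} (hs : s₁ ≤ s₂)
    (h0 : 1 / ((n : ℝ) + 1) < s₁) (hT : 1 / ((n : ℝ) + 1) < T - s₂) {X V : ℝ → Space3}
    (hX : ContinuousOn X (Icc s₁ s₂)) (hV : ContinuousOn V (Icc s₁ s₂))
    (hXV : ∀ s ∈ Ioo s₁ s₂, HasDerivAt X (V s) s) :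
    mollify volume n U (s₂, X s₂) - mollify volume n U (s₁, X s₁) =
      ∫ τ in s₁..s₂, (-mollify volume n F (τ, X τ) -
        ∑ i, V τ i * mollify volume n (E i) (τ, X τ)) := by
  have hcurve : ContinuousOn (fun τ => (τ, X τ)) (Icc s₁ s₂) := continuousOn_id.prodMk hX
  have hUc := continuous_mollify n h.potential.locallyIntegrable
  have hFc := continuous_mollify n h.source.locallyIntegrable
  have hEc := fun i => continuous_mollify n (h.field i).locallyIntegrable
  have hVi : ∀ i, ContinuousOn (fun τ => V τ i) (Icc s₁ s₂) := fun i =>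
    (EuclideanSpace.proj (𝕜 := ℝ) i).continuous.comp_continuousOn hV
  symm
  refine intervalIntegral.integral_eq_sub_of_hasDerivAt_of_le
    (f := fun s => mollify volume n U (s, X s)) hs
    (hUc.comp_continuousOn hcurve) (fun s hs' => ?_) ?_
  · obtain ⟨D, hD, hDv⟩ := h.hasFDerivAt_mollify (n := n) (p := (s, X s))
      (h0.trans hs'.1) (by have := hs'.2; dsimp only; linarith)
    rw [← hDv]
    exact hD.comp_hasDerivAt s ((hasDerivAt_id s).prodMk (hXV s hs'))
  · refine ContinuousOn.intervalIntegrable_of_Icc hs ?_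
    refine (hFc.comp_continuousOn hcurve).neg.sub (continuousOn_finsetSum _ fun i _ => ?_)
    exact (hVi i).mul ((hEc i).comp_continuousOn hcurve)

/-- Conservation of energy along a trajectory along which the mollified fields converge in `L¹`. -/
lemma energy_identity (h : IsPotentialOf T U F E) {s₁ s₂ : ℝ} (hs : s₁ ≤ s₂)
    (h0 : 0 < s₁) (hT : s₂ < T) {X V : ℝ → Space3}
    (hX : ContinuousOn X (Icc s₁ s₂)) (hV : ContinuousOn V (Icc s₁ s₂))
    (hXV : ∀ s ∈ Ioo s₁ s₂, HasDerivAt X (V s) s)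
    (hEi : ∀ i, IntervalIntegrable (fun τ => E i (τ, X τ)) volume s₁ s₂)
    (hFi : IntervalIntegrable (fun τ => F (τ, X τ)) volume s₁ s₂)
    (hVE : ∀ i, ∀ s ∈ Icc s₁ s₂, V s i = V s₁ i + ∫ τ in s₁..s, E i (τ, X τ))
    {n : ℕ → ℕ} (hn : Tendsto n atTop atTop)
    (hF : Tendsto (fun m => ∫⁻ τ in Icc s₁ s₂,
      ‖mollify volume (n m) F (τ, X τ) - F (τ, X τ)‖ₑ) atTop (𝓝 0))
    (hE : ∀ i, Tendsto (fun m => ∫⁻ τ in Icc s₁ s₂,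
      ‖mollify volume (n m) (E i) (τ, X τ) - E i (τ, X τ)‖ₑ) atTop (𝓝 0))
    (hU₁ : Tendsto (fun m => mollify volume (n m) U (s₁, X s₁)) atTop (𝓝 (U (s₁, X s₁))))
    (hU₂ : Tendsto (fun m => mollify volume (n m) U (s₂, X s₂)) atTop (𝓝 (U (s₂, X s₂)))) :
    ‖V s₂‖ ^ 2 / 2 + U (s₂, X s₂) =
      ‖V s₁‖ ^ 2 / 2 + U (s₁, X s₁) - ∫ τ in s₁..s₂, F (τ, X τ) := by
  have hVi : ∀ i, ContinuousOn (fun τ => V τ i) (Icc s₁ s₂) := fun i =>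
    (EuclideanSpace.proj (𝕜 := ℝ) i).continuous.comp_continuousOn hV
  have hcurve : ContinuousOn (fun τ => (τ, X τ)) (Icc s₁ s₂) := continuousOn_id.prodMk hX
  have huIcc : uIcc s₁ s₂ = Icc s₁ s₂ := uIcc_of_le hs
  have hFc : ∀ m, ContinuousOn (fun τ => mollify volume (n m) F (τ, X τ)) (Icc s₁ s₂) := fun m =>
    (continuous_mollify (n m) h.source.locallyIntegrable).comp_continuousOn hcurve
  have hEc : ∀ m i, ContinuousOn (fun τ => mollify volume (n m) (E i) (τ, X τ)) (Icc s₁ s₂) :=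
    fun m i => (continuous_mollify (n m) (h.field i).locallyIntegrable).comp_continuousOn hcurve
  obtain ⟨C, hC⟩ := isCompact_Icc.exists_bound_of_continuousOn hV
  have hCi : ∀ i, ∀ s ∈ Icc s₁ s₂, ‖V s i‖ ≤ C := fun i s hs' =>
    (PiLp.norm_apply_le (V s) i).trans (hC s hs')
  have hVEi : ∀ i, IntervalIntegrable (fun τ => V τ i * E i (τ, X τ)) volume s₁ s₂ := fun i =>
    (hEi i).continuousOn_mul (by rw [huIcc]; exact hVi i)
  -- Passage to the limit in the integrals along the curve.
  have hlimF : Tendsto (fun m => ∫ τ in s₁..s₂, mollify volume (n m) F (τ, X τ)) atTop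
      (𝓝 (∫ τ in s₁..s₂, F (τ, X τ))) := by
    simp only [intervalIntegral.integral_of_le hs]
    refine tendsto_integral_of_L1 _
      ((intervalIntegrable_iff_integrableOn_Ioc_of_le hs).1 hFi).aestronglyMeasurable
      (Eventually.of_forall fun m =>
        ((hFc m).integrableOn_Icc.mono_set Ioc_subset_Icc_self)) ?_
    exact tendsto_of_tendsto_of_tendsto_of_le_of_le tendsto_const_nhds hF (fun _ => bot_le)
      fun m => lintegral_mono_set Ioc_subset_Icc_self
  have hlimE : ∀ i, Tendsto (fun m => ∫ τ in s₁..s₂, V τ i * mollify volume (n m) (E i) (τ, X τ))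
      atTop (𝓝 (∫ τ in s₁..s₂, V τ i * E i (τ, X τ))) := by
    intro i
    simp only [intervalIntegral.integral_of_le hs]
    refine tendsto_integral_of_L1 _
      ((intervalIntegrable_iff_integrableOn_Ioc_of_le hs).1 (hVEi i)).aestronglyMeasurable
      (Eventually.of_forall fun m =>
        (((hVi i).mul (hEc m i)).integrableOn_Icc.mono_set Ioc_subset_Icc_self)) ?_
    have hb := ENNReal.Tendsto.const_mul (a := ENNReal.ofReal C) (hE i)
      (Or.inr ENNReal.ofReal_ne_top)
    rw [mul_zero] at hb
    refine tendsto_of_tendsto_of_tendsto_of_le_of_le tendsto_const_nhds hb (fun _ => bot_le)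
      fun m => ?_
    dsimp only
    rw [← lintegral_const_mul' _ _ ENNReal.ofReal_ne_top]
    refine (lintegral_mono_set Ioc_subset_Icc_self).trans
      (setLIntegral_mono' measurableSet_Icc fun τ hτ => ?_)
    rw [← mul_sub, enorm_mul]
    gcongr
    rw [← ofReal_norm]
    exact ENNReal.ofReal_le_ofReal (hCi i τ hτ)
  have hev : ∀ᶠ m in atTop, mollify volume (n m) U (s₂, X s₂) - mollify volume (n m) U (s₁, X s₁) =
      -(∫ τ in s₁..s₂, mollify volume (n m) F (τ, X τ)) -
        ∑ i, ∫ τ in s₁..s₂, V τ i * mollify volume (n m) (E i) (τ, X τ) := by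
    have hsmall : Tendsto (fun m => 1 / ((n m : ℝ) + 1)) atTop (𝓝 0) :=
      tendsto_one_div_add_atTop_nhds_zero_nat.comp hn
    filter_upwards [hsmall.eventually_lt_const h0,
      hsmall.eventually_lt_const (sub_pos.2 hT)] with m h1 h2
    rw [h.mollify_sub_mollify hs h1 h2 hX hV hXV, intervalIntegral.integral_sub,
      intervalIntegral.integral_neg, intervalIntegral.integral_finsetSum]
    · exact fun i _ => ((hVi i).mul (hEc m i)).intervalIntegrable_of_Icc hs
    · exact (hFc m).neg.intervalIntegrable_of_Icc hs
    · exact (continuousOn_finsetSum _ fun i _ =>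
        (hVi i).mul (hEc m i)).intervalIntegrable_of_Icc hs
  have hlim := (tendsto_nhds_unique_of_eventuallyEq (hU₂.sub hU₁)
    (hlimF.neg.sub (tendsto_finsetSum _ fun i _ => hlimE i)) hev)
  have hkin : ∀ i, ∫ τ in s₁..s₂, V τ i * E i (τ, X τ) = (V s₂ i ^ 2 - V s₁ i ^ 2) / 2 := by
    intro i
    have hsq := sq_primitive_sub_sq (c := V s₁ i) (hEi i)
    rw [← hVE i s₂ (right_mem_Icc.2 hs)] at hsq
    rw [← hsq]
    refine intervalIntegral.integral_congr fun τ hτ => ?_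
    rw [huIcc] at hτ
    dsimp only
    rw [hVE i τ hτ]
  simp only [hkin, Fin.sum_univ_three] at hlim
  rw [EuclideanSpace.norm_sq_eq, EuclideanSpace.norm_sq_eq, Fin.sum_univ_three, Fin.sum_univ_three]
  simp only [Real.norm_eq_abs, sq_abs]
  linarith

end IsPotentialOf

/-! ### The Sobolev bound for the potential -/

/-- A set of points which eventually belong to sets of measure at most `B` has measure at most
`B`. -/
lemma measure_le_of_ae_eventually {α : Type*} [MeasurableSpace α] {μ : Measure α} {S : Set α}
    {A : ℕ → Set α} {B : ℝ≥0∞} (hA : ∀ᶠ n in atTop, μ (A n) ≤ B)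
    (hS : ∀ᵐ x ∂μ, x ∈ S → ∀ᶠ n in atTop, x ∈ A n) : μ S ≤ B := by
  obtain ⟨N₀, hN₀⟩ := eventually_atTop.1 hA
  set I : ℕ → Set α := fun N => ⋂ n ≥ N, A n
  have hmono : Monotone I := fun N N' h x hx =>
    mem_iInter₂.2 fun n hn => mem_iInter₂.1 hx n (le_trans h hn)
  calc μ S ≤ μ (⋃ N, I N) := by
        refine measure_mono_ae ?_
        filter_upwards [hS] with x hx hxS
        obtain ⟨N, hN⟩ := eventually_atTop.1 (hx hxS)
        exact mem_iUnion.2 ⟨N, mem_iInter₂.2 fun n hn => hN n hn⟩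
    _ = ⨆ N, μ (I N) := hmono.measure_iUnion
    _ ≤ B := iSup_le fun N => (measure_mono fun x hx =>
        mem_iInter₂.1 hx (max N N₀) (le_max_left _ _)).trans (hN₀ _ (le_max_right _ _))

/-- A `C¹` function which vanishes on `(-∞,1]`, has derivative in `[0,1]` and satisfies
`s - 2 ≤ cutoff s`. Its composition with a function which tends to zero at infinity has compact
support, as the Sobolev inequality requires. -/
def cutoff (s : ℝ) : ℝ := ∫ τ in (1 : ℝ)..s, (1 - (max τ 1 ^ 2)⁻¹)

lemma continuous_cutoff_deriv : Continuous fun τ : ℝ => 1 - (max τ 1 ^ 2)⁻¹ := by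
  refine continuous_const.sub (Continuous.inv₀ (by fun_prop) fun τ => ?_)
  have : (1 : ℝ) ≤ max τ 1 := le_max_right _ _
  positivity

lemma hasDerivAt_cutoff (s : ℝ) : HasDerivAt cutoff (1 - (max s 1 ^ 2)⁻¹) s :=
  continuous_cutoff_deriv.integral_hasStrictDerivAt 1 s |>.hasDerivAt

lemma contDiff_cutoff : ContDiff ℝ 1 cutoff := by
  rw [contDiff_one_iff_deriv]
  refine ⟨fun s => (hasDerivAt_cutoff s).differentiableAt, ?_⟩
  have : deriv cutoff = fun s => 1 - (max s 1 ^ 2)⁻¹ := funext fun s => (hasDerivAt_cutoff s).deriv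
  rw [this]
  exact continuous_cutoff_deriv

lemma abs_cutoff_deriv_le (s : ℝ) : |1 - (max s 1 ^ 2)⁻¹| ≤ 1 := by
  have h : (1 : ℝ) ≤ max s 1 ^ 2 := one_le_pow₀ (le_max_right _ _)
  have h1 := inv_le_one_of_one_le₀ h
  have h2 : 0 < (max s 1 ^ 2)⁻¹ := inv_pos.2 (by linarith)
  rw [abs_le]; constructor <;> linarith

lemma cutoff_eq_zero {s : ℝ} (hs : s ≤ 1) : cutoff s = 0 := by
  unfold cutoff
  rw [intervalIntegral.integral_congr (g := fun _ => 0), intervalIntegral.integral_zero]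
  intro τ hτ
  rw [uIcc_of_ge hs] at hτ
  simp [max_eq_right hτ.2]

lemma sub_two_le_cutoff {s : ℝ} (hs : 1 ≤ s) : s - 2 ≤ cutoff s := by
  have h : cutoff s = (s - 2 + s⁻¹) - (1 - 2 + 1⁻¹) := by
    refine intervalIntegral.integral_eq_sub_of_hasDerivAt (f := fun s => s - 2 + s⁻¹)
      (fun τ hτ => ?_) (continuous_cutoff_deriv.intervalIntegrable _ _)
    rw [uIcc_of_le hs] at hτ
    rw [max_eq_left hτ.1]
    have h0 : τ ≠ 0 := by linarith [hτ.1]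
    have := ((hasDerivAt_id τ).sub_const 2).add (hasDerivAt_inv h0)
    refine HasDerivAt.congr_deriv (f := fun s => s - 2 + s⁻¹) this ?_
    ring
  rw [h]
  have : 0 < s⁻¹ := inv_pos.2 (by linarith)
  linarith

section Mollify

variable {G : Type*} [NormedAddCommGroup G] [NormedSpace ℝ G] [MeasurableSpace G] [BorelSpace G]
  [FiniteDimensional ℝ G] {μ : Measure G} [μ.IsAddHaarMeasure]

/-- Mollification is a contraction of `L²`. -/
lemma eLpNorm_mollify_le (n : ℕ) {u : G → ℝ} (hu : Measurable u) :
    eLpNorm (mollify μ n u) 2 μ ≤ eLpNorm u 2 μ := by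
  have hmc : Measurable (mollifier μ n) := (contDiff_mollifier μ n).continuous.measurable
  have hpt : ∀ a, ‖mollify μ n u a‖ₑ ^ (2 : ℝ) ≤
      ∫⁻ p, ‖u p‖ₑ ^ (2 : ℝ) * ‖mollifier μ n (p - a)‖ₑ ∂μ := by
    intro a
    -- Jensen's inequality for the probability measure with density `mollifier μ n (· - a)`.
    set d : G → ℝ≥0∞ := fun p => ‖mollifier μ n (p - a)‖ₑ
    have hd : Measurable d := (hmc.comp (measurable_id.sub_const a)).enorm
    have hprob : IsProbabilityMeasure (μ.withDensity d) := by
      constructor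
      rw [withDensity_apply _ MeasurableSet.univ, Measure.restrict_univ,
        lintegral_sub_right_eq_self (fun p => ‖mollifier μ n p‖ₑ) a, lintegral_mollifier]
    have hJ : eLpNorm u 1 (μ.withDensity d) ≤ eLpNorm u 2 (μ.withDensity d) :=
      eLpNorm_le_eLpNorm_of_exponent_le (by norm_num) hu.aestronglyMeasurable
    have h2 := eLpNorm_nnreal_pow_eq_lintegral (f := u) (μ := μ.withDensity d) (p := 2) (by simp)
    calc ‖mollify μ n u a‖ₑ ^ (2 : ℝ) ≤ (eLpNorm u 1 (μ.withDensity d)) ^ (2 : ℝ) := by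
          refine ENNReal.rpow_le_rpow ?_ (by norm_num)
          rw [eLpNorm_one_eq_lintegral_enorm,
            lintegral_withDensity_eq_lintegral_mul _ hd hu.enorm]
          refine (enorm_integral_le_lintegral_enorm _).trans (le_of_eq ?_)
          refine lintegral_congr fun p => ?_
          rw [enorm_mul, mul_comm]
          rfl
      _ ≤ (eLpNorm u 2 (μ.withDensity d)) ^ (2 : ℝ) := ENNReal.rpow_le_rpow hJ (by norm_num)
      _ = ∫⁻ p, ‖u p‖ₑ ^ (2 : ℝ) ∂(μ.withDensity d) := by simpa using h2
      _ = ∫⁻ p, ‖u p‖ₑ ^ (2 : ℝ) * d p ∂μ := by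
          rw [lintegral_withDensity_eq_lintegral_mul _ hd (hu.enorm.pow_const _)]
          refine lintegral_congr fun p => ?_
          simp [mul_comm]
  have h1 := eLpNorm_nnreal_pow_eq_lintegral (f := mollify μ n u) (μ := μ) (p := 2) (by simp)
  have h2 := eLpNorm_nnreal_pow_eq_lintegral (f := u) (μ := μ) (p := 2) (by simp)
  simp only [NNReal.coe_ofNat, ENNReal.coe_ofNat] at h1 h2
  rw [← ENNReal.rpow_le_rpow_iff (z := 2) (by norm_num), h1, h2]
  calc ∫⁻ a, ‖mollify μ n u a‖ₑ ^ (2 : ℝ) ∂μ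
      ≤ ∫⁻ a, ∫⁻ p, ‖u p‖ₑ ^ (2 : ℝ) * ‖mollifier μ n (p - a)‖ₑ ∂μ ∂μ := lintegral_mono hpt
    _ = ∫⁻ p, ∫⁻ a, ‖u p‖ₑ ^ (2 : ℝ) * ‖mollifier μ n (p - a)‖ₑ ∂μ ∂μ := by
        rw [lintegral_lintegral_swap]
        have h1 : Measurable fun q : G × G => ‖u q.2‖ₑ ^ (2 : ℝ) :=
          (hu.comp measurable_snd).enorm.pow_const _
        have h2 : Measurable fun q : G × G => ‖mollifier μ n (q.2 - q.1)‖ₑ :=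
          (hmc.comp (measurable_snd.sub measurable_fst)).enorm
        exact (h1.mul h2).aemeasurable
    _ = ∫⁻ p, ‖u p‖ₑ ^ (2 : ℝ) ∂μ := by
        refine lintegral_congr fun p => ?_
        have hm : Measurable fun a => ‖mollifier μ n (p - a)‖ₑ :=
          (hmc.comp (measurable_const.sub measurable_id)).enorm
        rw [lintegral_const_mul _ hm,
          lintegral_sub_left_eq_self (fun a => ‖mollifier μ n a‖ₑ) p, lintegral_mollifier, mul_one]

end Mollify

/-- A mollified potential tends to zero at infinity. -/
lemma exists_mollify_potential_lt_one {s : Space3 → ℝ} (hs : Measurable s)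
    (hsi : ∫⁻ y, ‖s y‖ₑ < ∞) (n : ℕ) :
    ∃ R : ℝ, ∀ a, R < ‖a‖ → mollify volume n (kconv newtonKernel s) a < 1 := by
  by_contra! hcon
  choose c hc1 hc2 using fun N : ℕ => hcon N
  have hc : Tendsto (fun N => ‖c N‖) atTop atTop :=
    tendsto_atTop_mono (fun N => (hc1 N).le) tendsto_natCast_atTop_atTop
  have hk := isPotentialKernel_newtonKernel
  obtain ⟨M, hM⟩ := (contDiff_mollifier (G := Space3) volume n).continuous.bounded_above_of_compact_support
    (hasCompactSupport_mollifier volume n)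
  have hlim := ENNReal.Tendsto.const_mul (a := ENNReal.ofReal M)
    (hk.tendsto_lintegral_conv_ball hs hsi 1 hc) (Or.inr ENNReal.ofReal_ne_top)
  rw [mul_zero] at hlim
  obtain ⟨N, hN⟩ := (hlim.eventually_lt_const (u := 1) one_pos).exists
  refine absurd hN (not_lt.2 ?_)
  calc (1 : ℝ≥0∞) ≤ ‖mollify volume n (kconv newtonKernel s) (c N)‖ₑ := by
        rw [← ofReal_norm, ← ENNReal.ofReal_one]
        exact ENNReal.ofReal_le_ofReal ((hc2 N).trans (le_abs_self _))
    _ ≤ ∫⁻ p, ‖kconv newtonKernel s p * mollifier volume n (p - c N)‖ₑ :=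
        enorm_integral_le_lintegral_enorm _
    _ ≤ ∫⁻ p, (Metric.ball (c N) 1).indicator
          (fun x => ENNReal.ofReal M * ∫⁻ y, ‖s y‖ₑ * ‖newtonKernel (x - y)‖ₑ) p := by
        refine lintegral_mono fun p => ?_
        by_cases hp : p ∈ Metric.ball (c N) 1
        · rw [indicator_of_mem hp, enorm_mul, mul_comm]
          gcongr
          · rw [← ofReal_norm]
            exact ENNReal.ofReal_le_ofReal (hM _)
          · exact IsPotentialKernel.enorm_kconv_le _ _
        · have : mollifier (volume : Measure Space3) n (p - c N) = 0 := by
            refine mollifier_eq_zero volume ?_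
            rw [mem_ball_iff_norm, not_lt] at hp
            refine le_trans ?_ hp
            rw [div_le_one (by positivity)]
            simp
          simp [this]
    _ = _ := by
        rw [lintegral_indicator Metric.isOpen_ball.measurableSet, lintegral_const_mul]
        exact (hk.measurable_mul_translate hs).lintegral_prod_right'

/-- The Gagliardo-Nirenberg-Sobolev inequality `‖U‖_6 ≤ C ‖∇U‖_2` for Newton potentials, in the
form of a bound for the superlevels of `U`. It does not involve the mass of the density. -/
lemma exists_measure_potential_gt_le : ∃ C : ℝ≥0, ∀ (s : Space3 → ℝ) (E : Space3 → Space3) (B : ℝ≥0),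
    Measurable s → ∫⁻ y, ‖s y‖ₑ < ∞ → Measurable E →
    (∀ i, ∀ᵐ x, E x i = kconv (fun x => coulombKernel x i) s x) →
    eLpNorm E 2 volume ≤ B → ∀ a : ℝ, 0 < a →
      volume {x | 2 + a < kconv newtonKernel s x} ≤ (C * B / ENNReal.ofReal a) ^ (6 : ℝ) := by
  set C : ℝ≥0 := eLpNormLESNormFDerivOfEqInnerConst (volume : Measure Space3) (2 : ℝ≥0)
  refine ⟨C, fun s E B hs hsi hE hEi hEB a ha => ?_⟩
  have hk := isPotentialKernel_newtonKernel
  set U := kconv newtonKernel s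
  have hU : LocallyIntegrable U := hk.locallyIntegrable_kconv hs hsi
  have hEmem : MemLp E 2 volume := ⟨hE.aestronglyMeasurable, hEB.trans_lt ENNReal.coe_lt_top⟩
  have hEloc : LocallyIntegrable (fun x => ‖E x‖) := fun x =>
    (hEmem.locallyIntegrable (by norm_num) x).norm
  set m : ℕ → Space3 → ℝ := fun n => mollify volume n U
  -- The gradient of the mollified potential is dominated by the mollification of `|E|`.
  have hgrad : ∀ n x, ∃ D : Space3 →L[ℝ] ℝ, HasFDerivAt (m n) D x ∧
      ‖D‖ ≤ mollify volume n (fun x => ‖E x‖) x := by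
    intro n x
    obtain ⟨D, hD, hDv⟩ := hasFDerivAt_mollify n hU x
    refine ⟨D, hD, D.opNorm_le_bound
      (integral_nonneg fun p => mul_nonneg (norm_nonneg _) (mollifier_nonneg _ _ _)) fun v => ?_⟩
    set φ : Space3 → ℝ := fun p => mollifier volume n (p - x)
    have hφ : ContDiff ℝ 1 φ := ((contDiff_mollifier volume n).of_le (by exact_mod_cast le_top)).comp
      (contDiff_id.sub contDiff_const)
    have hφc : HasCompactSupport φ :=
      (hasCompactSupport_mollifier volume n).comp_homeomorph (Homeomorph.subRight x)
    have hi : ∀ i, D (EuclideanSpace.single i 1) = -∫ p, E p i * φ p := fun i => by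
      rw [hDv, integral_kconv_newtonKernel_mul_fderiv hs hsi hφ hφc]
      congr 1
      refine integral_congr_ae ?_
      filter_upwards [hEi i] with p hp
      rw [hp]
    have hint : ∀ i, Integrable fun p => E p i * φ p := fun i => by
      have h := (isPotentialKernel_coulombKernel i).locallyIntegrable_kconv hs hsi
      refine (integrable_mul_mollifier n h x).congr ?_
      filter_upwards [hEi i] with p hp
      rw [hp]
    have hv : v = ∑ i, v i • (EuclideanSpace.single i 1 : Space3) := by
      ext j; simp [Pi.single_apply]
    have hDint : D v = -∫ p, (∑ i, v i * (E p i * φ p)) := by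
      rw [integral_finsetSum _ fun i _ => (hint i).const_mul _]
      conv_lhs => rw [hv]
      rw [map_sum, ← Finset.sum_neg_distrib]
      refine Finset.sum_congr rfl fun i _ => ?_
      rw [map_smul, hi, integral_const_mul, smul_eq_mul, mul_neg]
    rw [hDint, norm_neg, mollify, ← integral_mul_const]
    refine norm_integral_le_of_norm_le ((integrable_mul_mollifier n hEloc x).mul_const _)
      (Eventually.of_forall fun p => ?_)
    have hsum : ∑ i, v i * (E p i * φ p) = inner ℝ (E p) v * φ p := by
      rw [PiLp.inner_apply, Finset.sum_mul]
      refine Finset.sum_congr rfl fun i _ => ?_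
      simp only [RCLike.inner_apply, conj_trivial]
      ring
    have hφ0 : 0 ≤ φ p := mollifier_nonneg _ _ _
    rw [hsum, norm_mul, Real.norm_of_nonneg hφ0, mul_right_comm]
    exact mul_le_mul_of_nonneg_right (norm_inner_le_norm _ _) hφ0
  have hmC1 : ∀ n, ContDiff ℝ 1 (m n) := fun n => by
    have hcs := hasCompactSupport_mollifier (volume : Measure Space3) n
    have h1 : ContDiff ℝ 1 (convolution ((stdBump Space3 n).normed volume) U
        (ContinuousLinearMap.lsmul ℝ ℝ) volume) :=
      HasCompactSupport.contDiff_convolution_left _ hcs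
        ((contDiff_mollifier volume n).of_le (by exact_mod_cast le_top)) hU
    rwa [← mollify_eq_convolution] at h1
  have hbound : ∀ n, volume {x | 2 + a < m n x} ≤ (C * B / ENNReal.ofReal a) ^ (6 : ℝ) := by
    intro n
    set w : Space3 → ℝ := fun x => cutoff (m n x)
    have hw : ContDiff ℝ 1 w := contDiff_cutoff.comp (hmC1 n)
    have hwc : HasCompactSupport w := by
      obtain ⟨R, hR⟩ := exists_mollify_potential_lt_one hs hsi n
      refine HasCompactSupport.of_support_subset_isCompact (isCompact_closedBall (0 : Space3) R)
        fun x hx => ?_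
      by_contra h
      rw [mem_closedBall_zero_iff, not_le] at h
      exact hx (cutoff_eq_zero (hR x h).le)
    have hsob := eLpNorm_le_eLpNorm_fderiv_of_eq_inner (volume : Measure Space3) hw hwc
      (p := 2) (p' := 6) (by norm_num) (by simp) (by simp; norm_num)
    have hfd : eLpNorm (fderiv ℝ w) 2 volume ≤ B := by
      calc eLpNorm (fderiv ℝ w) 2 volume
          ≤ eLpNorm (mollify volume n fun x => ‖E x‖) 2 volume := by
            refine eLpNorm_mono fun x => ?_
            obtain ⟨D, hD, hDle⟩ := hgrad n x
            have hwD := (hasDerivAt_cutoff (m n x)).comp_hasFDerivAt x hD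
            have : fderiv ℝ w x = (1 - (max (m n x) 1 ^ 2)⁻¹) • D := hwD.fderiv
            rw [this, norm_smul, Real.norm_eq_abs]
            calc |1 - (max (m n x) 1 ^ 2)⁻¹| * ‖D‖ ≤ 1 * ‖D‖ := by
                  gcongr; exact abs_cutoff_deriv_le _
              _ ≤ _ := by rw [one_mul]; exact hDle.trans (le_abs_self _)
        _ ≤ eLpNorm (fun x => ‖E x‖) 2 volume := eLpNorm_mollify_le n hE.norm
        _ = eLpNorm E 2 volume := eLpNorm_norm _
        _ ≤ B := hEB
    have hcheb := meas_ge_le_mul_pow_eLpNorm_enorm (volume : Measure Space3) (p := 6)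
      (by norm_num) (by norm_num) hw.continuous.aestronglyMeasurable
      (ε := ENNReal.ofReal a) (by simpa using ha) (by simp)
    calc volume {x | 2 + a < m n x} ≤ volume {x | ENNReal.ofReal a ≤ ‖w x‖ₑ} := by
          refine measure_mono fun x hx => ?_
          have hx' : 2 + a < m n x := hx
          have h1 := sub_two_le_cutoff (s := m n x) (by linarith)
          change ENNReal.ofReal a ≤ ‖w x‖ₑ
          rw [← ofReal_norm]
          exact ENNReal.ofReal_le_ofReal
            (le_trans (by simp only [w]; linarith) (le_abs_self (w x)))
      _ ≤ _ := hcheb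
      _ ≤ (C * B / ENNReal.ofReal a) ^ (6 : ℝ) := by
          rw [← ENNReal.mul_rpow_of_nonneg _ _ (by norm_num), ENNReal.div_eq_inv_mul]
          simp only [ENNReal.toReal_ofNat]
          gcongr
          refine le_trans (by exact_mod_cast hsob) ?_
          exact mul_le_mul' (by simp [C]) (by exact_mod_cast hfd)
  refine measure_le_of_ae_eventually (Eventually.of_forall hbound) ?_
  filter_upwards [ae_tendsto_mollify hU] with x hx hxU
  exact hx.eventually_const_lt hxU

/-! ### Measure theory of regular Lagrangian flows -/

/-- A curve in phase space on `[t,T]` with `X' = V` and `V' = E(s, X)`, the second equation in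
integrated form. -/
structure IsTrajectory (E : Fin 3 → ℝ × Space3 → ℝ) (t T : ℝ) (β : ℝ → Phase) : Prop where
  continuousOn : ContinuousOn β (Icc t T)
  hasDerivAt : ∀ s ∈ Ioo t T, HasDerivAt (fun s => (β s).1) (β s).2 s
  position : ∀ s ∈ Icc t T, (β s).1 = (β t).1 + ∫ τ in t..s, (β τ).2
  integrable : ∀ i, IntervalIntegrable (fun τ => E i (τ, (β τ).1)) volume t T
  velocity : ∀ i, ∀ s ∈ Icc t T, (β s).2 i = (β t).2 i + ∫ τ in t..s, E i (τ, (β τ).1)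

lemma aemeasurable_uncurry_comp_countable {α β γ : Type*} [MeasurableSpace α] [MeasurableSpace β]
    [MeasurableSpace γ] {μ : Measure γ} {ν : Measure α} [SFinite ν] {g : γ → ℤ} (hg : Measurable g)
    {W : ℤ → α → β} (hW : ∀ k, AEMeasurable (W k) ν) :
    AEMeasurable (fun q : γ × α => W (g q.1) q.2) (μ.prod ν) := by
  refine ⟨fun q => (hW (g q.1)).mk _ q.2, ?_, ?_⟩
  · have h1 : Measurable fun q : ℤ × α => (hW q.1).mk _ q.2 :=
      measurable_from_prod_countable_right fun k => (hW k).measurable_mk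
    exact h1.comp ((hg.comp measurable_fst).prodMk measurable_snd)
  · have h1 : ∀ᵐ z ∂ν, ∀ k, W k z = (hW k).mk _ z := ae_all_iff.2 fun k => (hW k).ae_eq_mk
    have h2 := (Measure.quasiMeasurePreserving_snd (μ := μ) (ν := ν)).ae h1
    filter_upwards [h2] with q hq
    exact hq _

namespace IsRegularLagrangianFlow

variable {b : ℝ → Phase → Phase} {t T : ℝ} {L : ℝ≥0} {Z : ℝ → Phase → Phase}

lemma ae_continuousOn (hZ : IsRegularLagrangianFlow b t T L Z) :
    ∀ᵐ z, ContinuousOn (fun s => Z s z) (Icc t T) := by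
  filter_upwards [hZ.integral_solution] with z ⟨hi, hz⟩
  rcases le_or_gt t T with htT | htT
  · have h1 : ContinuousOn (fun s => z + ∫ τ in t..s, b τ (Z τ z)) (Icc t T) := by
      have := intervalIntegral.continuousOn_primitive_interval (a := t) (b := T) (μ := volume)
        (f := fun τ => b τ (Z τ z)) (by rwa [uIcc_of_le htT])
      rw [uIcc_of_le htT] at this
      exact continuousOn_const.add this
    exact h1.congr fun s hs => hz s hs
  · simp [Icc_eq_empty (not_le.2 htT)]

lemma ae_initial (hZ : IsRegularLagrangianFlow b t T L Z) (htT : t ≤ T) : ∀ᵐ z, Z t z = z := by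
  filter_upwards [hZ.integral_solution] with z ⟨_, hz⟩
  simpa using hz t (left_mem_Icc.2 htT)

/-- A flow is jointly measurable: it is the limit of its restrictions to finer and finer grids of
times. -/
lemma aemeasurable_uncurry (hZ : IsRegularLagrangianFlow b t T L Z) (htT : t ≤ T) :
    AEMeasurable (fun q : ℝ × Phase => Z q.1 q.2) ((volume.restrict (Icc t T)).prod volume) := by
  set r : ℕ → ℤ → ℝ := fun n k => max t (min T ((k : ℝ) / (n + 1)))
  have hr : ∀ n k, r n k ∈ Icc t T := fun n k =>
    ⟨le_max_left _ _, max_le htT (min_le_left _ _)⟩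
  set g : ℕ → ℝ → ℤ := fun n s => ⌊s * (n + 1)⌋
  have hg : ∀ n, Measurable (g n) := fun n => (measurable_id.mul_const _).floor
  have hlim : ∀ s ∈ Icc t T, Tendsto (fun n => r n (g n s)) atTop (𝓝[Icc t T] s) := by
    intro s hs
    refine tendsto_nhdsWithin_iff.2 ⟨?_, Eventually.of_forall fun n => hr _ _⟩
    have h1 : Tendsto (fun n : ℕ => ((g n s : ℤ) : ℝ) / (n + 1)) atTop (𝓝 s) := by
      have h0 : Tendsto (fun n : ℕ => s - 1 / ((n : ℝ) + 1)) atTop (𝓝 s) := by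
        simpa using (tendsto_const_nhds (x := s)).sub
          (tendsto_one_div_add_atTop_nhds_zero_nat (𝕜 := ℝ))
      refine tendsto_of_tendsto_of_tendsto_of_le_of_le h0 tendsto_const_nhds (fun n => ?_)
        fun n => ?_
      · have hp : (0 : ℝ) < n + 1 := by positivity
        have := Int.lt_floor_add_one (s * ((n : ℝ) + 1))
        simp only [g]
        rw [sub_le_iff_le_add, ← add_div, le_div_iff₀ hp]
        exact this.le
      · have hp : (0 : ℝ) < n + 1 := by positivity
        have := Int.floor_le (s * ((n : ℝ) + 1))
        simp only [g]
        rwa [div_le_iff₀ hp]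
    have h2 : Tendsto (fun n : ℕ => r n (g n s)) atTop (𝓝 (max t (min T s))) :=
      tendsto_const_nhds.max (tendsto_const_nhds.min h1)
    rwa [min_eq_right hs.2, max_eq_right hs.1] at h2
  refine aemeasurable_of_tendsto_metrizable_ae atTop
    (f := fun n (q : ℝ × Phase) => Z (r n (g n q.1)) q.2) (fun n => ?_) ?_
  · exact aemeasurable_uncurry_comp_countable (W := fun k => Z (r n k)) (hg n)
      fun k => hZ.aemeasurable _ (hr n k)
  · have h1 := (Measure.quasiMeasurePreserving_snd
      (μ := volume.restrict (Icc t T)) (ν := (volume : Measure Phase))).ae hZ.ae_continuousOn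
    have h2 := (Measure.quasiMeasurePreserving_fst
      (μ := volume.restrict (Icc t T)) (ν := (volume : Measure Phase))).ae
      (ae_restrict_mem measurableSet_Icc)
    filter_upwards [h1, h2] with q hq1 hq2
    exact (hq1 q.1 hq2).tendsto.comp (hlim q.1 hq2)

lemma aemeasurable_graph (hZ : IsRegularLagrangianFlow b t T L Z) (htT : t ≤ T) :
    AEMeasurable (fun q : ℝ × Phase => (q.1, Z q.1 q.2))
      ((volume.restrict (Icc t T)).prod volume) :=
  measurable_fst.aemeasurable.prodMk (hZ.aemeasurable_uncurry htT)

/-- The space-time form of the compressibility of a flow. -/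
lemma map_graph_le (hZ : IsRegularLagrangianFlow b t T L Z) (htT : t ≤ T) :
    ((volume.restrict (Icc t T)).prod volume).map (fun q : ℝ × Phase => (q.1, Z q.1 q.2)) ≤
      (L : ℝ≥0∞) • (volume.restrict (Icc t T)).prod volume := by
  have hm := hZ.aemeasurable_uncurry htT
  refine Measure.le_iff.2 fun A hA => ?_
  have hcongr : (fun q : ℝ × Phase => (q.1, Z q.1 q.2)) =ᵐ[(volume.restrict (Icc t T)).prod volume]
      fun q => (q.1, hm.mk _ q) := by
    filter_upwards [hm.ae_eq_mk] with q hq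
    rw [hq]
  have hmk : Measurable fun q : ℝ × Phase => (q.1, hm.mk _ q) :=
    measurable_fst.prodMk hm.measurable_mk
  rw [Measure.map_congr hcongr, Measure.map_apply hmk hA, Measure.prod_apply (hmk hA),
    Measure.smul_apply, Measure.prod_apply hA, smul_eq_mul,
    ← lintegral_const_mul _ (measurable_measure_prodMk_left hA)]
  refine lintegral_mono_ae ?_
  filter_upwards [Measure.ae_ae_of_ae_prod hm.ae_eq_mk, ae_restrict_mem measurableSet_Icc]
    with s hs hsI
  refine le_trans (le_of_eq ?_)
    (hZ.compression s hsI (Prod.mk s ⁻¹' A) (measurable_prodMk_left hA))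
  refine measure_congr ?_
  filter_upwards [hs] with z hz
  change ((s, hm.mk _ (s, z)) ∈ A) = ((s, Z s z) ∈ A)
  rw [← hz]

lemma lintegral_lintegral_comp_le (hZ : IsRegularLagrangianFlow b t T L Z) (htT : t ≤ T)
    {f : ℝ × Phase → ℝ≥0∞} (hf : Measurable f) :
    ∫⁻ z, ∫⁻ s in Icc t T, f (s, Z s z) ≤ L * ∫⁻ s in Icc t T, ∫⁻ z, f (s, z) := by
  have hg := hZ.aemeasurable_graph htT
  have hfg : AEMeasurable (fun q : ℝ × Phase => f (q.1, Z q.1 q.2))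
      ((volume.restrict (Icc t T)).prod volume) := hf.comp_aemeasurable hg
  calc ∫⁻ z, ∫⁻ s in Icc t T, f (s, Z s z)
      = ∫⁻ s in Icc t T, ∫⁻ z, f (s, Z s z) := (lintegral_lintegral_swap hfg).symm
    _ = ∫⁻ q, f (q.1, Z q.1 q.2) ∂((volume.restrict (Icc t T)).prod volume) :=
        (lintegral_prod _ hfg).symm
    _ = ∫⁻ q, f q ∂(((volume.restrict (Icc t T)).prod volume).map
          fun q : ℝ × Phase => (q.1, Z q.1 q.2)) := (lintegral_map' hf.aemeasurable hg).symm
    _ ≤ ∫⁻ q, f q ∂((L : ℝ≥0∞) • (volume.restrict (Icc t T)).prod volume) :=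
        lintegral_mono' (hZ.map_graph_le htT) le_rfl
    _ = L * ∫⁻ s in Icc t T, ∫⁻ z, f (s, z) := by
        rw [lintegral_smul_measure, smul_eq_mul, lintegral_prod _ hf.aemeasurable]

lemma aemeasurable_lintegral_comp (hZ : IsRegularLagrangianFlow b t T L Z) (htT : t ≤ T)
    {f : ℝ × Phase → ℝ≥0∞} (hf : Measurable f) :
    AEMeasurable (fun z => ∫⁻ s in Icc t T, f (s, Z s z)) volume := by
  have h : AEMeasurable (fun q : ℝ × Phase => f (q.1, Z q.1 q.2))
      ((volume.restrict (Icc t T)).prod volume) :=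
    hf.comp_aemeasurable (hZ.aemeasurable_graph htT)
  exact h.prod_swap.lintegral_prod_right'

/-- A property which holds almost everywhere in phase space at time `s` holds almost everywhere
along the flow. -/
lemma ae_comp (hZ : IsRegularLagrangianFlow b t T L Z) {s : ℝ} (hs : s ∈ Icc t T)
    {P : Phase → Prop} (hP : ∀ᵐ z, P z) : ∀ᵐ z, P (Z s z) := by
  rw [ae_iff] at hP ⊢
  obtain ⟨A, hA, hAm, hA0⟩ := exists_measurable_superset_of_null hP
  refine measure_mono_null (fun z hz => hA hz) (t := Z s ⁻¹' A) (le_antisymm ?_ bot_le)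
  simpa [hA0] using hZ.compression s hs A hAm

lemma ae_comp_position (hZ : IsRegularLagrangianFlow b t T L Z) {s : ℝ} (hs : s ∈ Icc t T)
    {P : Space3 → Prop} (hP : ∀ᵐ x, P x) : ∀ᵐ z, P (Z s z).1 := by
  refine hZ.ae_comp hs (P := fun z => P z.1) ?_
  rw [Measure.volume_eq_prod]
  exact Measure.quasiMeasurePreserving_fst.ae hP

lemma ae_ae_comp (hZ : IsRegularLagrangianFlow b t T L Z) (htT : t ≤ T) {P : ℝ × Phase → Prop}
    (hP : ∀ᵐ q ∂((volume.restrict (Icc t T)).prod volume), P q) :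
    ∀ᵐ z, ∀ᵐ s ∂(volume.restrict (Icc t T)), P (s, Z s z) := by
  obtain ⟨A, hA, hAm, hA0⟩ := exists_measurable_superset_of_null (ae_iff.1 hP)
  have h : ∫⁻ z, ∫⁻ s in Icc t T, A.indicator 1 (s, Z s z) = 0 := by
    refine le_antisymm ((hZ.lintegral_lintegral_comp_le htT
      (measurable_one.indicator hAm)).trans ?_) bot_le
    rw [← lintegral_prod _ (measurable_one.indicator hAm).aemeasurable, lintegral_indicator_one hAm,
      hA0, mul_zero]
  rw [lintegral_eq_zero_iff' (hZ.aemeasurable_lintegral_comp htT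
    (measurable_one.indicator hAm))] at h
  filter_upwards [h, hZ.ae_continuousOn] with z hz hc
  have hcm : AEMeasurable (fun s => Z s z) (volume.restrict (Icc t T)) :=
    hc.aemeasurable measurableSet_Icc
  have hm : AEMeasurable (fun s => (A.indicator 1 (s, Z s z) : ℝ≥0∞))
      (volume.restrict (Icc t T)) :=
    (measurable_one.indicator hAm).comp_aemeasurable (aemeasurable_id.prodMk hcm)
  have hz' : ∫⁻ s in Icc t T, (A.indicator 1 (s, Z s z) : ℝ≥0∞) = 0 := hz
  rw [lintegral_eq_zero_iff' hm] at hz'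
  filter_upwards [hz'] with s hs
  by_contra hcon
  have : (s, Z s z) ∈ A := hA hcon
  simp [indicator_of_mem this] at hs

/-- A property which holds almost everywhere on `(0,T) × ℝ³` holds along almost all trajectories
at almost all times. -/
lemma ae_ae_comp_position (hZ : IsRegularLagrangianFlow b t T L Z) (ht : 0 ≤ t) (htT : t ≤ T)
    {P : ℝ × Space3 → Prop} (hP : ∀ᵐ p ∂(slabMeasure T), P p) :
    ∀ᵐ z, ∀ᵐ s ∂(volume.restrict (Icc t T)), P (s, (Z s z).1) := by
  refine hZ.ae_ae_comp htT (P := fun q => P (q.1, q.2.1)) ?_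
  have hle : volume.restrict (Icc t T) ≤ volume.restrict (Ioo 0 T) := by
    rw [← restrict_Ioo_eq_restrict_Icc]
    exact Measure.restrict_mono (Ioo_subset_Ioo_left ht) le_rfl
  have hac : ((volume.restrict (Icc t T)).prod (volume : Measure Space3)) ≪ slabMeasure T :=
    hle.absolutelyContinuous.prod Measure.AbsolutelyContinuous.rfl
  have h1 : ∀ᵐ p ∂((volume.restrict (Icc t T)).prod (volume : Measure Space3)), P p :=
    hac.ae_le hP
  have h2 := (Measure.quasiMeasurePreserving_fst
    (μ := (volume.restrict (Icc t T)).prod (volume : Measure Space3))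
    (ν := (volume : Measure Space3))).ae h1
  rw [Measure.volume_eq_prod]
  have h3 := (measurePreserving_prodAssoc (volume.restrict (Icc t T))
    (volume : Measure Space3) (volume : Measure Space3)).symm.quasiMeasurePreserving.ae h2
  exact h3

/-- Almost all flow lines of the Vlasov field are trajectories. -/
lemma ae_isTrajectory {Ef : ℝ → Space3 → Space3} {E : Fin 3 → ℝ × Space3 → ℝ}
    (hZ : IsRegularLagrangianFlow (vlasovField Ef) t T L Z) (ht : 0 ≤ t) (htT : t ≤ T)
    (hE : ∀ᵐ p ∂(slabMeasure T), ∀ i, Ef p.1 p.2 i = E i p) :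
    ∀ᵐ z, IsTrajectory E t T fun s => Z s z := by
  filter_upwards [hZ.integral_solution, hZ.ae_continuousOn, hZ.ae_initial htT,
    hZ.ae_ae_comp_position ht htT hE] with z ⟨hi, hz⟩ hc h0 hEz
  have hsub : ∀ s ∈ Icc t T, Ioc t s ⊆ Icc t T := fun s hs =>
    Ioc_subset_Icc_self.trans (Icc_subset_Icc_right hs.2)
  have hV : ContinuousOn (fun s => (Z s z).2) (Icc t T) := continuous_snd.comp_continuousOn hc
  have hii : ∀ s ∈ Icc t T, IntegrableOn (fun τ => vlasovField Ef τ (Z τ z)) (Ioc t s) volume :=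
    fun s hs => hi.mono_set (hsub s hs)
  have hpos : ∀ s ∈ Icc t T, (Z s z).1 = (Z t z).1 + ∫ τ in t..s, (Z τ z).2 := fun s hs => by
    rw [h0]
    conv_lhs => rw [hz s hs]
    rw [Prod.fst_add, intervalIntegral.integral_of_le hs.1, intervalIntegral.integral_of_le hs.1,
      fst_integral (hii s hs)]
    rfl
  have hEint : IntegrableOn (fun τ => Ef τ (Z τ z).1) (Icc t T) volume := hi.snd
  have hproj : ∀ i, IntegrableOn (fun τ => Ef τ (Z τ z).1 i) (Icc t T) volume := fun i =>
    (EuclideanSpace.proj (𝕜 := ℝ) i).integrable_comp hEint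
  refine ⟨hc, fun s hs => ?_, hpos, fun i => ?_, fun i s hs => ?_⟩
  · have hVat : ContinuousAt (fun s => (Z s z).2) s := hV.continuousAt (Icc_mem_nhds hs.1 hs.2)
    have hd : HasDerivAt (fun s => ∫ τ in t..s, (Z τ z).2) (Z s z).2 s := by
      refine intervalIntegral.integral_hasDerivAt_right
        ((hV.mono (Icc_subset_Icc_right hs.2.le)).intervalIntegrable_of_Icc hs.1.le) ?_ hVat
      exact (hV.mono Ioo_subset_Icc_self).stronglyMeasurableAtFilter isOpen_Ioo s hs
    refine (hd.const_add (Z t z).1).congr_of_eventuallyEq ?_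
    filter_upwards [Icc_mem_nhds hs.1 hs.2] with s' hs'
    exact hpos s' hs'
  · rw [intervalIntegrable_iff_integrableOn_Icc_of_le htT]
    refine (hproj i).congr_fun_ae ?_
    filter_upwards [hEz] with s hs
    exact hs i
  · rw [h0]
    conv_lhs => rw [hz s hs]
    have h1 : (∫ τ in t..s, vlasovField Ef τ (Z τ z)).2 = ∫ τ in t..s, Ef τ (Z τ z).1 := by
      rw [intervalIntegral.integral_of_le hs.1, intervalIntegral.integral_of_le hs.1,
        snd_integral (hii s hs)]
      rfl
    rw [Prod.snd_add, PiLp.add_apply, h1]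
    congr 1
    rw [intervalIntegral.integral_of_le hs.1, intervalIntegral.integral_of_le hs.1]
    have h2 := (EuclideanSpace.proj (𝕜 := ℝ) i).integral_comp_comm (hEint.mono_set (hsub s hs))
    refine h2.symm.trans (integral_congr_ae ?_)
    filter_upwards [ae_restrict_of_ae_restrict_of_subset (hsub s hs) hEz] with τ hτ
    exact hτ i

end IsRegularLagrangianFlow

/-! ### Conservation of energy along the flow -/

lemma exists_subseq_tendsto_zero {α : Type*} [MeasurableSpace α] {μ : Measure α}
    {d : ℕ → α → ℝ≥0∞} (hd : ∀ n, AEMeasurable (d n) μ)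
    (hlim : Tendsto (fun n => ∫⁻ z, d n z ∂μ) atTop (𝓝 0)) :
    ∃ n : ℕ → ℕ, StrictMono n ∧ ∀ᵐ z ∂μ, Tendsto (fun k => d (n k) z) atTop (𝓝 0) := by
  have hev : ∀ k : ℕ, ∀ᶠ n in atTop, ∫⁻ z, d n z ∂μ ≤ (2⁻¹ : ℝ≥0∞) ^ k := fun k =>
    ENNReal.tendsto_nhds_zero.1 hlim _ (ENNReal.pow_pos (by simp) k)
  obtain ⟨n, hn, hle⟩ := extraction_forall_of_eventually hev
  refine ⟨n, hn, ?_⟩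
  have hsum : ∫⁻ z, ∑' k, d (n k) z ∂μ ≠ ∞ := by
    rw [lintegral_tsum fun k => hd (n k)]
    refine ((ENNReal.tsum_le_tsum hle).trans_lt ?_).ne
    rw [ENNReal.tsum_geometric, ENNReal.one_sub_inv_two, inv_inv]
    simp
  filter_upwards [ae_lt_top' (AEMeasurable.tsum fun k => hd (n k)) hsum] with z hz
  exact ENNReal.tendsto_atTop_zero_of_tsum_ne_top hz.ne

/-- The function `g` of time and position, cut off to positions and velocities of norm below `R`.
A function which does not depend on the velocity is not integrable over phase space; the cutoff in
velocity makes the compressibility of a flow applicable to it. -/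
def localized (R : ℝ) (g : ℝ × Space3 → ℝ≥0∞) (q : ℝ × Phase) : ℝ≥0∞ :=
  (Metric.ball (0 : Space3) R).indicator (fun x => g (q.1, x)) q.2.1 *
    (Metric.ball (0 : Space3) R).indicator 1 q.2.2

lemma measurable_localized {R : ℝ} {g : ℝ × Space3 → ℝ≥0∞} (hg : Measurable g) :
    Measurable (localized R g) := by
  have h1 : Measurable fun q : ℝ × Phase =>
      (Metric.ball (0 : Space3) R).indicator (fun x => g (q.1, x)) q.2.1 := by
    have : (fun q : ℝ × Phase => (Metric.ball (0 : Space3) R).indicator (fun x => g (q.1, x)) q.2.1)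
        = ((fun q : ℝ × Phase => q.2.1) ⁻¹' Metric.ball (0 : Space3) R).indicator
          fun q => g (q.1, q.2.1) := by
      ext q; simp [indicator]
    rw [this]
    refine Measurable.indicator (hg.comp (by fun_prop)) ?_
    exact (measurable_fst.comp measurable_snd) Metric.isOpen_ball.measurableSet
  have h2 : Measurable fun q : ℝ × Phase =>
      ((Metric.ball (0 : Space3) R).indicator 1 q.2.2 : ℝ≥0∞) :=
    (measurable_one.indicator Metric.isOpen_ball.measurableSet).comp
      (measurable_snd.comp measurable_snd)
  exact h1.mul h2

lemma localized_eq {R : ℝ} {g : ℝ × Space3 → ℝ≥0∞} {s : ℝ} {z : Phase} (hx : ‖z.1‖ < R)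
    (hv : ‖z.2‖ < R) : localized R g (s, z) = g (s, z.1) := by
  simp [localized, indicator_of_mem, hx, hv]

lemma lintegral_localized {R : ℝ} {g : ℝ × Space3 → ℝ≥0∞} (hg : Measurable g) (s : ℝ) :
    ∫⁻ z, localized R g (s, z) =
      (∫⁻ x in Metric.ball (0 : Space3) R, g (s, x)) * volume (Metric.ball (0 : Space3) R) := by
  have h1 : Measurable ((Metric.ball (0 : Space3) R).indicator fun x => g (s, x)) :=
    (hg.comp measurable_prodMk_left).indicator Metric.isOpen_ball.measurableSet
  have h2 : Measurable ((Metric.ball (0 : Space3) R).indicator 1 : Space3 → ℝ≥0∞) :=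
    measurable_one.indicator Metric.isOpen_ball.measurableSet
  rw [Measure.volume_eq_prod]
  simp only [localized]
  rw [lintegral_prod_mul h1.aemeasurable h2.aemeasurable,
    lintegral_indicator Metric.isOpen_ball.measurableSet,
    lintegral_indicator_one Metric.isOpen_ball.measurableSet]

namespace IsRegularLagrangianFlow

variable {b : ℝ → Phase → Phase} {t T : ℝ} {L : ℝ≥0} {Z : ℝ → Phase → Phase}

lemma lintegral_localized_le (hZ : IsRegularLagrangianFlow b t T L Z) (htT : t ≤ T) (R : ℝ)
    {g : ℝ × Space3 → ℝ≥0∞} (hg : Measurable g) :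
    ∫⁻ z, ∫⁻ s in Icc t T, localized R g (s, Z s z) ≤
      L * volume (Metric.ball (0 : Space3) R) * ∫⁻ p in univ ×ˢ Metric.ball (0 : Space3) R, g p := by
  refine (hZ.lintegral_lintegral_comp_le htT (measurable_localized hg)).trans ?_
  have hm : Measurable fun s => ∫⁻ x in Metric.ball (0 : Space3) R, g (s, x) :=
    hg.lintegral_prod_right'
  simp only [lintegral_localized hg]
  rw [lintegral_mul_const _ hm, IsSlabDensity.setLIntegral_prod_ball hg, mul_assoc,
    mul_comm (volume _)]
  gcongr
  exact Measure.restrict_le_self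

/-- The size of the errors made in mollifying the source `F` and the field `E`. -/
def mollifyError (F : ℝ × Space3 → ℝ) (E : Fin 3 → ℝ × Space3 → ℝ) (n : ℕ)
    (p : ℝ × Space3) : ℝ≥0∞ :=
  ‖mollify volume n F p - F p‖ₑ + ∑ i, ‖mollify volume n (E i) p - E i p‖ₑ

lemma _root_.VanishesInMean.measurable_mollify_sub {u : ℝ × Space3 → ℝ} (hu : VanishesInMean u)
    (n : ℕ) : Measurable fun p => ‖mollify volume n u p - u p‖ₑ :=
  ((continuous_mollify n hu.locallyIntegrable).measurable.sub hu.measurable).enorm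

lemma measurable_mollifyError {U F : ℝ × Space3 → ℝ} {E : Fin 3 → ℝ × Space3 → ℝ}
    (h : IsPotentialOf T U F E) (n : ℕ) : Measurable (mollifyError F E n) :=
  (h.source.measurable_mollify_sub n).add
    (Finset.measurable_sum _ fun i _ => (h.field i).measurable_mollify_sub n)

lemma tendsto_lintegral_mollifyError {U F : ℝ × Space3 → ℝ} {E : Fin 3 → ℝ × Space3 → ℝ}
    (h : IsPotentialOf T U F E) (R : ℝ) :
    Tendsto (fun n => ∫⁻ p in univ ×ˢ Metric.ball (0 : Space3) R, mollifyError F E n p)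
      atTop (𝓝 0) := by
  have h1 : ∀ n, ∫⁻ p in univ ×ˢ Metric.ball (0 : Space3) R, mollifyError F E n p =
      (∫⁻ p in univ ×ˢ Metric.ball (0 : Space3) R, ‖mollify volume n F p - F p‖ₑ) +
        ∑ i, ∫⁻ p in univ ×ˢ Metric.ball (0 : Space3) R,
          ‖mollify volume n (E i) p - E i p‖ₑ := fun n => by
    unfold mollifyError
    rw [lintegral_add_left (h.source.measurable_mollify_sub n),
      lintegral_finsetSum _ fun i _ => (h.field i).measurable_mollify_sub n]
  simp_rw [h1]
  have h2 := (h.source.tendsto_lintegral_mollify_sub R).add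
    (tendsto_finsetSum Finset.univ fun i _ => (h.field i).tendsto_lintegral_mollify_sub R)
  simpa using h2

/-- Along almost every flow line, as long as it remains in the ball of radius `R`, a subsequence of
the mollified fields converges in `L¹` in time. -/
lemma exists_subseq_mollifyError {U F : ℝ × Space3 → ℝ} {E : Fin 3 → ℝ × Space3 → ℝ}
    (hZ : IsRegularLagrangianFlow b t T L Z) (htT : t ≤ T) (h : IsPotentialOf T U F E) (R : ℝ) :
    ∃ n : ℕ → ℕ, StrictMono n ∧ ∀ᵐ z, Tendsto (fun k => ∫⁻ s in Icc t T,
      localized R (mollifyError F E (n k)) (s, Z s z)) atTop (𝓝 0) := by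
  refine exists_subseq_tendsto_zero
    (d := fun n z => ∫⁻ s in Icc t T, localized R (mollifyError F E n) (s, Z s z))
    (fun n => hZ.aemeasurable_lintegral_comp htT
      (measurable_localized (measurable_mollifyError h n))) ?_
  have h2 := ENNReal.Tendsto.const_mul
    (a := L * volume (Metric.ball (0 : Space3) R)) (tendsto_lintegral_mollifyError h R)
    (Or.inr (ENNReal.mul_ne_top ENNReal.coe_ne_top measure_ball_lt_top.ne))
  rw [mul_zero] at h2
  exact tendsto_of_tendsto_of_tendsto_of_le_of_le tendsto_const_nhds h2 (fun _ => bot_le)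
    fun n => hZ.lintegral_localized_le htT R (measurable_mollifyError h n)

lemma ae_lintegral_localized_lt_top {u : ℝ × Space3 → ℝ}
    (hZ : IsRegularLagrangianFlow b t T L Z) (htT : t ≤ T) (hu : VanishesInMean u) (R : ℝ) :
    ∀ᵐ z, ∫⁻ s in Icc t T, localized R (fun p => ‖u p‖ₑ) (s, Z s z) < ∞ := by
  refine ae_lt_top' (hZ.aemeasurable_lintegral_comp htT
    (measurable_localized hu.measurable.enorm)) (lt_of_le_of_lt
      (hZ.lintegral_localized_le htT R hu.measurable.enorm) ?_).ne
  exact ENNReal.mul_lt_top (ENNReal.mul_lt_top ENNReal.coe_lt_top measure_ball_lt_top)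
    (hu.lintegral_lt_top 0 R)

lemma _root_.IsTrajectory.energy_identity {U F : ℝ × Space3 → ℝ}
    {E : Fin 3 → ℝ × Space3 → ℝ} {β : ℝ → Phase} (hβ : IsTrajectory E t T β)
    (h : IsPotentialOf T U F E) (ht : 0 ≤ t) {s₁ s₂ : ℝ} (hs₁ : s₁ ∈ Ioo t T) (hle : s₁ ≤ s₂)
    (hs₂ : s₂ < T) (hFi : IntegrableOn (fun τ => F (τ, (β τ).1)) (Icc t T))
    {n : ℕ → ℕ} (hn : StrictMono n)
    (hlim : Tendsto (fun k => ∫⁻ s in Icc t T, mollifyError F E (n k) (s, (β s).1)) atTop (𝓝 0))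
    (hU₁ : Tendsto (fun n => mollify volume n U (s₁, (β s₁).1)) atTop (𝓝 (U (s₁, (β s₁).1))))
    (hU₂ : Tendsto (fun n => mollify volume n U (s₂, (β s₂).1)) atTop (𝓝 (U (s₂, (β s₂).1)))) :
    ‖(β s₂).2‖ ^ 2 / 2 + U (s₂, (β s₂).1) =
      ‖(β s₁).2‖ ^ 2 / 2 + U (s₁, (β s₁).1) - ∫ τ in s₁..s₂, F (τ, (β τ).1) := by
  have htT : t ≤ T := (hs₁.1.trans hs₁.2).le
  have hXc : ContinuousOn (fun s => (β s).1) (Icc t T) :=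
    continuous_fst.comp_continuousOn hβ.continuousOn
  have hVc : ContinuousOn (fun s => (β s).2) (Icc t T) :=
    continuous_snd.comp_continuousOn hβ.continuousOn
  have hIcc : Icc s₁ s₂ ⊆ Icc t T := Icc_subset_Icc hs₁.1.le hs₂.le
  have hEint : ∀ i, ∀ a ∈ Icc t T, ∀ c ∈ Icc t T,
      IntervalIntegrable (fun τ => E i (τ, (β τ).1)) volume a c := fun i a ha c hc =>
    (hβ.integrable i).mono_set (by
      rw [uIcc_of_le htT]; exact uIcc_subset_Icc ha hc)
  have htI : t ∈ Icc t T := left_mem_Icc.2 htT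
  have hs₁I : s₁ ∈ Icc t T := Ioo_subset_Icc_self hs₁
  have hs₂I : s₂ ∈ Icc t T := ⟨hs₁.1.le.trans hle, hs₂.le⟩
  have hsmall : ∀ f : ℕ → ℝ × Space3 → ℝ≥0∞, (∀ m p, f m p ≤ mollifyError F E (n m) p) →
      Tendsto (fun m => ∫⁻ τ in Icc s₁ s₂, f m (τ, (β τ).1)) atTop (𝓝 0) := by
    intro f hf
    refine tendsto_of_tendsto_of_tendsto_of_le_of_le tendsto_const_nhds hlim (fun _ => bot_le)
      fun m => ?_
    exact (lintegral_mono_set hIcc).trans (lintegral_mono fun τ => hf m _)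
  have hF : Tendsto (fun m => ∫⁻ τ in Icc s₁ s₂,
      ‖mollify volume (n m) F (τ, (β τ).1) - F (τ, (β τ).1)‖ₑ) atTop (𝓝 0) :=
    hsmall (fun m p => ‖mollify volume (n m) F p - F p‖ₑ) fun m p => by
      unfold mollifyError; exact le_self_add
  have hE : ∀ i, Tendsto (fun m => ∫⁻ τ in Icc s₁ s₂,
      ‖mollify volume (n m) (E i) (τ, (β τ).1) - E i (τ, (β τ).1)‖ₑ) atTop (𝓝 0) := fun i =>
    hsmall (fun m p => ‖mollify volume (n m) (E i) p - E i p‖ₑ) fun m p => by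
      unfold mollifyError
      exact (Finset.single_le_sum (f := fun i => ‖mollify volume (n m) (E i) p - E i p‖ₑ)
        (fun _ _ => bot_le) (Finset.mem_univ i)).trans le_add_self
  have hvel : ∀ i, ∀ s ∈ Icc s₁ s₂,
      (β s).2 i = (β s₁).2 i + ∫ τ in s₁..s, E i (τ, (β τ).1) := fun i s hs => by
    have hsI := hIcc hs
    rw [hβ.velocity i s hsI, hβ.velocity i s₁ hs₁I, add_assoc,
      intervalIntegral.integral_add_adjacent_intervals (hEint i t htI s₁ hs₁I)
        (hEint i s₁ hs₁I s hsI)]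
  have hder : ∀ s ∈ Ioo s₁ s₂, HasDerivAt (fun s => (β s).1) (β s).2 s := fun s hs =>
    hβ.hasDerivAt s ⟨hs₁.1.trans hs.1, hs.2.trans hs₂⟩
  have hFi' : IntervalIntegrable (fun τ => F (τ, (β τ).1)) volume s₁ s₂ :=
    (intervalIntegrable_iff_integrableOn_Icc_of_le hle).2 (hFi.mono_set hIcc)
  exact h.energy_identity (X := fun s => (β s).1) (V := fun s => (β s).2) hle
    (ht.trans_lt hs₁.1) hs₂ (hXc.mono hIcc) (hVc.mono hIcc) hder
    (fun i => hEint i _ hs₁I _ hs₂I) hFi' hvel hn.tendsto_atTop hF hE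
    (hU₁.comp hn.tendsto_atTop) (hU₂.comp hn.tendsto_atTop)

lemma _root_.VanishesInMean.ae_slab_tendsto_mollify {u : ℝ × Space3 → ℝ} (hu : VanishesInMean u) :
    ∀ᵐ p ∂(slabMeasure T), Tendsto (fun n => mollify volume n u p) atTop (𝓝 (u p)) := by
  have h1 := ae_tendsto_mollify hu.locallyIntegrable
  rw [Measure.volume_eq_prod] at h1
  have hac : slabMeasure T ≪ (volume : Measure ℝ).prod (volume : Measure Space3) :=
    Measure.restrict_le_self.absolutelyContinuous.prod Measure.AbsolutelyContinuous.rfl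
  exact hac.ae_le h1

lemma lintegral_localized_eq {R : ℝ} {β : ℝ → Phase}
    (hR : ∀ s ∈ Icc t T, ‖(β s).1‖ < R ∧ ‖(β s).2‖ < R) (f : ℝ × Space3 → ℝ≥0∞) :
    ∫⁻ s in Icc t T, localized R f (s, β s) = ∫⁻ s in Icc t T, f (s, (β s).1) :=
  setLIntegral_congr_fun measurableSet_Icc fun s hs => localized_eq (hR s hs).1 (hR s hs).2

lemma aestronglyMeasurable_comp_position {u : ℝ × Space3 → ℝ} (hu : Measurable u)
    {β : ℝ → Phase} (hβ : ContinuousOn β (Icc t T)) :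
    AEStronglyMeasurable (fun τ => u (τ, (β τ).1)) (volume.restrict (Icc t T)) := by
  have hXc : ContinuousOn (fun s => (β s).1) (Icc t T) := continuous_fst.comp_continuousOn hβ
  refine (hu.comp_aemeasurable ?_).aestronglyMeasurable
  exact aemeasurable_id.prodMk (hXc.aemeasurable measurableSet_Icc)

/-- Conservation of energy along the flow lines which remain in a ball. -/
lemma ae_energy_identity_of_bounded {Ef : ℝ → Space3 → Space3} {U F : ℝ × Space3 → ℝ}
    {E : Fin 3 → ℝ × Space3 → ℝ} (hZ : IsRegularLagrangianFlow (vlasovField Ef) t T L Z)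
    (h : IsPotentialOf T U F E) (ht : 0 ≤ t)
    (hE : ∀ᵐ p ∂(slabMeasure T), ∀ i, Ef p.1 p.2 i = E i p) {s₁ : ℝ} (hs₁ : s₁ ∈ Ioo t T)
    (hU₁ : ∀ᵐ x, Tendsto (fun n => mollify volume n U (s₁, x)) atTop (𝓝 (U (s₁, x)))) (R : ℝ) :
    ∀ᵐ z, (∀ s ∈ Icc t T, ‖(Z s z).1‖ < R ∧ ‖(Z s z).2‖ < R) →
      IntegrableOn (fun τ => F (τ, (Z τ z).1)) (Icc t T) ∧
      ∀ᵐ s₂ ∂(volume.restrict (Icc t T)), s₁ ≤ s₂ →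
        ‖(Z s₂ z).2‖ ^ 2 / 2 + U (s₂, (Z s₂ z).1) =
          ‖(Z s₁ z).2‖ ^ 2 / 2 + U (s₁, (Z s₁ z).1) - ∫ τ in s₁..s₂, F (τ, (Z τ z).1) := by
  have htT : t ≤ T := (hs₁.1.trans hs₁.2).le
  obtain ⟨n, hn, hnz⟩ := hZ.exists_subseq_mollifyError htT h R
  have hneT : ∀ᵐ s ∂(volume.restrict (Icc t T)), s ≠ T :=
    ae_restrict_of_ae (compl_mem_ae_iff.2 (measure_singleton T))
  have h5 := hZ.ae_comp_position (Ioo_subset_Icc_self hs₁) hU₁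
  have h4 := hZ.ae_ae_comp_position ht htT h.potential.ae_slab_tendsto_mollify
  filter_upwards [hnz, hZ.ae_lintegral_localized_lt_top htT h.source R,
    hZ.ae_isTrajectory ht htT hE, h4, h5] with z hz1 hz2 hz3 hz4 hz5 hzR
  have hFi : IntegrableOn (fun τ => F (τ, (Z τ z).1)) (Icc t T) :=
    ⟨aestronglyMeasurable_comp_position h.source.measurable hz3.continuousOn,
      by rwa [lintegral_localized_eq hzR] at hz2⟩
  simp only [lintegral_localized_eq hzR] at hz1
  refine ⟨hFi, ?_⟩
  filter_upwards [hz4, ae_restrict_mem measurableSet_Icc, hneT] with s₂ hUs₂ hs₂ hs₂T hle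
  exact hz3.energy_identity h ht hs₁ hle (lt_of_le_of_ne hs₂.2 hs₂T) hFi hn hz1 hz5 hUs₂

/-- Conservation of energy along the flow. The potential is defined only almost everywhere, so the
initial time `s₁` has to be one at which the mollified potentials converge; almost every time has
this property. -/
lemma ae_energy_identity {Ef : ℝ → Space3 → Space3} {U F : ℝ × Space3 → ℝ}
    {E : Fin 3 → ℝ × Space3 → ℝ} (hZ : IsRegularLagrangianFlow (vlasovField Ef) t T L Z)
    (h : IsPotentialOf T U F E) (ht : 0 ≤ t)
    (hE : ∀ᵐ p ∂(slabMeasure T), ∀ i, Ef p.1 p.2 i = E i p) {s₁ : ℝ} (hs₁ : s₁ ∈ Ioo t T)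
    (hU₁ : ∀ᵐ x, Tendsto (fun n => mollify volume n U (s₁, x)) atTop (𝓝 (U (s₁, x)))) :
    ∀ᵐ z, IntegrableOn (fun τ => F (τ, (Z τ z).1)) (Icc t T) ∧
      ∀ᵐ s₂ ∂(volume.restrict (Icc t T)), s₁ ≤ s₂ →
        ‖(Z s₂ z).2‖ ^ 2 / 2 + U (s₂, (Z s₂ z).1) =
          ‖(Z s₁ z).2‖ ^ 2 / 2 + U (s₁, (Z s₁ z).1) - ∫ τ in s₁..s₂, F (τ, (Z τ z).1) := by
  have hR := ae_all_iff.2 fun R : ℕ => hZ.ae_energy_identity_of_bounded h ht hE hs₁ hU₁ R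
  filter_upwards [hR, hZ.ae_continuousOn] with z hz hc
  obtain ⟨C, hC⟩ := isCompact_Icc.exists_bound_of_continuousOn hc
  obtain ⟨R, hR⟩ := exists_nat_gt C
  exact hz R fun s hs => ⟨(norm_fst_le _).trans_lt ((hC s hs).trans_lt hR),
    (norm_snd_le _).trans_lt ((hC s hs).trans_lt hR)⟩

end IsRegularLagrangianFlow

/-! ### Weighted integrability of the source in phase space -/

/-- The weight `1 / (h (1 + log h))`, which is the derivative of `log (1 + log h)`, at
`h = 1 + |v|² / 2`. -/
def logWeight (h : ℝ) : ℝ := (h * (1 + Real.log h))⁻¹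

/-- The weight in the velocity variable. -/
def velWeight (v : Space3) : ℝ := logWeight (1 + ‖v‖ ^ 2 / 2)

/-- The radius at which the Coulomb kernel is split, as a function of `|v|`. It is chosen so that
`velWeight v ≤ 6 (splitRadius |v|)²` and so that `(splitRadius |v|)³` is integrable over `ℝ³`;
without the logarithm the latter integral diverges. -/
def splitRadius (y : ℝ) : ℝ := ((1 + y) * √(1 + Real.log (1 + y)))⁻¹

lemma logWeight_pos {h : ℝ} (hh : 1 ≤ h) : 0 < logWeight h := by
  have := Real.log_nonneg hh
  unfold logWeight
  positivity

lemma logWeight_anti {h h' : ℝ} (hh : 1 ≤ h) (hle : h ≤ h') : logWeight h' ≤ logWeight h := by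
  have h1 := Real.log_nonneg hh
  have h2 := Real.log_le_log (by linarith) hle
  have h3 : 0 ≤ h' := by linarith
  unfold logWeight
  refine inv_anti₀ (by positivity) ?_
  gcongr

lemma one_le_energy (v : Space3) : 1 ≤ 1 + ‖v‖ ^ 2 / 2 := by
  have := sq_nonneg ‖v‖; linarith

lemma splitRadius_pos {y : ℝ} (hy : 0 ≤ y) : 0 < splitRadius y := by
  have := Real.log_nonneg (show (1 : ℝ) ≤ 1 + y by linarith)
  unfold splitRadius
  positivity

lemma splitRadius_sq {y : ℝ} (hy : 0 ≤ y) :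
    splitRadius y ^ 2 = ((1 + y) ^ 2 * (1 + Real.log (1 + y)))⁻¹ := by
  have := Real.log_nonneg (show (1 : ℝ) ≤ 1 + y by linarith)
  rw [splitRadius, inv_pow, mul_pow, Real.sq_sqrt (by linarith)]

lemma velWeight_le (v : Space3) : velWeight v ≤ 6 * splitRadius ‖v‖ ^ 2 := by
  set y := ‖v‖
  have hy : 0 ≤ y := norm_nonneg v
  rw [splitRadius_sq hy, velWeight, logWeight]
  set l := Real.log (1 + y)
  have hl : 0 ≤ l := Real.log_nonneg (by linarith)
  have h1 : (1 + y) ^ 2 / 3 ≤ 1 + y ^ 2 / 2 := by nlinarith [sq_nonneg (y - 2)]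
  have h2 : 0 ≤ Real.log (1 + y ^ 2 / 2) := Real.log_nonneg (one_le_energy v)
  have h3 : 2 * l - 2 ≤ Real.log (1 + y ^ 2 / 2) := by
    have h4 : Real.log ((1 + y) ^ 2 / 3) ≤ Real.log (1 + y ^ 2 / 2) :=
      Real.log_le_log (by positivity) h1
    rw [Real.log_div (by positivity) (by norm_num), Real.log_pow] at h4
    have h5 : Real.log 3 ≤ 2 := (Real.log_le_sub_one_of_pos (by norm_num)).trans (by norm_num)
    push_cast at h4
    simp only [l]
    linarith
  -- For `l ≤ 1` the logarithm is merely nonnegative, for `l ≥ 1` it is at least `2 l - 2`.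
  have h6 : (1 + l) / 2 ≤ 1 + Real.log (1 + y ^ 2 / 2) := by
    rcases le_total l 1 with h | h <;> linarith
  calc ((1 + y ^ 2 / 2) * (1 + Real.log (1 + y ^ 2 / 2)))⁻¹
      ≤ ((1 + y) ^ 2 / 3 * ((1 + l) / 2))⁻¹ := by
        refine inv_anti₀ (by positivity) ?_
        gcongr
    _ = 6 * ((1 + y) ^ 2 * (1 + l))⁻¹ := by field_simp; norm_num

lemma measurable_velWeight : Measurable velWeight := by
  unfold velWeight logWeight
  exact Measurable.inv (by fun_prop)

lemma measurable_splitRadius_norm : Measurable fun v : Space3 => splitRadius ‖v‖ := by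
  unfold splitRadius
  exact Measurable.inv (by fun_prop)

lemma integrable_splitRadius_pow : Integrable fun v : Space3 => splitRadius ‖v‖ ^ 3 := by
  rw [integrable_fun_norm_addHaar volume (f := fun y => splitRadius y ^ 3)]
  simp only [finrank_euclideanSpace, Fintype.card_fin, smul_eq_mul]
  have hlog : ∀ y : ℝ, 0 ≤ y → 0 ≤ Real.log (1 + y) := fun y hy => Real.log_nonneg (by linarith)
  -- An explicit primitive of `1 / ((1 + y) (1 + log (1 + y))^{3/2})`.
  have hprim : ∀ y ∈ Ici (0 : ℝ), HasDerivAt (fun y => -2 * (√(1 + Real.log (1 + y)))⁻¹)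
      ((1 + y)⁻¹ * ((1 + Real.log (1 + y)) * √(1 + Real.log (1 + y)))⁻¹) y := by
    intro y hy
    have hy0 : (0 : ℝ) ≤ y := hy
    have hl := hlog y hy0
    have hne : √(1 + Real.log (1 + y)) ≠ 0 := (Real.sqrt_pos.2 (by linarith)).ne'
    have hd1 : HasDerivAt (fun y : ℝ => 1 + y) 1 y := (hasDerivAt_id y).const_add 1
    have hd := (((hd1.log (by linarith : (1 + y) ≠ 0)).const_add 1).sqrt
      (by linarith : (1 + Real.log (1 + y)) ≠ 0)).inv hne
    refine (hd.const_mul (-2)).congr_deriv ?_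
    rw [Real.sq_sqrt (by linarith)]
    field_simp
  have hint := integrableOn_Ioi_deriv_of_nonneg' hprim (fun y hy => by
    have := hlog y (le_of_lt hy)
    have hy0 : (0 : ℝ) < y := hy
    positivity) (l := -2 * 0) (by
    refine Tendsto.const_mul _ (tendsto_inv_atTop_zero.comp ?_)
    exact Real.tendsto_sqrt_atTop.comp (tendsto_atTop_add_const_left _ _
      (Real.tendsto_log_atTop.comp (tendsto_atTop_add_const_left _ _ tendsto_id))))
  refine hint.mono' ?_ ?_
  · have : Measurable fun y : ℝ => y ^ (3 - 1) * splitRadius y ^ 3 := by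
      unfold splitRadius
      exact (measurable_id.pow_const _).mul (Measurable.pow_const (Measurable.inv (by fun_prop)) _)
    exact this.aestronglyMeasurable
  · filter_upwards [ae_restrict_mem measurableSet_Ioi] with y hy
    have hy0 : (0 : ℝ) < y := hy
    have hl := hlog y hy0.le
    have hs := splitRadius_pos hy0.le
    rw [Real.norm_of_nonneg (by positivity), pow_succ (splitRadius y) 2, splitRadius_sq hy0.le,
      splitRadius]
    have hsq : 0 < √(1 + Real.log (1 + y)) := Real.sqrt_pos.2 (by linarith)
    have h1 : y ^ (3 - 1) ≤ (1 + y) ^ 2 := by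
      norm_num
      gcongr
      linarith
    calc y ^ (3 - 1) * (((1 + y) ^ 2 * (1 + Real.log (1 + y)))⁻¹ *
          ((1 + y) * √(1 + Real.log (1 + y)))⁻¹)
        ≤ (1 + y) ^ 2 * (((1 + y) ^ 2 * (1 + Real.log (1 + y)))⁻¹ *
          ((1 + y) * √(1 + Real.log (1 + y)))⁻¹) := by gcongr
      _ = _ := by field_simp

/-- The contribution of the singular part of the Coulomb kernel, at distances below
`splitRadius |v|`, to the weighted potential. -/
def nearPot (s : ℝ → Space3 → ℝ) (q : ℝ × Phase) : ℝ≥0∞ :=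
  ENNReal.ofReal (velWeight q.2.2) * ∫⁻ y, ‖s q.1 y‖ₑ *
    (Metric.ball (0 : Space3) (splitRadius ‖q.2.2‖)).indicator (fun x => ‖coulombKernel x‖ₑ)
      (q.2.1 - y)

lemma measurable_nearPot {T : ℝ} {M : ℝ≥0} {s : ℝ → Space3 → ℝ} (hs : IsSlabDensity T M s) :
    Measurable (nearPot s) := by
  have hw : Measurable fun q : ℝ × Phase => ENNReal.ofReal (velWeight q.2.2) :=
    (measurable_velWeight.comp (measurable_snd.comp measurable_snd)).ennreal_ofReal
  have h1 : Measurable fun r : (ℝ × Phase) × Space3 => ‖s r.1.1 r.2‖ₑ := by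
    have : Measurable fun r : (ℝ × Phase) × Space3 => s r.1.1 r.2 :=
      hs.measurable.comp ((measurable_fst.comp measurable_fst).prodMk measurable_snd)
    exact this.enorm
  have hd : Measurable fun r : (ℝ × Phase) × Space3 => r.1.2.1 - r.2 :=
    (measurable_fst.comp (measurable_snd.comp measurable_fst)).sub measurable_snd
  have hset : MeasurableSet {r : (ℝ × Phase) × Space3 |
      ‖r.1.2.1 - r.2‖ < splitRadius ‖r.1.2.2‖} :=
    measurableSet_lt hd.norm (measurable_splitRadius_norm.comp
      (measurable_snd.comp (measurable_snd.comp measurable_fst)))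
  have h2 : Measurable fun r : (ℝ × Phase) × Space3 =>
      (Metric.ball (0 : Space3) (splitRadius ‖r.1.2.2‖)).indicator (fun x => ‖coulombKernel x‖ₑ)
      (r.1.2.1 - r.2) := by
    have h3 := ((measurable_coulombKernel.comp hd).enorm).indicator hset
    convert h3 using 1
    ext r
    simp [indicator]
  exact hw.mul (h1.mul h2).lintegral_prod_right'

/-- The weighted potential is the sum of an integrable and of a bounded function on phase space. -/
lemma absPot_mul_velWeight_le {T : ℝ} {M : ℝ≥0} {s : ℝ → Space3 → ℝ} (hs : IsSlabDensity T M s)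
    (q : ℝ × Phase) :
    absPot (fun x => ‖coulombKernel x‖) s (q.1, q.2.1) * ENNReal.ofReal (velWeight q.2.2) ≤
      nearPot s q + 6 * M := by
  set δ := splitRadius ‖q.2.2‖
  have hδ : 0 < δ := splitRadius_pos (norm_nonneg _)
  set w := ENNReal.ofReal (velWeight q.2.2)
  have hker : ∀ x : Space3, ‖coulombKernel x‖ₑ ≤
      (Metric.ball (0 : Space3) δ).indicator (fun x => ‖coulombKernel x‖ₑ) x +
        ENNReal.ofReal ((δ ^ 2)⁻¹) := by
    intro x
    by_cases hx : x ∈ Metric.ball (0 : Space3) δ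
    · rw [indicator_of_mem hx]; exact le_self_add
    · rw [indicator_of_notMem hx, zero_add, ← ofReal_norm, norm_coulombKernel]
      refine ENNReal.ofReal_le_ofReal (inv_anti₀ (by positivity) ?_)
      rw [mem_ball_zero_iff, not_lt] at hx
      have h1 : δ ^ 2 ≤ ‖x‖ ^ 2 := by gcongr
      nlinarith [Real.pi_gt_three, sq_nonneg ‖x‖]
  have hst := (hs.measurable_time q.1).enorm
  calc absPot (fun x => ‖coulombKernel x‖) s (q.1, q.2.1) * w
      ≤ (∫⁻ y, (‖s q.1 y‖ₑ * (Metric.ball (0 : Space3) δ).indicator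
          (fun x => ‖coulombKernel x‖ₑ) (q.2.1 - y) +
            ‖s q.1 y‖ₑ * ENNReal.ofReal ((δ ^ 2)⁻¹))) * w := by
        gcongr
        refine lintegral_mono fun y => ?_
        rw [← mul_add, enorm_norm]
        gcongr
        exact hker _
    _ = nearPot s q + (∫⁻ y, ‖s q.1 y‖ₑ) * ENNReal.ofReal ((δ ^ 2)⁻¹) * w := by
        rw [lintegral_add_right _ (hst.mul_const _), lintegral_mul_const _ hst, add_mul, nearPot]
        congr 1
        exact mul_comm _ _
    _ ≤ nearPot s q + M * 6 := by
        rw [mul_assoc]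
        gcongr
        · exact hs.lintegral_le q.1
        · rw [← ENNReal.ofReal_mul (by positivity)]
          refine (ENNReal.ofReal_le_ofReal (q := 6) ?_).trans (by simp)
          rw [inv_mul_le_iff₀ (by positivity), mul_comm]
          exact velWeight_le _
    _ = _ := by rw [mul_comm (M : ℝ≥0∞)]

/-- The mass of the Coulomb kernel in the ball of radius `δ` is of order `δ`, so that the near part
has an integral of order `∫ velWeight v δ(v) dv ≤ 6 ∫ δ(v)³ dv`. -/
lemma exists_lintegral_nearPot_le : ∃ C : ℝ≥0, ∀ (T : ℝ) (M : ℝ≥0) (s : ℝ → Space3 → ℝ),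
    IsSlabDensity T M s → ∀ t, ∫⁻ z, nearPot s (t, z) ≤ C * M := by
  obtain ⟨c, hc⟩ := lintegral_coulombKernel_ball
  set W : ℝ≥0∞ := ∫⁻ v : Space3, ENNReal.ofReal (splitRadius ‖v‖ ^ 3)
  have hW : W < ∞ := by
    refine lt_of_le_of_lt (lintegral_mono fun v => ?_) integrable_splitRadius_pow.2
    rw [← ofReal_norm]
    exact ENNReal.ofReal_le_ofReal (le_abs_self _)
  refine ⟨6 * c * W.toNNReal, fun T M s hs t => ?_⟩
  have hm : Measurable fun z : Phase => nearPot s (t, z) :=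
    (measurable_nearPot hs).comp measurable_prodMk_left
  rw [Measure.volume_eq_prod] at *
  rw [lintegral_prod_symm' _ hm]
  have hv : ∀ v : Space3, ∫⁻ x, nearPot s (t, (x, v)) ≤
      ENNReal.ofReal (splitRadius ‖v‖ ^ 3) * (6 * c * M) := by
    intro v
    set δ := splitRadius ‖v‖
    have hδ : 0 < δ := splitRadius_pos (norm_nonneg _)
    set I : Space3 → ℝ≥0∞ := (Metric.ball (0 : Space3) δ).indicator fun x => ‖coulombKernel x‖ₑ
    have hI : Measurable I :=
      measurable_coulombKernel.enorm.indicator Metric.isOpen_ball.measurableSet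
    have hst := (hs.measurable_time t).enorm
    have hprod : Measurable fun p : Space3 × Space3 => ‖s t p.2‖ₑ * I (p.1 - p.2) :=
      (hst.comp measurable_snd).mul (hI.comp (measurable_fst.sub measurable_snd))
    calc ∫⁻ x, nearPot s (t, (x, v))
        = ENNReal.ofReal (velWeight v) * ∫⁻ x, ∫⁻ y, ‖s t y‖ₑ * I (x - y) := by
          simp only [nearPot]
          rw [lintegral_const_mul _ hprod.lintegral_prod_right']
      _ = ENNReal.ofReal (velWeight v) * ∫⁻ y, ‖s t y‖ₑ * ∫⁻ x, I x := by
          rw [lintegral_lintegral_swap hprod.aemeasurable]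
          congr 1
          refine lintegral_congr fun y => ?_
          have hIy : Measurable fun x => I (x - y) := hI.comp (measurable_id.sub_const y)
          rw [lintegral_const_mul _ hIy, lintegral_sub_right_eq_self I y]
      _ = ENNReal.ofReal (velWeight v) * ((∫⁻ y, ‖s t y‖ₑ) *
            ∫⁻ x in Metric.ball (0 : Space3) δ, ‖coulombKernel x‖ₑ) := by
          rw [lintegral_mul_const _ hst, lintegral_indicator Metric.isOpen_ball.measurableSet]
      _ ≤ ENNReal.ofReal (6 * δ ^ 2) * (M * (c * ENNReal.ofReal δ)) := by
          gcongr
          · exact velWeight_le v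
          · exact hs.lintegral_le t
          · exact hc δ hδ.le
      _ = ENNReal.ofReal (δ ^ 3) * (6 * c * M) := by
          rw [pow_succ δ 2, ENNReal.ofReal_mul (by positivity), ENNReal.ofReal_mul (by positivity)]
          simp only [ENNReal.ofReal_ofNat]
          ring
  calc ∫⁻ v, ∫⁻ x, nearPot s (t, (x, v))
      ≤ ∫⁻ v : Space3, ENNReal.ofReal (splitRadius ‖v‖ ^ 3) * (6 * c * M) := lintegral_mono hv
    _ = W * (6 * c * M) := by
        rw [lintegral_mul_const _ (measurable_splitRadius_norm.pow_const 3).ennreal_ofReal]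
    _ = _ := by
        push_cast
        rw [ENNReal.coe_toNNReal hW.ne]
        ring

/-! ### Growth of the kinetic energy along a trajectory -/

/-- The primitive `log (1 + log h)` of `logWeight`. It tends to infinity, so that a bound on it is a
bound on `h`. -/
def logGrowth (h : ℝ) : ℝ := Real.log (1 + Real.log h)

lemma hasDerivAt_logGrowth {h : ℝ} (hh : 1 ≤ h) : HasDerivAt logGrowth (logWeight h) h := by
  have h1 := Real.log_nonneg hh
  refine (((Real.hasDerivAt_log (by linarith : h ≠ 0)).const_add 1).log
    (by linarith : 1 + Real.log h ≠ 0)).congr_deriv ?_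
  rw [logWeight, mul_inv, div_eq_mul_inv]

lemma logWeight_le_one {h : ℝ} (hh : 1 ≤ h) : logWeight h ≤ 1 := by
  have h1 := Real.log_nonneg hh
  exact inv_le_one_of_one_le₀ (by nlinarith)

lemma logGrowth_mono {h h' : ℝ} (hh : 1 ≤ h) (hle : h ≤ h') : logGrowth h ≤ logGrowth h' := by
  have h1 := Real.log_nonneg hh
  have h2 := Real.log_le_log (by linarith) hle
  exact Real.log_le_log (by linarith) (by linarith)

lemma lipschitzOnWith_logGrowth : LipschitzOnWith 1 logGrowth (Ici 1) := by
  refine (convex_Ici 1).lipschitzOnWith_of_nnnorm_hasDerivWithin_le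
    (fun h hh => (hasDerivAt_logGrowth hh).hasDerivWithinAt) fun h hh => ?_
  rw [← NNReal.coe_le_coe, coe_nnnorm, Real.norm_of_nonneg (logWeight_pos hh).le]
  exact logWeight_le_one hh

lemma tendsto_logGrowth : Tendsto logGrowth atTop atTop :=
  Real.tendsto_log_atTop.comp
    (tendsto_atTop_add_const_left _ _ Real.tendsto_log_atTop)

/-- If `e` is dominated by a function with derivative `-f`, then `logGrowth e` is controlled by the
integral of `|f|` with the weight `logWeight e`. The bound `1 ≤ c` is part of the conclusion because
`logGrowth c` is meaningful only then. -/
lemma ofReal_logGrowth_le {s₁ T c : ℝ} (hs₁ : s₁ < T) {f e : ℝ → ℝ}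
    (hf : IntegrableOn f (Icc s₁ T)) (he : ContinuousOn e (Icc s₁ T))
    (he1 : ∀ s ∈ Icc s₁ T, 1 ≤ e s)
    (hle : ∀ᵐ s ∂(volume.restrict (Icc s₁ T)), e s ≤ c - ∫ τ in s₁..s, f τ) :
    1 ≤ c ∧ ∀ s ∈ Icc s₁ T, ENNReal.ofReal (logGrowth (e s)) ≤ ENNReal.ofReal (logGrowth c) +
      ∫⁻ τ in Icc s₁ T, ‖f τ‖ₑ * ENNReal.ofReal (logWeight (e τ)) := by
  set h : ℝ → ℝ := fun s => c + ∫ τ in s₁..s, -f τ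
  have hh : ContinuousOn h (Icc s₁ T) := by
    have := intervalIntegral.continuousOn_primitive_interval (a := s₁) (b := T) (μ := volume)
      (f := fun τ => -f τ) (by rw [uIcc_of_le hs₁.le]; exact hf.neg)
    rw [uIcc_of_le hs₁.le] at this
    exact continuousOn_const.add this
  -- By continuity, the domination holds at every time.
  have hle' : ∀ s ∈ Icc s₁ T, e s ≤ h s := by
    have h1 : (fun s => max (e s) (h s)) =ᵐ[volume.restrict (Icc s₁ T)] h := by
      filter_upwards [hle] with s hs
      refine max_eq_right (hs.trans (le_of_eq ?_))
      simp only [h, intervalIntegral.integral_neg]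
      ring
    have h2 := Measure.eqOn_Icc_of_ae_eq volume hs₁.ne h1 (he.sup hh) hh
    exact fun s hs => le_of_max_le_left (h2 hs).le
  have hs₁' : s₁ ∈ Icc s₁ T := left_mem_Icc.2 hs₁.le
  refine ⟨(he1 s₁ hs₁').trans ((hle' s₁ hs₁').trans (by simp [h])), fun s hs => ?_⟩
  have hsub : Icc s₁ s ⊆ Icc s₁ T := Icc_subset_Icc_right hs.2
  have hint : IntervalIntegrable (fun τ => -f τ) volume s₁ s := by
    rw [intervalIntegrable_iff_integrableOn_Icc_of_le hs.1]
    exact (hf.mono_set hsub).neg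
  have key := integral_deriv_comp_primitive (c := c) hint lipschitzOnWith_logGrowth
    (fun x hx => hasDerivAt_logGrowth hx) (fun τ hτ => by
      rw [uIcc_of_le hs.1] at hτ
      exact (he1 τ (hsub hτ)).trans (hle' τ (hsub hτ)))
  have h1 : logGrowth (e s) ≤ logGrowth c + ∫ τ in s₁..s, logWeight (h τ) * -f τ := by
    rw [key]
    have := logGrowth_mono (he1 s hs) (hle' s hs)
    simp only [h] at this
    linarith
  calc ENNReal.ofReal (logGrowth (e s))
      ≤ ENNReal.ofReal (logGrowth c) + ENNReal.ofReal (∫ τ in s₁..s, logWeight (h τ) * -f τ) :=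
        (ENNReal.ofReal_le_ofReal h1).trans ENNReal.ofReal_add_le
    _ ≤ ENNReal.ofReal (logGrowth c) +
          ∫⁻ τ in Icc s₁ T, ‖f τ‖ₑ * ENNReal.ofReal (logWeight (e τ)) := by
        gcongr
        rw [intervalIntegral.integral_of_le hs.1]
        calc ENNReal.ofReal (∫ τ in Ioc s₁ s, logWeight (h τ) * -f τ)
            ≤ ‖∫ τ in Ioc s₁ s, logWeight (h τ) * -f τ‖ₑ := by
              rw [← ofReal_norm]
              exact ENNReal.ofReal_le_ofReal (le_abs_self _)
          _ ≤ ∫⁻ τ in Ioc s₁ s, ‖logWeight (h τ) * -f τ‖ₑ := enorm_integral_le_lintegral_enorm _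
          _ ≤ ∫⁻ τ in Ioc s₁ s, ‖f τ‖ₑ * ENNReal.ofReal (logWeight (e τ)) := by
              refine setLIntegral_mono_ae' measurableSet_Ioc (ae_of_all _ fun τ hτ => ?_)
              have hτ' := hsub (Ioc_subset_Icc_self hτ)
              rw [enorm_mul, enorm_neg, mul_comm]
              gcongr
              rw [← ofReal_norm, Real.norm_of_nonneg
                (logWeight_pos ((he1 τ hτ').trans (hle' τ hτ'))).le]
              exact ENNReal.ofReal_le_ofReal (logWeight_anti (he1 τ hτ') (hle' τ hτ'))
          _ ≤ _ := lintegral_mono_set (Ioc_subset_Icc_self.trans hsub)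

/-! ### Measurable representatives of the data -/

lemma slabMeasure_eq_restrict (T : ℝ) :
    slabMeasure T = (volume : Measure (ℝ × Space3)).restrict (Ioo 0 T ×ˢ univ) := by
  rw [slabMeasure, Measure.volume_eq_prod, ← Measure.prod_restrict, Measure.restrict_univ]

lemma integral_slabMeasure {T : ℝ} {f : ℝ × Space3 → ℝ} (hf : ∀ p, p.1 ∉ Ioo 0 T → f p = 0) :
    ∫ p, f p ∂(slabMeasure T) = ∫ p, f p := by
  rw [slabMeasure_eq_restrict]
  exact setIntegral_eq_integral_of_forall_compl_eq_zero fun p hp =>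
    hf p fun h => hp ⟨h, mem_univ _⟩

lemma ae_slabMeasure_of_ae_time {T : ℝ} {P : ℝ → Prop}
    (h : ∀ᵐ t ∂(volume.restrict (Ioo 0 T)), P t) : ∀ᵐ p ∂(slabMeasure T), P p.1 :=
  Measure.quasiMeasurePreserving_fst.ae h

lemma ae_eLpNorm_le_of_normLinftyLq_le {F : Type*} [NormedAddCommGroup F] {T : ℝ} {q M : ℝ≥0∞}
    {u : ℝ → Space3 → F} (h : normLinftyLq T q u ≤ M) :
    ∀ᵐ t ∂(volume.restrict (Ioo 0 T)), eLpNorm (u t) q volume ≤ M :=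
  (ENNReal.ae_le_essSup _).mono fun _ ht => ht.trans h

/-- An element of `L^∞_t L^1_x` has a representative for which measurability and the bound hold
at every time. -/
lemma exists_slab_representative {F : Type*} [NormedAddCommGroup F] [MeasurableSpace F]
    [BorelSpace F] {T : ℝ} {M : ℝ≥0} {u : ℝ → Space3 → F} (hu : MemLinftyLq T 1 u)
    (hM : normLinftyLq T 1 u ≤ M) : ∃ v : ℝ → Space3 → F,
      StronglyMeasurable (fun p : ℝ × Space3 => v p.1 p.2) ∧ (∀ t, ∫⁻ y, ‖v t y‖ₑ ≤ M) ∧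
      (∀ t, t ∉ Ioo 0 T → v t = 0) ∧
      ∀ᵐ t ∂(volume.restrict (Ioo 0 T)), v t =ᵐ[volume] u t := by
  set w : ℝ × Space3 → F := hu.1.mk _
  have hw : StronglyMeasurable w := hu.1.stronglyMeasurable_mk
  have hwu : ∀ᵐ t ∂(volume.restrict (Ioo 0 T)), ∀ᵐ y, u t y = w (t, y) :=
    Measure.ae_ae_of_ae_prod hu.1.ae_eq_mk
  set G : Set ℝ := {t | t ∈ Ioo 0 T ∧ ∫⁻ y, ‖w (t, y)‖ₑ ≤ M}
  have hG : MeasurableSet G := measurableSet_Ioo.inter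
    (measurableSet_le hw.enorm.lintegral_prod_right' measurable_const)
  refine ⟨fun t y => (Prod.fst ⁻¹' G).indicator w (t, y),
    hw.indicator (measurable_fst hG), fun t => ?_, fun t ht => ?_, ?_⟩
  · by_cases ht : t ∈ G
    · simpa [indicator, ht] using ht.2
    · simp [indicator, ht]
  · ext y
    have : t ∉ G := fun h => ht h.1
    simp [indicator, this]
  · filter_upwards [hwu, ae_eLpNorm_le_of_normLinftyLq_le hM, ae_restrict_mem measurableSet_Ioo]
      with t ht htM htT
    have htG : t ∈ G := by
      refine ⟨htT, ?_⟩
      rw [eLpNorm_one_eq_lintegral_enorm] at htM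
      rwa [← lintegral_congr_ae (ht.mono fun y hy => congrArg enorm hy)]
    filter_upwards [ht] with y hy
    simp [indicator, htG, hy]

lemma enorm_invLaplacianDiv_le (j : Space3 → Space3) (x : Space3) :
    ‖invLaplacianDiv j x‖ₑ ≤ ∫⁻ y, ‖‖j y‖‖ₑ * ‖‖coulombKernel (x - y)‖‖ₑ := by
  refine (enorm_integral_le_lintegral_enorm _).trans (lintegral_mono fun y => ?_)
  simp only [enorm_neg, enorm_norm]
  rw [← ofReal_norm, ← ofReal_norm, ← ofReal_norm, ← ENNReal.ofReal_mul (norm_nonneg _),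
    mul_comm ‖j y‖]
  exact ENNReal.ofReal_le_ofReal (norm_inner_le_norm _ _)

lemma coulombField_apply {s : Space3 → ℝ} (hs : Measurable s) {x : Space3}
    (hx : ∫⁻ y, ‖s y‖ₑ * ‖‖coulombKernel (x - y)‖‖ₑ < ∞) (i : Fin 3) :
    coulombField s x i = kconv (fun x => coulombKernel x i) s x := by
  have hi : Integrable fun y => s y • coulombKernel (x - y) := by
    refine ⟨(hs.smul (measurable_coulombKernel.comp
      (measurable_const.sub measurable_id))).aestronglyMeasurable, ?_⟩
    simpa only [HasFiniteIntegral, enorm_smul, enorm_norm] using hx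
  have := (EuclideanSpace.proj (𝕜 := ℝ) i).integral_comp_comm hi
  simpa [coulombField, kconv] using this.symm

/-- A potential `U` of the field `Ef` with the bounds that the estimate of the superlevels of the
flow uses; `j` is the modulus of the current, and `A` bounds the norm of `U` in `L^∞_t L^6_x`, up to
a truncation near zero. -/
structure IsFieldPotential (T : ℝ) (A CJ Cb : ℝ≥0) (Ef : ℝ → Space3 → Space3)
    (U F : ℝ × Space3 → ℝ) (E : Fin 3 → ℝ × Space3 → ℝ) (j : ℝ → Space3 → ℝ) : Prop where
  isPotentialOf : IsPotentialOf T U F E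
  field_eq : ∀ᵐ p ∂(slabMeasure T), ∀ i, Ef p.1 p.2 i = E i p
  lower_bound : ∀ᵐ p ∂(slabMeasure T), -(Cb : ℝ) ≤ U p
  superlevel : ∀ᵐ t ∂(volume.restrict (Ioo 0 T)), ∀ a : ℝ, 0 < a →
    volume {x | 2 + a < U (t, x)} ≤ (A / ENNReal.ofReal a) ^ (6 : ℝ)
  isSlabDensity : IsSlabDensity T CJ j
  source_le : ∀ p, ‖F p‖ₑ ≤ absPot (fun x => ‖coulombKernel x‖) j p

lemma kconv_congr_ae {k s s' : Space3 → ℝ} (h : s =ᵐ[volume] s') : kconv k s = kconv k s' := by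
  ext x
  exact integral_congr_ae (h.mono fun y hy => by simp only [hy])

lemma coulombField_congr_ae {s s' : Space3 → ℝ} (h : s =ᵐ[volume] s') :
    coulombField s = coulombField s' := by
  ext1 x
  exact integral_congr_ae (h.mono fun y hy => by simp only [hy])

lemma invLaplacianDiv_congr_ae {j j' : Space3 → Space3} (h : j =ᵐ[volume] j') :
    invLaplacianDiv j = invLaplacianDiv j' := by
  ext1 x
  exact integral_congr_ae (h.mono fun y hy => by simp only [hy])

/-- The charge density `ρ - ρ_b`, with `ρ ≥ 0`, has a representative of which the potential
of the background charge bounds the potential from below. -/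
lemma exists_density_representative {T : ℝ} {Cb : ℝ≥0} {ρ : ℝ → Space3 → ℝ} {ρb : Space3 → ℝ}
    (hρ : MemLinftyLq T 1 ρ) (hρ0 : ∀ᵐ p ∂(slabMeasure T), 0 ≤ ρ p.1 p.2)
    (hρb : MemLp ρb 1 volume) (hCb : eLpNorm (newtonPotential ρb) ⊤ volume ≤ Cb) :
    ∃ (M : ℝ≥0) (σ : ℝ → Space3 → ℝ), IsSlabDensity T M σ ∧
      (∀ᵐ t ∂(volume.restrict (Ioo 0 T)), σ t =ᵐ[volume] fun y => ρ t y - ρb y) ∧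
      ∀ᵐ p ∂(slabMeasure T), -(Cb : ℝ) ≤ kconv newtonKernel (σ p.1) p.2 := by
  obtain ⟨v, hv, hvM, hv0, hvρ⟩ := exists_slab_representative hρ
    (M := (normLinftyLq T 1 ρ).toNNReal) (by rw [ENNReal.coe_toNNReal hρ.2.ne])
  set b : Space3 → ℝ := hρb.1.mk _
  have hb : Measurable b := hρb.1.stronglyMeasurable_mk.measurable
  have hbρ : ρb =ᵐ[volume] b := hρb.1.ae_eq_mk
  have hbi : ∫⁻ y, ‖b y‖ₑ = eLpNorm ρb 1 volume := by
    rw [eLpNorm_congr_ae hbρ, eLpNorm_one_eq_lintegral_enorm]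
  set M₁ := (normLinftyLq T 1 ρ).toNNReal
  set M₂ := (eLpNorm ρb 1 volume).toNNReal
  have hbi' : ∫⁻ y, ‖b y‖ₑ = M₂ := by rw [hbi, ENNReal.coe_toNNReal hρb.2.ne]
  set σ : ℝ → Space3 → ℝ := fun t y => (Ioo 0 T).indicator (fun t => max (v t y) 0 - b y) t
  have hvm : ∀ t, Measurable (v t) := fun t => hv.measurable.comp measurable_prodMk_left
  have hσT : ∀ t ∈ Ioo 0 T, σ t = fun y => max (v t y) 0 - b y := fun t ht => by
    ext y; exact indicator_of_mem ht _
  have hσ0 : ∀ t, t ∉ Ioo 0 T → σ t = 0 := fun t ht => by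
    ext y; exact indicator_of_notMem ht _
  have hmax : ∀ t, ∫⁻ y, ‖max (v t y) 0‖ₑ ≤ M₁ := fun t => by
    refine (lintegral_mono fun y => ?_).trans (hvM t)
    rw [← ofReal_norm, ← ofReal_norm]
    refine ENNReal.ofReal_le_ofReal ?_
    rw [Real.norm_of_nonneg (le_max_right _ _)]
    exact max_le (le_abs_self _) (norm_nonneg _)
  have hσ : IsSlabDensity T (M₁ + M₂) σ := by
    refine ⟨?_, fun t => ?_, hσ0⟩
    · have h1 : Measurable fun p : ℝ × Space3 => max (v p.1 p.2) 0 - b p.2 :=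
        (hv.measurable.max measurable_const).sub (hb.comp measurable_snd)
      exact h1.indicator (measurable_fst measurableSet_Ioo)
    · by_cases ht : t ∈ Ioo 0 T
      · rw [hσT t ht]
        calc ∫⁻ y, ‖max (v t y) 0 - b y‖ₑ
            ≤ ∫⁻ y, (‖max (v t y) 0‖ₑ + ‖b y‖ₑ) := lintegral_mono fun y => enorm_sub_le
          _ = (∫⁻ y, ‖max (v t y) 0‖ₑ) + ∫⁻ y, ‖b y‖ₑ := lintegral_add_right _ hb.enorm
          _ ≤ _ := by
            rw [hbi']; push_cast
            gcongr
            exact hmax t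
      · simp [hσ0 t ht]
  refine ⟨M₁ + M₂, σ, hσ, ?_, ?_⟩
  · filter_upwards [hvρ, Measure.ae_ae_of_ae_prod hρ0, ae_restrict_mem measurableSet_Ioo]
      with t h1 h2 ht
    rw [hσT t ht]
    filter_upwards [h1, h2, hbρ] with y hy1 hy2 hy3
    rw [hy1, hy3, max_eq_left hy2]
  · have hk := isPotentialKernel_newtonKernel
    have hmeas : MeasurableSet {p : ℝ × Space3 | -(Cb : ℝ) ≤ kconv newtonKernel (σ p.1) p.2} :=
      measurableSet_le measurable_const (hσ.measurable_kconv hk)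
    refine (Measure.ae_prod_iff_ae_ae hmeas).2 ?_
    filter_upwards [ae_restrict_mem measurableSet_Ioo] with t ht
    have hmm : Measurable fun y => max (v t y) 0 := (hvm t).max measurable_const
    have hb1 : ∀ᵐ x, kconv newtonKernel b x ≤ Cb := by
      rw [← kconv_congr_ae hbρ, ← newtonPotential_eq_kconv]
      filter_upwards [ae_le_eLpNormEssSup (f := newtonPotential ρb) (μ := volume)] with x hx
      rw [eLpNorm_exponent_top] at hCb
      have h1 := hx.trans hCb
      rw [← ofReal_norm, ← ENNReal.ofReal_coe_nnreal,
        ENNReal.ofReal_le_ofReal_iff NNReal.zero_le_coe] at h1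
      exact (le_abs_self _).trans h1
    filter_upwards [hb1, hk.ae_lintegral_conv_lt_top hb (by rw [hbi']; exact ENNReal.coe_lt_top),
      hk.ae_lintegral_conv_lt_top hmm ((hmax t).trans_lt ENNReal.coe_lt_top)] with x h1 h2 h3
    have h4 : kconv newtonKernel (σ t) x =
        kconv newtonKernel (fun y => max (v t y) 0) x - kconv newtonKernel b x := by
      rw [hσT t ht]
      simp only [kconv, sub_mul]
      exact integral_sub (hk.integrable_mul_translate hmm h3) (hk.integrable_mul_translate hb h2)
    have h5 : 0 ≤ kconv newtonKernel (fun y => max (v t y) 0) x :=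
      integral_nonneg fun y => mul_nonneg (le_max_right _ _) (newtonKernel_nonneg _)
    simp only [h4]
    linarith

lemma exists_isFieldPotential : ∃ C : ℝ≥0, ∀ {T : ℝ} {CE CJ Cb : ℝ≥0} {ρ : ℝ → Space3 → ℝ}
    {ρb : Space3 → ℝ} {Ef J : ℝ → Space3 → Space3}, MemLinftyLq T 1 ρ →
    (∀ᵐ p ∂(slabMeasure T), 0 ≤ ρ p.1 p.2) → MemLp ρb 1 volume →
    (∀ᵐ p ∂(slabMeasure T), Ef p.1 p.2 = coulombField (fun y => ρ p.1 y - ρb y) p.2) →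
    MemLinftyLq T 1 J → IsWeakTimeDerivEq T Ef J → normLinftyLq T 2 Ef ≤ CE →
    normLinftyLq T 1 J ≤ CJ → eLpNorm (newtonPotential ρb) ⊤ volume ≤ Cb →
    ∃ U F E j, IsFieldPotential T (C * CE) CJ Cb Ef U F E j := by
  obtain ⟨C, hC⟩ := exists_measure_potential_gt_le
  refine ⟨C, fun {T CE CJ Cb ρ ρb Ef J} hρ hρ0 hρb hEf hJ hweak hCE hCJ hCb => ?_⟩
  obtain ⟨M, σ, hσ, hσρ, hlow⟩ := exists_density_representative hρ hρ0 hρb hCb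
  obtain ⟨v, hv, hvM, hv0, hvJ⟩ := exists_slab_representative hJ hCJ
  have hkN := isPotentialKernel_newtonKernel
  have hkK := isPotentialKernel_norm_coulombKernel
  set U : ℝ × Space3 → ℝ := fun p => kconv newtonKernel (σ p.1) p.2
  set E : Fin 3 → ℝ × Space3 → ℝ := fun i p => kconv (fun x => coulombKernel x i) (σ p.1) p.2
  set F : ℝ × Space3 → ℝ := fun p => invLaplacianDiv (v p.1) p.2
  set j : ℝ → Space3 → ℝ := fun t y => ‖v t y‖
  have hj : IsSlabDensity T CJ j := by
    refine ⟨hv.measurable.norm, fun t => by simpa [j] using hvM t, fun t ht => ?_⟩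
    ext y
    simp [j, hv0 t ht]
  have hFle : ∀ p, ‖F p‖ₑ ≤ absPot (fun x => ‖coulombKernel x‖) j p := fun p =>
    enorm_invLaplacianDiv_le _ _
  have hFm : Measurable F := by
    have h1 : StronglyMeasurable fun q : (ℝ × Space3) × Space3 =>
        -inner ℝ (coulombKernel (q.1.2 - q.2)) (v q.1.1 q.2) := by
      have h2 : Measurable fun q : (ℝ × Space3) × Space3 => coulombKernel (q.1.2 - q.2) :=
        measurable_coulombKernel.comp ((measurable_snd.comp measurable_fst).sub measurable_snd)
      have h3 : Measurable fun q : (ℝ × Space3) × Space3 => v q.1.1 q.2 :=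
        hv.measurable.comp ((measurable_fst.comp measurable_fst).prodMk measurable_snd)
      exact (h2.inner h3).neg.stronglyMeasurable
    exact h1.integral_prod_right.measurable
  have hU : VanishesInMean U := hσ.vanishesInMean_kconv hkN
  have hF : VanishesInMean F := hj.vanishesInMean hkK hFm hFle
  have hE : ∀ i, VanishesInMean (E i) := fun i =>
    hσ.vanishesInMean_kconv (isPotentialKernel_coulombKernel i)
  have hfield : ∀ᵐ p ∂(slabMeasure T), ∀ i, Ef p.1 p.2 i = E i p := by
    have hfin : ∀ᵐ p ∂(slabMeasure T), absPot (fun x => ‖coulombKernel x‖) σ p < ∞ := by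
      refine (Measure.ae_prod_iff_ae_ae
        (measurableSet_lt (hσ.measurable_absPot hkK) measurable_const)).2 (ae_of_all _ fun t => ?_)
      exact hkK.ae_lintegral_conv_lt_top (hσ.measurable_time t) (hσ.lintegral_lt_top t)
    filter_upwards [hEf, ae_slabMeasure_of_ae_time hσρ, hfin] with p h1 h2 h3 i
    rw [h1, ← coulombField_congr_ae h2]
    exact coulombField_apply (hσ.measurable_time p.1) h3 i
  have hF0 : ∀ p : ℝ × Space3, p.1 ∉ Ioo 0 T → F p = 0 := fun p hp => by
    simp [F, invLaplacianDiv, hv0 _ hp]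
  have hE0 : ∀ i, ∀ p : ℝ × Space3, p.1 ∉ Ioo 0 T → E i p = 0 := fun i p hp => by
    simp [E, kconv, hσ.eq_zero _ hp]
  have hgrad : ∀ φ : ℝ × Space3 → ℝ, ContDiff ℝ 1 φ → HasCompactSupport φ → ∀ i,
      ∫ p, U p * fderiv ℝ φ p (0, EuclideanSpace.single i 1) = ∫ p, E i p * φ p :=
    fun φ hφ hφc i => hσ.integral_potential_mul_fderiv hφ hφc i
  refine ⟨U, F, E, j, ⟨hU, hF, hE, hgrad, fun φ hφ hφc hφs => ?_⟩, hfield, hlow, ?_, hj, hFle⟩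
  · refine integral_mul_fderiv_time_eq hU hF hgrad (fun φ hφ hφc hφs i => ?_) hφ hφc hφs
    have h1 := hweak φ hφ hφc hφs i
    rw [← integral_slabMeasure (T := T) fun p hp => by rw [hE0 i p hp, zero_mul],
      ← integral_slabMeasure (T := T) fun p hp => by rw [hF0 p hp, zero_mul]]
    convert h1 using 1
    · exact integral_congr_ae (hfield.mono fun p hp => by simp only [hp])
    · refine integral_congr_ae ((ae_slabMeasure_of_ae_time hvJ).mono fun p hp => ?_)
      simp only [F, invLaplacianDiv_congr_ae hp]
  · filter_upwards [Measure.ae_ae_of_ae_prod hfield, ae_eLpNorm_le_of_normLinftyLq_le hCE]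
      with t h1 h2 a ha
    set E' : Space3 → Space3 := fun x => WithLp.toLp 2 fun i => E i (t, x)
    have hE' : Measurable E' := by
      refine (WithLp.measurable_toLp 2 _).comp (measurable_pi_lambda _ fun i => ?_)
      exact (hE i).measurable.comp measurable_prodMk_left
    have hEE : E' =ᵐ[volume] Ef t := by
      filter_upwards [h1] with x hx
      ext i
      exact (hx i).symm
    exact_mod_cast hC (σ t) E' CE (hσ.measurable_time t) (hσ.lintegral_lt_top t) hE'
      (fun i => ae_of_all _ fun x => rfl) ((eLpNorm_congr_ae hEE).trans_le h2) a ha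

/-! ### Superlevels of the flow -/

lemma phaseNorm_eq (z : Phase) : phaseNorm z = √(‖z.1‖ ^ 2 + ‖z.2‖ ^ 2) :=
  WithLp.prod_norm_eq_of_L2 _

lemma norm_fst_le_phaseNorm (z : Phase) : ‖z.1‖ ≤ phaseNorm z := by
  rw [phaseNorm_eq]
  exact Real.le_sqrt_of_sq_le (by nlinarith [sq_nonneg ‖z.2‖])

lemma norm_snd_le_phaseNorm (z : Phase) : ‖z.2‖ ≤ phaseNorm z := by
  rw [phaseNorm_eq]
  exact Real.le_sqrt_of_sq_le (by nlinarith [sq_nonneg ‖z.1‖])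

lemma phaseNorm_le_add (z : Phase) : phaseNorm z ≤ ‖z.1‖ + ‖z.2‖ := by
  rw [phaseNorm_eq]
  refine Real.sqrt_le_iff.2 ⟨by positivity, ?_⟩
  nlinarith [mul_nonneg (norm_nonneg z.1) (norm_nonneg z.2)]

lemma measurableSet_phaseBall (r : ℝ) : MeasurableSet (phaseBall r) := by
  have : phaseBall r = {z : Phase | √(‖z.1‖ ^ 2 + ‖z.2‖ ^ 2) < r} := by
    ext z; simp only [phaseBall, mem_ofPred_eq, phaseNorm_eq]
  rw [this]
  exact measurableSet_lt (by fun_prop) measurable_const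

lemma volume_phaseBall_lt_top (r : ℝ) : volume (phaseBall r) < ∞ := by
  refine (measure_mono fun z hz => ?_).trans_lt
    (measure_ball_lt_top (x := (0 : Phase)) (r := r))
  have hz' : phaseNorm z < r := hz
  rw [mem_ball_zero_iff, Prod.norm_def]
  exact max_lt ((norm_fst_le_phaseNorm z).trans_lt hz') ((norm_snd_le_phaseNorm z).trans_lt hz')

lemma IsTrajectory.norm_position_le {E : Fin 3 → ℝ × Space3 → ℝ} {t T y : ℝ} {β : ℝ → Phase}
    (hβ : IsTrajectory E t T β) (ht : 0 ≤ t) (hy : ∀ s ∈ Icc t T, ‖(β s).2‖ ≤ y) {s : ℝ}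
    (hs : s ∈ Icc t T) : ‖(β s).1‖ ≤ ‖(β t).1‖ + T * y := by
  have hy0 : 0 ≤ y := (norm_nonneg _).trans (hy s hs)
  rw [hβ.position s hs]
  refine (norm_add_le _ _).trans (add_le_add le_rfl ?_)
  refine (intervalIntegral.norm_integral_le_of_norm_le_const (C := y) fun τ hτ => ?_).trans ?_
  · rw [uIoc_of_le hs.1] at hτ
    exact hy τ ⟨hτ.1.le, hτ.2.trans hs.2⟩
  · rw [abs_of_nonneg (by linarith [hs.1]), mul_comm]
    exact mul_le_mul_of_nonneg_right (by linarith [hs.2]) hy0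

/-- A trajectory which starts in `B_r` and leaves the ball of radius `ℓ` has a velocity above
`(ℓ - r) / (T + 1)` at some time after the initial one. -/
lemma IsTrajectory.exists_lt_norm_velocity {E : Fin 3 → ℝ × Space3 → ℝ} {t T r ℓ : ℝ}
    {β : ℝ → Phase} (hβ : IsTrajectory E t T β) (ht : 0 ≤ t) (htT : t < T)
    (hr : phaseNorm (β t) < r) (hℓ : ∃ s ∈ Icc t T, ℓ < phaseNorm (β s)) :
    ∃ s ∈ Ioc t T, (ℓ - r) / (T + 1) < ‖(β s).2‖ := by
  set y := (ℓ - r) / (T + 1)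
  by_contra! hcon
  have hmem : t ∈ Icc t T := left_mem_Icc.2 htT.le
  have ht0 : ‖(β t).2‖ ≤ y := by
    have h1 : Tendsto (fun s => ‖(β s).2‖) (𝓝[>] t) (𝓝 ‖(β t).2‖) := by
      have h2 : ContinuousWithinAt (fun s => ‖(β s).2‖) (Icc t T) t :=
        ((continuous_snd.comp_continuousOn hβ.continuousOn).norm) t hmem
      rw [← nhdsWithin_Ioc_eq_nhdsGT htT]
      exact h2.mono Ioc_subset_Icc_self
    refine le_of_tendsto h1 ?_
    rw [← nhdsWithin_Ioc_eq_nhdsGT htT]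
    exact eventually_mem_nhdsWithin.mono hcon
  have hall : ∀ s ∈ Icc t T, ‖(β s).2‖ ≤ y := fun s hs => by
    rcases hs.1.eq_or_lt with rfl | h
    · exact ht0
    · exact hcon s ⟨h, hs.2⟩
  obtain ⟨s, hs, hsℓ⟩ := hℓ
  have h1 := hβ.norm_position_le ht hall hs
  have h2 := hall s hs
  have h3 := phaseNorm_le_add (β s)
  have h4 := norm_fst_le_phaseNorm (β t)
  have h5 : y * (T + 1) = ℓ - r := div_mul_cancel₀ _ (by linarith)
  nlinarith

/-- A property of almost every time holds along a sequence of times decreasing to a given one. -/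
lemma exists_seq_tendsto_of_ae {t T : ℝ} (htT : t < T) {P : ℝ → Prop}
    (hP : ∀ᵐ s ∂(volume.restrict (Ioo t T)), P s) :
    ∃ s : ℕ → ℝ, Tendsto s atTop (𝓝[>] t) ∧ ∀ n, s n ∈ Ioo t T ∧ P (s n) := by
  have hfreq : ∃ᶠ s in 𝓝[>] t, s ∈ Ioo t T ∧ P s := by
    intro hev
    obtain ⟨u, hu, hsub⟩ := (mem_nhdsGT_iff_exists_Ioo_subset (a := t)).1 hev
    have hu' : t < min u T := lt_min hu htT
    have h0 : volume (Ioo t (min u T)) = 0 := by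
      refine measure_mono_null (fun s hs => ?_)
        (ae_iff.1 ((ae_restrict_iff' measurableSet_Ioo).1 hP))
      have h1 := hsub ⟨hs.1, hs.2.trans_le (min_le_left _ _)⟩
      have h2 : s ∈ Ioo t T := ⟨hs.1, hs.2.trans_le (min_le_right _ _)⟩
      exact fun h => h1 ⟨h2, h h2⟩
    rw [Real.volume_Ioo, ENNReal.ofReal_eq_zero] at h0
    linarith
  exact exists_seq_forall_of_frequently hfreq

namespace IsRegularLagrangianFlow

variable {t T : ℝ} {L A CJ Cb : ℝ≥0} {Z : ℝ → Phase → Phase} {Ef : ℝ → Space3 → Space3}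
  {U F : ℝ × Space3 → ℝ} {E : Fin 3 → ℝ × Space3 → ℝ} {j : ℝ → Space3 → ℝ}

/-- The kinetic energy along almost every trajectory grows at most by the energy at the time `s₁`
and by an integral which is controlled by the compressibility of the flow. -/
lemma ae_logGrowth_le (hZ : IsRegularLagrangianFlow (vlasovField Ef) t T L Z)
    (h : IsFieldPotential T A CJ Cb Ef U F E j) (ht : 0 ≤ t) {s₁ : ℝ} (hs₁ : s₁ ∈ Ioo t T)
    (hU₁ : ∀ᵐ x, Tendsto (fun n => mollify volume n U (s₁, x)) atTop (𝓝 (U (s₁, x)))) :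
    ∀ᵐ z, 1 ≤ 1 + Cb + (‖(Z s₁ z).2‖ ^ 2 / 2 + U (s₁, (Z s₁ z).1)) ∧
      ∀ s ∈ Icc s₁ T, ENNReal.ofReal (logGrowth (1 + ‖(Z s z).2‖ ^ 2 / 2)) ≤
        ENNReal.ofReal
          (logGrowth (1 + Cb + (‖(Z s₁ z).2‖ ^ 2 / 2 + U (s₁, (Z s₁ z).1)))) +
        ∫⁻ τ in Icc t T, (nearPot j (τ, Z τ z) + 6 * CJ) := by
  have htT : t ≤ T := (hs₁.1.trans hs₁.2).le
  have hsub : Icc s₁ T ⊆ Icc t T := Icc_subset_Icc_left hs₁.1.le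
  filter_upwards [hZ.ae_energy_identity h.isPotentialOf ht h.field_eq hs₁ hU₁,
    hZ.ae_continuousOn, hZ.ae_ae_comp_position ht htT h.lower_bound] with z ⟨hF, hen⟩ hc hlow
  have hle : ∀ᵐ s ∂(volume.restrict (Icc s₁ T)), 1 + ‖(Z s z).2‖ ^ 2 / 2 ≤
      1 + Cb + (‖(Z s₁ z).2‖ ^ 2 / 2 + U (s₁, (Z s₁ z).1)) - ∫ τ in s₁..s, F (τ, (Z τ z).1) := by
    filter_upwards [ae_restrict_of_ae_restrict_of_subset hsub hen,
      ae_restrict_of_ae_restrict_of_subset hsub hlow, ae_restrict_mem measurableSet_Icc]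
      with s h1 h2 h3
    have := h1 h3.1
    linarith
  have hcV : ContinuousOn (fun s => 1 + ‖(Z s z).2‖ ^ 2 / 2) (Icc s₁ T) := by
    have h1 : ContinuousOn (fun s => ‖(Z s z).2‖) (Icc s₁ T) :=
      ((continuous_snd.comp_continuousOn hc).norm).mono hsub
    exact ((h1.pow 2).div_const 2).const_add 1
  obtain ⟨h1, h2⟩ := ofReal_logGrowth_le hs₁.2 (hF.mono_set hsub) hcV
    (fun s _ => one_le_energy _) hle
  refine ⟨h1, fun s hs => (h2 s hs).trans (add_le_add le_rfl ?_)⟩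
  refine (lintegral_mono_set hsub).trans (lintegral_mono fun τ => ?_)
  calc ‖F (τ, (Z τ z).1)‖ₑ * ENNReal.ofReal (logWeight (1 + ‖(Z τ z).2‖ ^ 2 / 2))
      ≤ absPot (fun x => ‖coulombKernel x‖) j (τ, (Z τ z).1) *
          ENNReal.ofReal (velWeight (Z τ z).2) := by
        gcongr
        · exact h.source_le _
        · rfl
    _ ≤ _ := absPot_mul_velWeight_le h.isSlabDensity (τ, Z τ z)

lemma setLIntegral_nearPot_le {c : ℝ≥0} {b : ℝ → Phase → Phase}
    (hZ : IsRegularLagrangianFlow b t T L Z)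
    (hj : IsSlabDensity T CJ j) (hc : ∀ t, ∫⁻ z, nearPot j (t, z) ≤ c * CJ) (ht : 0 ≤ t)
    (htT : t ≤ T) (B : Set Phase) :
    ∫⁻ z in B, ∫⁻ τ in Icc t T, (nearPot j (τ, Z τ z) + 6 * CJ) ≤
      (L * (c * CJ) + 6 * CJ * volume B) * ENNReal.ofReal T := by
  have hvol : volume (Icc t T) ≤ ENNReal.ofReal T := by
    rw [Real.volume_Icc]
    exact ENNReal.ofReal_le_ofReal (by linarith)
  calc ∫⁻ z in B, ∫⁻ τ in Icc t T, (nearPot j (τ, Z τ z) + 6 * CJ)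
      = (∫⁻ z in B, ∫⁻ τ in Icc t T, nearPot j (τ, Z τ z)) +
          6 * CJ * volume (Icc t T) * volume B := by
        simp_rw [lintegral_add_right _ measurable_const, setLIntegral_const]
    _ ≤ L * (∫⁻ τ in Icc t T, ∫⁻ z, nearPot j (τ, z)) + 6 * CJ * volume (Icc t T) * volume B := by
        gcongr
        exact (setLIntegral_le_lintegral _ _).trans
          (hZ.lintegral_lintegral_comp_le htT (measurable_nearPot hj))
    _ ≤ L * (c * CJ * ENNReal.ofReal T) + 6 * CJ * ENNReal.ofReal T * volume B := by
        gcongr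
        calc ∫⁻ τ in Icc t T, ∫⁻ z, nearPot j (τ, z)
            ≤ ∫⁻ _ in Icc t T, (c * CJ : ℝ≥0∞) := lintegral_mono fun τ => hc τ
          _ = c * CJ * volume (Icc t T) := setLIntegral_const _ _
          _ ≤ _ := by gcongr
    _ = _ := by ring

/-- The estimate of the superlevels. A trajectory which leaves the ball of radius `ℓ` either has a
large weighted integral of the source, or has a large potential at almost every time close to the
initial one. The first set is small by Chebyshev's inequality, the second by the Sobolev
inequality. -/
lemma volume_phaseBall_diff_flowSublevel_le {c : ℝ≥0}
    (hZ : IsRegularLagrangianFlow (vlasovField Ef) t T L Z)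
    (h : IsFieldPotential T A CJ Cb Ef U F E j) (hc : ∀ t, ∫⁻ z, nearPot j (t, z) ≤ c * CJ)
    (ht : 0 ≤ t) (htT : t < T) {r ℓ m a : ℝ} (hrℓ : r ≤ ℓ)
    (hm : m = logGrowth (1 + ((ℓ - r) / (T + 1)) ^ 2 / 2)) (ha : 0 < a)
    (ham : a = m / 2 - (3 + Cb + (r + 1) ^ 2 / 2)) :
    volume (phaseBall r \ flowSublevel t T Z ℓ) ≤
      (L * (c * CJ) + 6 * CJ * volume (phaseBall r)) * ENNReal.ofReal T / ENNReal.ofReal (m / 2) +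
        L * ((A / ENNReal.ofReal a) ^ (6 : ℝ) * volume (Metric.ball (0 : Space3) (r + 1))) := by
  have hmpos : 0 < m / 2 := by
    have := sq_nonneg (r + 1)
    have := Cb.coe_nonneg
    linarith
  have hsub : Ioo t T ⊆ Ioo 0 T := Ioo_subset_Ioo_left ht
  set Q : Phase → ℝ≥0∞ := fun z => ∫⁻ τ in Icc t T, (nearPot j (τ, Z τ z) + 6 * CJ)
  have hQ : AEMeasurable Q volume := hZ.aemeasurable_lintegral_comp htT.le
    (f := fun q => nearPot j q + 6 * CJ) ((measurable_nearPot h.isSlabDensity).add_const _)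
  have hUae : ∀ᵐ s, ∀ᵐ x,
      Tendsto (fun n => mollify volume n U (s, x)) atTop (𝓝 (U (s, x))) := by
    have h1 := ae_tendsto_mollify (μ := (volume : Measure (ℝ × Space3)))
      h.isPotentialOf.potential.locallyIntegrable
    exact Measure.ae_ae_of_ae_prod h1
  obtain ⟨s, hst, hs⟩ := exists_seq_tendsto_of_ae htT
    ((ae_restrict_of_ae hUae).and (ae_restrict_of_ae_restrict_of_subset hsub h.superlevel))
  -- The initial points with a large potential and a bounded velocity at the time `s n`.
  set H : ℕ → Set Phase := fun n =>
    Z (s n) ⁻¹' ({x | 2 + a < U (s n, x)} ×ˢ Metric.ball (0 : Space3) (r + 1))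
  refine measure_le_of_ae_eventually
    (A := fun n => ({z | ENNReal.ofReal (m / 2) ≤ Q z} ∩ phaseBall r) ∪ H n)
    (Eventually.of_forall fun n => ?_) ?_
  · refine (measure_union_le _ _).trans (add_le_add ?_ ?_)
    · rw [← Measure.restrict_apply' (measurableSet_phaseBall r)]
      refine (meas_ge_le_lintegral_div hQ.restrict (by simpa using hmpos) ENNReal.ofReal_ne_top).trans
        ?_
      gcongr
      exact hZ.setLIntegral_nearPot_le h.isSlabDensity hc ht htT.le _
    · have hmeas : MeasurableSet {x | 2 + a < U (s n, x)} := measurableSet_lt measurable_const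
        (h.isPotentialOf.potential.measurable.comp measurable_prodMk_left)
      refine (hZ.compression (s n) (Ioo_subset_Icc_self (hs n).1) _
        (hmeas.prod Metric.isOpen_ball.measurableSet)).trans ?_
      rw [Measure.volume_eq_prod, Measure.prod_prod]
      gcongr
      exact (hs n).2.2 a ha
  · have hall := ae_all_iff.2 fun n => hZ.ae_logGrowth_le h ht (hs n).1 (hs n).2.1
    filter_upwards [hall, hZ.ae_isTrajectory ht htT.le h.field_eq, hZ.ae_initial htT.le]
      with z hz hβ h0 ⟨hzr, hzℓ⟩
    have hzr' : phaseNorm (Z t z) < r := by rw [h0]; exact hzr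
    obtain ⟨s', hs', hV⟩ := hβ.exists_lt_norm_velocity ht htT hzr' (by
      by_contra! hcon
      exact hzℓ (ae_restrict_of_forall_mem measurableSet_Icc hcon))
    have hlate : ∀ᶠ n in atTop, s n ≤ s' :=
      (hst.eventually (Ioo_mem_nhdsGT hs'.1)).mono fun n hn => hn.2.le
    -- The velocity is continuous, so it stays in the ball of radius `r + 1` for a short time.
    have hslow : ∀ᶠ n in atTop, ‖(Z (s n) z).2‖ < r + 1 := by
      have h1 : ContinuousWithinAt (fun s => ‖(Z s z).2‖) (Ioc t T) t :=
        (((continuous_snd.comp_continuousOn hβ.continuousOn).norm) t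
          (left_mem_Icc.2 htT.le)).mono Ioc_subset_Icc_self
      rw [ContinuousWithinAt, nhdsWithin_Ioc_eq_nhdsGT htT] at h1
      refine (h1.comp hst).eventually_lt_const ?_
      linarith [norm_snd_le_phaseNorm (Z t z)]
    filter_upwards [hlate, hslow] with n hn hVn
    obtain ⟨h1, h2⟩ := hz n
    have h3 := h2 s' ⟨hn, hs'.2⟩
    set κ : ℝ := 1 + Cb + (‖(Z (s n) z).2‖ ^ 2 / 2 + U (s n, (Z (s n) z).1)) with hκ
    by_cases hQz : ENNReal.ofReal (m / 2) ≤ Q z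
    · exact Or.inl ⟨hQz, hzr⟩
    refine Or.inr ⟨?_, by simpa using hVn⟩
    -- If the weighted integral is below `m / 2`, then `logGrowth κ` is above it.
    have hy : 0 ≤ (ℓ - r) / (T + 1) := div_nonneg (by linarith) (by linarith)
    have h4 : m ≤ logGrowth (1 + ‖(Z s' z).2‖ ^ 2 / 2) := by
      rw [hm]
      refine logGrowth_mono (by nlinarith [sq_nonneg ((ℓ - r) / (T + 1))]) ?_
      gcongr
    have h5 : m / 2 < logGrowth κ := by
      by_contra! hcon
      have h6 : ENNReal.ofReal m < ENNReal.ofReal (m / 2) + ENNReal.ofReal (m / 2) :=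
        ((ENNReal.ofReal_le_ofReal h4).trans h3).trans_lt
          (ENNReal.add_lt_add_of_le_of_lt ENNReal.ofReal_ne_top
            (ENNReal.ofReal_le_ofReal hcon) (not_le.1 hQz))
      rw [← ENNReal.ofReal_add hmpos.le hmpos.le, add_halves] at h6
      exact lt_irrefl _ h6
    have h7 : logGrowth κ ≤ κ := by
      have h8 := Real.log_nonneg h1
      have h9 := Real.log_le_sub_one_of_pos (show 0 < 1 + Real.log κ by linarith)
      have h10 := Real.log_le_sub_one_of_pos (show 0 < κ by linarith)
      rw [logGrowth]
      linarith
    have h11 : ‖(Z (s n) z).2‖ ^ 2 ≤ (r + 1) ^ 2 := by gcongr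
    simp only [mem_ofPred_eq]
    linarith

end IsRegularLagrangianFlow

/-! ### The bounding function -/

/-- The value of `logGrowth` at the energy that a trajectory from `B_r` to the exterior of the ball
of radius `ℓ` reaches. -/
def growthLevel (T r ℓ : ℝ) : ℝ := logGrowth (1 + ((ℓ - r) / (T + 1)) ^ 2 / 2)

lemma tendsto_growthLevel {T : ℝ} (hT : 0 < T) (r : ℝ) : Tendsto (growthLevel T r) atTop atTop := by
  refine tendsto_logGrowth.comp (tendsto_atTop_add_const_left _ _ ?_)
  refine Tendsto.atTop_div_const (by norm_num) ((tendsto_pow_atTop (by norm_num)).comp ?_)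
  exact (tendsto_atTop_add_const_right _ (-r) tendsto_id).atTop_div_const (by linarith)

/-- The bound for the measure of the superlevels as a function of `ℓ`: `D` is the bound of the
weighted integral of the source, `R` the volume of a ball of velocities, and `e` the part of
`growthLevel / 2` which is not available for the potential. -/
def superlevelBound (T : ℝ) (L A : ℝ≥0) (D R : ℝ≥0∞) (e r ℓ : ℝ) : ℝ≥0∞ :=
  D / ENNReal.ofReal (growthLevel T r ℓ / 2) +
    L * ((A / ENNReal.ofReal (growthLevel T r ℓ / 2 - e)) ^ (6 : ℝ) * R)

lemma superlevelBound_ne_top {T : ℝ} {L A : ℝ≥0} {D R : ℝ≥0∞} {e r ℓ : ℝ} (hD : D ≠ ∞)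
    (hR : R ≠ ∞) (he : 0 ≤ e) (ha : 0 < growthLevel T r ℓ / 2 - e) :
    superlevelBound T L A D R e r ℓ ≠ ∞ := by
  have hm : 0 < growthLevel T r ℓ / 2 := by linarith
  refine ENNReal.add_ne_top.2 ⟨ENNReal.div_ne_top hD (by simpa using hm), ?_⟩
  refine ENNReal.mul_ne_top ENNReal.coe_ne_top (ENNReal.mul_ne_top ?_ hR)
  exact ENNReal.rpow_ne_top_of_nonneg (by norm_num)
    (ENNReal.div_ne_top ENNReal.coe_ne_top (by simpa using ha))

lemma tendsto_superlevelBound {T : ℝ} (hT : 0 < T) {L A : ℝ≥0} {D R : ℝ≥0∞} (hD : D ≠ ∞)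
    (hR : R ≠ ∞) (e r : ℝ) : Tendsto (superlevelBound T L A D R e r) atTop (𝓝 0) := by
  have h1 : Tendsto (fun ℓ => growthLevel T r ℓ / 2) atTop atTop :=
    (tendsto_growthLevel hT r).atTop_div_const (by norm_num)
  have h2 : Tendsto (fun ℓ => growthLevel T r ℓ / 2 - e) atTop atTop :=
    tendsto_atTop_add_const_right _ (-e) h1
  have hdiv : ∀ {K : ℝ≥0∞}, K ≠ ∞ → ∀ {f : ℝ → ℝ}, Tendsto f atTop atTop →
      Tendsto (fun ℓ => K / ENNReal.ofReal (f ℓ)) atTop (𝓝 0) := fun {K} hK {f} hf => by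
    have := ENNReal.Tendsto.const_div (ENNReal.tendsto_ofReal_atTop.comp hf) (Or.inr hK)
    simpa using this
  have h3 := (ENNReal.continuous_rpow_const (y := 6)).tendsto 0 |>.comp
    (hdiv (K := A) ENNReal.coe_ne_top h2)
  rw [ENNReal.zero_rpow_of_pos (by norm_num)] at h3
  have h4 := ENNReal.Tendsto.const_mul (a := (L : ℝ≥0∞))
    (ENNReal.Tendsto.mul_const (b := R) h3 (Or.inr hR)) (Or.inr ENNReal.coe_ne_top)
  have h5 := (hdiv hD h1).add h4
  rw [zero_mul, mul_zero, add_zero] at h5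
  exact h5

end

theorem mainTheorem4 (T : ℝ) (hT : 0 < T) (L CE CJ Cb : ℝ≥0) :
    ∃ g : ℝ → ℝ → ℝ≥0,
      ∀ (ρ : ℝ → Space3 → ℝ) (ρb : Space3 → ℝ) (E J : ℝ → Space3 → Space3),
        MemLinftyLq T 1 ρ →
        (∀ᵐ p ∂(slabMeasure T), 0 ≤ ρ p.1 p.2) →
        MemLp ρb 1 volume →
        (∃ p : ℝ≥0∞, 3 / 2 < p ∧ MemLp ρb p volume) →
        (∀ᵐ p ∂(slabMeasure T), E p.1 p.2 = coulombField (fun y => ρ p.1 y - ρb y) p.2) →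
        MemLinftyLq T 2 E →
        MemLinftyLq T 1 J →
        IsWeakTimeDerivEq T E J →
        normLinftyLq T 2 E ≤ CE →
        normLinftyLq T 1 J ≤ CJ →
        eLpNorm (newtonPotential ρb) ⊤ volume ≤ Cb →
        ConditionR1a (vlasovField E) T L g := by
  obtain ⟨C, hC⟩ := exists_isFieldPotential
  obtain ⟨c, hc⟩ := exists_lintegral_nearPot_le
  set D : ℝ → ℝ≥0∞ := fun r =>
    (L * (c * CJ) + 6 * CJ * volume (phaseBall r)) * ENNReal.ofReal T
  set R : ℝ → ℝ≥0∞ := fun r => volume (Metric.ball (0 : Space3) (r + 1))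
  set e : ℝ → ℝ := fun r => 3 + Cb + (r + 1) ^ 2 / 2
  have hD : ∀ r, D r ≠ ∞ := fun r => by
    have := (volume_phaseBall_lt_top r).ne
    finiteness
  have hR : ∀ r, R r ≠ ∞ := fun r => measure_ball_lt_top.ne
  have he : ∀ r, 0 ≤ e r := fun r => by positivity
  -- The bound is meaningful only for large `ℓ`; elsewhere the volume of the ball serves.
  refine ⟨fun r ℓ => (if r ≤ ℓ ∧ 0 < growthLevel T r ℓ / 2 - e r then
    superlevelBound T L (C * CE) (D r) (R r) (e r) r ℓ else volume (phaseBall r)).toNNReal, ?_⟩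
  intro ρ ρb E J hρ hρ0 hρb _ hE _ hJ hweak hCE hCJ hCb
  refine ⟨fun r _ => ?_, fun t ht Z hZ r _ ℓ _ => ?_⟩
  · have h1 := (ENNReal.tendsto_toNNReal ENNReal.zero_ne_top).comp
      (tendsto_superlevelBound hT (L := L) (A := C * CE) (hD r) (hR r) (e r) r)
    refine h1.congr' ?_
    have h2 := ((tendsto_growthLevel hT r).atTop_div_const (r := 2) (by norm_num)).eventually_gt_atTop
      (e r)
    filter_upwards [h2, eventually_ge_atTop r] with ℓ h3 h4
    rw [Function.comp_apply, if_pos ⟨h4, by linarith⟩]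
  · beta_reduce
    split_ifs with h
    · obtain ⟨U, F, Ei, j, hpot⟩ := hC hρ hρ0 hρb hE hJ hweak hCE hCJ hCb
      rw [ENNReal.coe_toNNReal (superlevelBound_ne_top (hD r) (hR r) (he r) h.2)]
      exact hZ.volume_phaseBall_diff_flowSublevel_le hpot (hc T CJ j hpot.isSlabDensity) ht.1 ht.2
        h.1 rfl h.2 rfl
    · rw [ENNReal.coe_toNNReal (volume_phaseBall_lt_top r).ne]
      exact measure_mono sdiff_subset
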